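/- Let $N\in\{2,3,4,\dots\}\cup\{\mathbb N\}$. An $r$-polygon ($r>0$) in a metric space is a set whose distinct points are all at distance exactly $r$. Let $\mathcal K_N^{\prec}$ be the class of all finite ultrametric spaces with rational distances, all of whose polygons have size at most $N$ (no restriction for $N=\mathbb N$), equipped with a convex linear order, i.e. a linear order $\prec$ such that $x\prec y\prec z$ implies $d(x,y)\le d(x,z)$. A bijection between two ordered ultrametric spaces is an order-preserving bp-bijection if it preserves the order and maps balls $\{y: d(x,y)<r\}$, $r>0$, to balls, and so does its inverse; an order-preserving bp-injection is an order-preserving bp-bijection onto its range (with the induced metric and order). $\mathrm{BP}(X)$ denotes the group of order-preserving bp-bijections of $X$ onto itself, with the topology of pointwise convergence, $X$ being regarded as a discrete set. The ordered rational $N$-ultrametric Urysohn space $\mathbb U_N^{\prec}$ is the limit of $\mathcal K_N^{\prec}$ with order-preserving bp-injections as morphisms, i.e. a countable convexly ordered ultrametric space $X$ with rational distances and all polygons of size at most $N$ such that (i) every member of $\mathcal K_N^{\prec}$ admits an order-preserving bp-injection into $X$; (ii) $X$ is weakly ultrahomogeneous: for every finite $A\subseteq X$ there is a finite $A'$ with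 $A\subseteq A'\subseteq X$ such that, for every order-preserving bp-injection $f:A'\to X$, the restriction $f|_A$ extends to an element of $\mathrm{BP}(X)$. **Statement.** Such a space exists, and for every such space $X=\mathbb U_N^{\prec}$ the group $\mathrm{BP}(X)$ has a comeager conjugacy class but has no comeager $2$-diagonal conjugacy class, i.e. there is no pair $(g_1,g_2)\in \mathrm{BP}(X)^2$ for which $\{(k^{-1}g_1k,k^{-1}g_2k): k\in \mathrm{BP}(X)\}$ is comeager in $\mathrm{BP}(X)^2$. -/

import Mathlib

namespace OrdUltra

universe u v

/-- A ball in a metric space: a set `{y | dist y x < r}` with `r > 0`. -/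
def IsBall {X : Type u} [MetricSpace X] (s : Set X) : Prop :=
  ∃ (x : X) (r : ℝ), 0 < r ∧ s = Metric.ball x r

/-- An `r`-polygon: a set whose distinct points are all at distance exactly `r`. -/
def IsPolygon {X : Type u} [MetricSpace X] (r : ℝ) (P : Set X) : Prop :=
  ∀ x ∈ P, ∀ y ∈ P, x ≠ y → dist x y = r

/-- Convexly ordered ultrametric spaces with rational distances all of whose `r`-polygons have
size at most `N`; here `N = ⊤` stands for the countably infinite bound, which is no restriction
on countable spaces. The class `𝒦_N^≺` consists of the finite ones. -/
structure IsOrderedUltrametric (N : ℕ∞) (X : Type u) [MetricSpace X] [LinearOrder X] : Prop where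
  ultrametric : ∀ x y z : X, dist x z ≤ max (dist x y) (dist y z)
  rational : ∀ x y : X, ∃ q : ℚ, dist x y = (q : ℝ)
  convex : ∀ x y z : X, x < y → y < z → dist x y ≤ dist x z
  polygon : ∀ r : ℝ, 0 < r → ∀ P : Set X, IsPolygon r P → P.encard ≤ N

/-- An order-preserving bp-bijection: a bijection that is an isomorphism of the orders and under
which balls correspond to balls, in both directions. -/
def IsOrderedBP {X : Type u} {Y : Type v} [MetricSpace X] [LinearOrder X]
    [MetricSpace Y] [LinearOrder Y] (e : X ≃ Y) : Prop :=
  (∀ s : Set X, IsBall s ↔ IsBall (e '' s)) ∧ ∀ x y : X, x < y ↔ e x < e y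

/-- An order-preserving bp-injection: an order-preserving bp-bijection onto its range, the range
being equipped with the induced metric and order. -/
def IsOrderedBPInjection {X : Type u} {Y : Type v} [MetricSpace X] [LinearOrder X]
    [MetricSpace Y] [LinearOrder Y] (f : X → Y) : Prop :=
  ∃ h : Function.Injective f, IsOrderedBP (Equiv.ofInjective f h)

/-- The group `BP(X)` of order-preserving bp-automorphisms of an ordered ultrametric space. -/
def BP (X : Type u) [MetricSpace X] [LinearOrder X] : Subgroup (Equiv.Perm X) where
  carrier := {g | IsOrderedBP g}
  one_mem' := by
    refine ⟨fun s => ?_, fun x y => Iff.rfl⟩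
    simp
  mul_mem' := by
    rintro a b ⟨ha, ha'⟩ ⟨hb, hb'⟩
    refine ⟨fun s => ?_, fun x y => (hb' x y).trans (ha' _ _)⟩
    rw [hb s, ha (b '' s), Equiv.Perm.coe_mul, Set.image_comp]
  inv_mem' := by
    rintro a ⟨ha, ha'⟩
    refine ⟨fun s => ?_, fun x y => ?_⟩
    · have h : a '' ((a⁻¹ : Equiv.Perm X) '' s) = s := by
        rw [← Set.image_comp]
        simp
      rw [ha ((a⁻¹ : Equiv.Perm X) '' s), h]
    · rw [ha' ((a⁻¹ : Equiv.Perm X) x) ((a⁻¹ : Equiv.Perm X) y)]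
      simp

/-- The topology of pointwise convergence on `Sym(X)`, where `X` is regarded as a discrete set
(and not with the topology of its metric). -/
instance permTopology (X : Type u) : TopologicalSpace (Equiv.Perm X) :=
  TopologicalSpace.induced (fun (g : Equiv.Perm X) (x : X) => g x)
    (@Pi.topologicalSpace X (fun _ => X) (fun _ => ⊥))

/-- `X` is the ordered rational `N`-ultrametric Urysohn space: the limit of the class `𝒦_N^≺` with
order-preserving bp-injections as morphisms, i.e. a countable space of the same kind, in which
every member of the class embeds, and which is weakly ultrahomogeneous. -/
structure IsUrysohn (N : ℕ∞) (X : Type u) [MetricSpace X] [LinearOrder X] : Prop where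
  countable : Countable X
  ordered : IsOrderedUltrametric N X
  universal : ∀ (B : Type) [MetricSpace B] [LinearOrder B], Finite B → IsOrderedUltrametric N B →
    ∃ f : B → X, IsOrderedBPInjection f
  homogeneous : ∀ A : Set X, A.Finite → ∃ A' : Set X, A'.Finite ∧ A ⊆ A' ∧
    ∀ f : A' → X, IsOrderedBPInjection f → ∃ g ∈ BP X, ∀ a : A', (a : X) ∈ A → g a = f a

/-- The `n`-diagonal conjugacy class of a tuple `g ∈ Gⁿ`. -/
def diagonalClass {G : Type u} [Group G] {n : ℕ} (g : Fin n → G) : Set (Fin n → G) :=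
  {h | ∃ k : G, ∀ i, h i = k⁻¹ * g i * k}

/-- `G` has a comeager `n`-diagonal conjugacy class. -/
def HasComeagerDiagonalClass (n : ℕ) (G : Type u) [Group G] [TopologicalSpace G] : Prop :=
  ∃ g : Fin n → G, diagonalClass g ∈ residual (Fin n → G)

/-- `G` has a comeager conjugacy class. -/
def HasComeagerClass (G : Type u) [Group G] [TopologicalSpace G] : Prop :=
  ∃ g : G, conjugatesOf g ∈ residual G

end OrdUltra

namespace OrdUltra

open Set

universe u v w

/-! ### Ordered ultrametric spaces -/

namespace IsOrderedUltrametric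

variable {N : ℕ∞} {X : Type u} [MetricSpace X] [LinearOrder X]

/-! An ordered ultrametric space is an ordered tree: the nodes are the closed balls `{z | dist x z ≤
dist x u}`, and the branches at a node are convex. Between finite spaces, preserving balls and order
means preserving the order and the comparison of distances from a common point (`IsTreeEmb`), so the
actual values of the metric are irrelevant. If `N` is finite, every node of the limit has exactly
`N` branches and an automorphism cannot change the position of a branch. Partial isomorphisms
(`PIso`) therefore respect these positions (`lab`), and `col N y x` collects what the node of `x`
and `y` says about the two points.

The limit space. It is characterized by extension properties (`IsGeneric`): around each point every
color is dense among the levels, and a node is a dense unbounded order of branches, or is full if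
`N` is finite. They give one-point extensions of finite partial isomorphisms (`exists_extension`),
hence back and forth. A generic space is built from functions on the positive rationals, almost
equal to a fixed function, with the lexicographic order from the top level. Comparing an arbitrary
Urysohn space with this model shows that it is homogeneous too (`IsUrysohn.isHomogeneous`).

The comeager class. Locally an automorphism with a fixed point `y` acts on two kinds of dense
colored chains, the levels around `y` and, for `N = ⊤`, the branches at an invariant node. On such a
chain a generic action looks like a generic automorphism of the rationals: fixed points are dense
wherever no orbit interferes, and between two of them there are points moved up and points moved
down (`Chain.IsNice`). Generically, moreover, each moved point `a` has a fixed point within distance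
`dist a (f a)`. These conditions (`IsNiceAut`) are comeager. Any two automorphisms satisfying them
are conjugate, by a back and forth through invariant partial isomorphisms with finitely many orbits
(`Sys`): a fixed point capturing the new point is added first, and the new orbit is then placed on a
chain around the closest fixed point.

No comeager class of pairs. Let a pair fix `x` and let its first member move the level of `a` around
`x`. The comparison of the levels of all points `word t w a` is an invariant of the triple of the
pair, `x` and `a`, up to simultaneous conjugation. Against a fixed pair `g` only countably many such
comparisons occur. If the class of `g` were comeager, Baire's theorem would make the comparison
constant on some basic open set of pairs. But finitely many values never determine it: the orbit of
`a` climbs beyond the prescribed points below it, and where it first leaves them by one generator,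
the other generator can still move up or down (`IsHomogeneous.exists_undetermined`). -/

theorem dist_eq_right (h : IsOrderedUltrametric N X) {x y z : X} (hxy : dist x y < dist y z) :
    dist x z = dist y z := by
  apply le_antisymm
  · exact (h.ultrametric x y z).trans (max_le hxy.le le_rfl)
  · have := h.ultrametric y x z
    rw [dist_comm y x] at this
    rcases le_max_iff.1 this with h1 | h1
    · linarith
    · exact h1

theorem dist_eq_of_near (h : IsOrderedUltrametric N X) {x x' y : X}
    (hxx : dist x x' < dist x y) : dist x' y = dist x y := by
  rw [dist_comm] at hxx
  exact h.dist_eq_right hxx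

theorem dist_eq_max (h : IsOrderedUltrametric N X) {p q y : X} (hpq : dist p y ≤ dist p q) :
    dist p q = max (dist y p) (dist y q) := by
  apply le_antisymm
  · have := h.ultrametric p y q
    rwa [dist_comm p y] at this
  · apply max_le
    · rwa [dist_comm y p]
    · have := h.ultrametric y p q
      rw [dist_comm y p] at this
      exact this.trans (max_le hpq le_rfl)

theorem dist_left_le (h : IsOrderedUltrametric N X) {x y z : X} (hxy : x ≤ y) (hyz : y ≤ z) :
    dist x y ≤ dist x z := by
  rcases hxy.eq_or_lt with rfl | hxy
  · simp
  rcases hyz.eq_or_lt with rfl | hyz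
  · exact le_rfl
  exact h.convex x y z hxy hyz

theorem dist_right_le (h : IsOrderedUltrametric N X) {x y z : X} (hxy : x ≤ y) (hyz : y ≤ z) :
    dist y z ≤ dist x z := by
  have h1 := h.dist_left_le hxy hyz
  have h2 := h.ultrametric y x z
  rw [dist_comm y x] at h2
  exact h2.trans (max_le h1 le_rfl)

/-- Points at small mutual distance lie on the same side of a far point. -/
theorem lt_iff_of_near (h : IsOrderedUltrametric N X) {x x' y : X}
    (hxx : dist x x' < dist x y) : x < y ↔ x' < y := by
  have key : ∀ {x x' y : X}, dist x x' < dist x y → x < y → x' < y := by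
    intro x x' y hxx hxy
    by_contra hle
    have := h.dist_left_le hxy.le (not_lt.1 hle)
    linarith
  refine ⟨key hxx, key ?_⟩
  rw [h.dist_eq_of_near hxx, dist_comm]
  exact hxx

theorem gt_iff_of_near (h : IsOrderedUltrametric N X) {x x' y : X}
    (hxx : dist x x' < dist x y) : y < x ↔ y < x' := by
  have h1 : x ≠ y := by
    rintro rfl
    have := dist_nonneg (x := x) (y := x')
    simp at hxx
    linarith
  have h2 : x' ≠ y := by
    rintro rfl
    exact lt_irrefl _ hxx
  have := h.lt_iff_of_near hxx
  constructor
  · intro h3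
    exact lt_of_le_of_ne (not_lt.1 fun h4 => (this.2 h4).not_gt h3) h2.symm
  · intro h3
    exact lt_of_le_of_ne (not_lt.1 fun h4 => (this.1 h4).not_gt h3) h1.symm

theorem ball_eq (h : IsOrderedUltrametric N X) {x y : X} {r : ℝ} (hxy : dist x y < r) :
    Metric.ball x r = Metric.ball y r := by
  have key : ∀ {x y : X}, dist x y < r → Metric.ball x r ⊆ Metric.ball y r := by
    intro x y hxy z hz
    rw [Metric.mem_ball] at hz ⊢
    exact (h.ultrametric z x y).trans_lt (max_lt hz hxy)
  exact (key hxy).antisymm (key (by rwa [dist_comm]))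

end IsOrderedUltrametric

/-! ### Labels of branches -/

section Labels

variable {N : ℕ∞} {X : Type u} [MetricSpace X] [LinearOrder X]

/-- The branches to the left of `x` at the node of level `r` above `x`. -/
def leftBranches (x : X) (r : ℝ) : Set (Set X) :=
  {s | ∃ u, u < x ∧ dist u x = r ∧ s = Metric.ball u r}

open Classical in
/-- The number of branches to the left of `x` at the node spanned by `x` and `y`; it is not recorded
when branching is unbounded. -/
noncomputable def lab (N : ℕ∞) (x y : X) : ℕ :=
  if N = ⊤ then 0 else (leftBranches x (dist x y)).ncard

/-- The position of `x` as seen from `y`. -/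
noncomputable def col (N : ℕ∞) (y x : X) : ℕ × ℕ × Prop := (lab N y x, lab N x y, y < x)

/-- The positions which occur. -/
def colors (N : ℕ∞) : Set (ℕ × ℕ × Prop) :=
  {k | (N = ⊤ → k.1 = 0 ∧ k.2.1 = 0) ∧
    (N ≠ ⊤ → (k.1 : ℕ∞) < N ∧ (k.2.1 : ℕ∞) < N ∧ k.1 ≠ k.2.1 ∧ (k.2.2 ↔ k.1 < k.2.1))}

theorem leftBranches_congr (h : IsOrderedUltrametric N X) {x x' : X} {r : ℝ}
    (hx : dist x x' < r) : leftBranches x r = leftBranches x' r := by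
  have key : ∀ {x x' : X}, dist x x' < r → leftBranches x r ⊆ leftBranches x' r := by
    rintro x x' hx s ⟨u, hu, hur, rfl⟩
    rw [dist_comm u x] at hur
    have hx2 : dist x x' < dist x u := by rwa [hur]
    refine ⟨u, (h.gt_iff_of_near hx2).1 hu, ?_, rfl⟩
    rw [dist_comm, h.dist_eq_of_near hx2, hur]
  exact (key hx).antisymm (key (by rwa [dist_comm]))

theorem lab_congr_left (h : IsOrderedUltrametric N X) {x x' y : X} (hx : dist x x' < dist x y) :
    lab N x' y = lab N x y := by
  unfold lab
  rw [h.dist_eq_of_near hx, leftBranches_congr h hx]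

theorem lab_congr_right {x y z : X} (hx : dist x y = dist x z) : lab N x y = lab N x z := by
  unfold lab
  rw [hx]

theorem col_congr (h : IsOrderedUltrametric N X) {y x x' : X} (hx : dist x x' < dist y x) :
    col N y x' = col N y x := by
  have h1 : dist x x' < dist x y := by rwa [dist_comm x y]
  unfold col
  rw [lab_congr_left h h1, lab_congr_right (N := N) (x := y) (y := x') (z := x),
    propext (h.gt_iff_of_near h1)]
  rw [dist_comm y x', dist_comm y x, h.dist_eq_of_near h1]

theorem ball_ne_ball {X : Type u} [MetricSpace X] {x y : X} {r : ℝ} (hr : 0 < r) (h : dist x y = r) :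
    Metric.ball x r ≠ Metric.ball y r := by
  intro he
  have : x ∈ Metric.ball y r := he ▸ Metric.mem_ball_self hr
  rw [Metric.mem_ball, h] at this
  exact lt_irrefl _ this

/-- One representative of each left branch, together with `x` itself, forms an `r`-polygon; the
summand `1` accounts for `x`. -/
theorem encard_leftBranches (h : IsOrderedUltrametric N X) {x : X} {r : ℝ} (hr : 0 < r) :
    (leftBranches x r).encard + 1 ≤ N := by
  have : Nonempty X := ⟨x⟩
  choose! g hg using fun s (hs : s ∈ leftBranches x r) => hs
  have hinj : InjOn g (leftBranches x r) := by
    intro s hs t ht hst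
    rw [(hg s hs).2.2, (hg t ht).2.2, hst]
  have hx : x ∉ g '' leftBranches x r := by
    rintro ⟨s, hs, hsx⟩
    exact ((hg s hs).1).ne hsx
  rw [← hinj.encard_image, ← encard_insert_of_notMem hx]
  apply h.polygon r hr
  have main : ∀ s ∈ leftBranches x r, ∀ t ∈ leftBranches x r, g s ≠ g t →
      dist (g s) (g t) = r := by
    intro s hs t ht hst
    have h1 : dist (g s) (g t) ≤ r := by
      refine (h.ultrametric _ x _).trans (max_le (hg s hs).2.1.le ?_)
      rw [dist_comm]
      exact (hg t ht).2.1.le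
    refine h1.eq_of_not_lt fun h2 => hst ?_
    have : s = t := by rw [(hg s hs).2.2, (hg t ht).2.2, h.ball_eq h2]
    rw [this]
  rintro a (rfl | ⟨s, hs, rfl⟩) b (rfl | ⟨t, ht, rfl⟩) hab
  · exact absurd rfl hab
  · rw [dist_comm]
    exact (hg t ht).2.1
  · exact (hg s hs).2.1
  · exact main s hs t ht hab

theorem finite_leftBranches (h : IsOrderedUltrametric N X) (hN : N ≠ ⊤) {x : X} {r : ℝ}
    (hr : 0 < r) : (leftBranches x r).Finite := by
  have := encard_leftBranches h (x := x) hr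
  rw [← encard_lt_top_iff]
  exact (le_self_add.trans this).trans_lt (lt_top_iff_ne_top.2 hN)

theorem lab_lt (h : IsOrderedUltrametric N X) (hN : N ≠ ⊤) {x y : X} (hxy : x ≠ y) :
    (lab N x y : ℕ∞) < N := by
  have hr := dist_pos.2 hxy
  unfold lab
  rw [if_neg hN, (finite_leftBranches h hN hr).cast_ncard_eq]
  refine lt_of_lt_of_le ?_ (encard_leftBranches h (x := x) hr)
  exact ENat.lt_add_one_iff (encard_lt_top_iff.2 (finite_leftBranches h hN hr)).ne |>.2 le_rfl

theorem lab_top {x y : X} (hN : N = ⊤) : lab N x y = 0 := by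
  unfold lab
  rw [if_pos hN]

/-- The branch of `u` is to the left of `x` but not of `u`. Convexity keeps the branches to the left
of `u` at full distance from `x`. For finite `N` the order is thus encoded in the labels. -/
theorem leftBranches_ssubset (h : IsOrderedUltrametric N X) {u x : X} (hux : u < x) :
    leftBranches u (dist u x) ⊂ leftBranches x (dist u x) := by
  have hr := dist_pos.2 hux.ne
  have hmem : Metric.ball u (dist u x) ∈ leftBranches x (dist u x) := ⟨u, hux, rfl, rfl⟩
  refine ssubset_iff_of_subset ?_ |>.2 ⟨_, hmem, ?_⟩
  · rintro s ⟨v, hv, hvr, rfl⟩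
    refine ⟨v, hv.trans hux, le_antisymm ?_ ?_, rfl⟩
    · exact (h.ultrametric v u x).trans (max_le hvr.le le_rfl)
    · rw [← hvr]
      exact h.dist_left_le hv.le hux.le
  · rintro ⟨v, hv, hvr, he⟩
    exact ball_ne_ball hr hvr he.symm

theorem lab_lt_lab (h : IsOrderedUltrametric N X) (hN : N ≠ ⊤) {u x : X} (hux : u < x) :
    lab N u x < lab N x u := by
  unfold lab
  rw [if_neg hN, if_neg hN, dist_comm x u]
  exact ncard_lt_ncard (leftBranches_ssubset h hux)
    (finite_leftBranches h hN (dist_pos.2 hux.ne))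

theorem lt_iff_lab_lt (h : IsOrderedUltrametric N X) (hN : N ≠ ⊤) {u x : X} :
    u < x ↔ lab N u x < lab N x u := by
  refine ⟨lab_lt_lab h hN, fun h1 => ?_⟩
  by_contra h2
  rcases (not_lt.1 h2).eq_or_lt with rfl | h3
  · exact lt_irrefl _ h1
  · exact h1.not_gt (lab_lt_lab h hN h3)

theorem lab_ne (h : IsOrderedUltrametric N X) (hN : N ≠ ⊤) {u x : X} (hux : u ≠ x) :
    lab N u x ≠ lab N x u := by
  rcases lt_or_gt_of_ne hux with h1 | h1
  · exact (lab_lt_lab h hN h1).ne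
  · exact (lab_lt_lab h hN h1).ne'

theorem col_mem_colors (h : IsOrderedUltrametric N X) {y x : X} (hxy : y ≠ x) :
    col N y x ∈ colors N := by
  refine ⟨fun hN => ⟨lab_top hN, lab_top hN⟩, fun hN => ⟨lab_lt h hN hxy, lab_lt h hN hxy.symm,
    lab_ne h hN hxy, lt_iff_lab_lt h hN⟩⟩

/-- Labels can be read off from a polygon of maximal size. -/
theorem ncard_leftBranches_of_polygon (h : IsOrderedUltrametric N X) (hN : N ≠ ⊤) {x : X} {r : ℝ}
    (hr : 0 < r) {P : Set X} (hP : IsPolygon r P) (hPN : P.encard = N)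
    (hPx : ∀ p ∈ P, dist p x ≤ r) :
    (leftBranches x r).ncard = {p | p ∈ P ∧ p < x ∧ dist p x = r}.ncard := by
  have himg : leftBranches x r =
      (fun p => Metric.ball p r) '' {p | p ∈ P ∧ p < x ∧ dist p x = r} := by
    ext s
    constructor
    · rintro ⟨u, hu, hur, rfl⟩
      -- A polygon of maximal size meets every branch of its node: a branch missed by `P` would
      -- enlarge it to a polygon of size `N + 1`.
      obtain ⟨p, hp, hpu⟩ : ∃ p ∈ P, dist p u < r := by
        by_contra hcon
        push Not at hcon
        have hle : ∀ p ∈ P, dist p u = r := fun p hp =>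
          le_antisymm ((h.ultrametric p x u).trans (max_le (hPx p hp)
            (by rw [dist_comm, hur]))) (hcon p hp)
        have hu' : u ∉ P := fun hu' => by
          have := hcon u hu'
          simp at this
          linarith
        have h1 := h.polygon r hr (insert u P) (by
          rintro a (rfl | ha) b (rfl | hb) hab
          · exact absurd rfl hab
          · rw [dist_comm]; exact hle b hb
          · exact hle a ha
          · exact hP a ha b hb hab)
        rw [encard_insert_of_notMem hu', hPN] at h1
        exact (ENat.lt_add_one_iff hN |>.2 le_rfl).not_ge h1
      rw [dist_comm] at hpu
      have hpu' : dist u p < dist u x := by rwa [hur]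
      refine ⟨p, ⟨hp, (h.lt_iff_of_near hpu').1 hu, ?_⟩, h.ball_eq (by rwa [dist_comm])⟩
      rw [h.dist_eq_of_near hpu', hur]
    · rintro ⟨p, ⟨-, hpx, hpr⟩, rfl⟩
      exact ⟨p, hpx, hpr, rfl⟩
  rw [himg]
  refine InjOn.ncard_image fun p hp q hq hpq => ?_
  by_contra hne
  exact ball_ne_ball hr (hP p hp.1 q hq.1 hne) hpq

end Labels

/-! ### Maps respecting order and tree structure -/

section TreeEmb

variable {N : ℕ∞} {A : Type u} {B : Type v} [MetricSpace A] [LinearOrder A]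
  [MetricSpace B] [LinearOrder B]

/-- A map preserving and reflecting the order and the comparison of distances from a point. -/
def IsTreeEmb (f : A → B) : Prop :=
  (∀ x y, x < y ↔ f x < f y) ∧
    ∀ x y z, dist x y < dist x z ↔ dist (f x) (f y) < dist (f x) (f z)

theorem IsTreeEmb.injective {f : A → B} (hf : IsTreeEmb f) : Function.Injective f := by
  intro x y hxy
  by_contra hne
  rcases lt_or_gt_of_ne hne with h | h
  · exact ((hf.1 _ _).1 h).ne hxy
  · exact ((hf.1 _ _).1 h).ne hxy.symm

theorem IsTreeEmb.comp {C : Type w} [MetricSpace C] [LinearOrder C] {g : B → C} {f : A → B}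
    (hg : IsTreeEmb g) (hf : IsTreeEmb f) : IsTreeEmb (g ∘ f) :=
  ⟨fun x y => (hf.1 x y).trans (hg.1 _ _), fun x y z => (hf.2 x y z).trans (hg.2 _ _ _)⟩

theorem IsTreeEmb.symm {e : A ≃ B} (he : IsTreeEmb e) : IsTreeEmb e.symm := by
  refine ⟨fun x y => ?_, fun x y z => ?_⟩
  · rw [he.1]; simp
  · rw [he.2]; simp

theorem isTreeEmb_subtype (S : Set A) : IsTreeEmb (Subtype.val : S → A) :=
  ⟨fun _ _ => Iff.rfl, fun _ _ _ => Iff.rfl⟩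

theorem IsTreeEmb.dist_eq_iff {f : A → B} (hf : IsTreeEmb f) (x y z : A) :
    dist x y = dist x z ↔ dist (f x) (f y) = dist (f x) (f z) := by
  have h1 := hf.2 x y z
  have h2 := hf.2 x z y
  constructor
  · intro h
    exact le_antisymm (not_lt.1 fun h3 => (h2.2 h3).ne' h) (not_lt.1 fun h3 => (h1.2 h3).ne h)
  · intro h
    exact le_antisymm (not_lt.1 fun h3 => (h2.1 h3).ne' h) (not_lt.1 fun h3 => (h1.1 h3).ne h)

theorem IsOrderedUltrametric.subtype (h : IsOrderedUltrametric N A) (S : Set A) :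
    IsOrderedUltrametric N S where
  ultrametric x y z := h.ultrametric x y z
  rational x y := h.rational x y
  convex x y z := h.convex x y z
  polygon r hr P hP := by
    rw [← (Subtype.val_injective (p := fun x => x ∈ S)).encard_image]
    apply h.polygon r hr
    rintro _ ⟨a, ha, rfl⟩ _ ⟨b, hb, rfl⟩ hab
    exact hP a ha b hb fun he => hab (by rw [he])

/-- The inequality `dist x y < dist x z` says that some ball contains `x` and `y` but not `z`, which
is a statement about balls alone. -/
theorem IsOrderedBP.isTreeEmb (hA : IsOrderedUltrametric N A) (hB : IsOrderedUltrametric N B)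
    {e : A ≃ B} (he : IsOrderedBP e) : IsTreeEmb e := by
  refine ⟨he.2, fun x y z => ⟨fun h => ?_, fun h => ?_⟩⟩
  · have hr : 0 < dist x z := dist_nonneg.trans_lt h
    obtain ⟨c, r, -, hc⟩ := (he.1 (Metric.ball x (dist x z))).1 ⟨x, _, hr, rfl⟩
    have hx : e x ∈ Metric.ball c r := hc ▸ mem_image_of_mem e (Metric.mem_ball_self hr)
    have hy : e y ∈ Metric.ball c r := hc ▸ mem_image_of_mem e (by
      rwa [Metric.mem_ball, dist_comm])
    have hz : e z ∉ Metric.ball c r := by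
      rw [← hc]
      rintro ⟨w, hw, hwz⟩
      rw [e.injective hwz, Metric.mem_ball, dist_comm] at hw
      exact lt_irrefl _ hw
    rw [← hB.ball_eq (Metric.mem_ball.1 hx), Metric.mem_ball] at hy hz
    rw [dist_comm (e x), dist_comm (e x)]
    exact hy.trans_le (not_lt.1 hz)
  · have hr : 0 < dist (e x) (e z) := dist_nonneg.trans_lt h
    have him : e '' (e ⁻¹' Metric.ball (e x) (dist (e x) (e z))) =
      Metric.ball (e x) (dist (e x) (e z)) := e.image_preimage _
    obtain ⟨c, r, -, hc⟩ := (he.1 (e ⁻¹' Metric.ball (e x) (dist (e x) (e z)))).2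
      (by rw [him]; exact ⟨_, _, hr, rfl⟩)
    have hx : x ∈ Metric.ball c r := by
      rw [← hc]; exact Metric.mem_ball_self hr
    have hy : y ∈ Metric.ball c r := by
      rw [← hc, mem_preimage, Metric.mem_ball, dist_comm]; exact h
    have hz : z ∉ Metric.ball c r := by
      rw [← hc, mem_preimage, Metric.mem_ball, dist_comm]; exact lt_irrefl _
    rw [← hA.ball_eq (Metric.mem_ball.1 hx), Metric.mem_ball] at hy hz
    rw [dist_comm x, dist_comm x]
    exact hy.trans_le (not_lt.1 hz)

theorem IsOrderedBPInjection.isTreeEmb (hA : IsOrderedUltrametric N A)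
    (hB : IsOrderedUltrametric N B) {f : A → B} (hf : IsOrderedBPInjection f) : IsTreeEmb f := by
  obtain ⟨hinj, he⟩ := hf
  exact (isTreeEmb_subtype _).comp (he.isTreeEmb hA (hB.subtype _))

theorem isBall_image_of_finite [Finite A] {e : A ≃ B} (he : IsTreeEmb e) {s : Set A}
    (hs : IsBall s) : IsBall (e '' s) := by
  obtain ⟨x, r, hr, rfl⟩ := hs
  have hfin : (Metric.ball x r)ᶜ.Finite := toFinite _
  -- By finiteness the least distance from `e x` to the image of the complement serves as radius. If
  -- the complement is empty, any number above all distances from `e x` will do.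
  obtain ⟨r', hr', hlt, hge⟩ : ∃ r' : ℝ, 0 < r' ∧ (∀ v, dist x v < r → dist (e x) (e v) < r') ∧
      ∀ v, r ≤ dist x v → r' ≤ dist (e x) (e v) := by
    by_cases hne : (Metric.ball x r)ᶜ.Nonempty
    · obtain ⟨w, hw, hmin⟩ := hfin.exists_minimalFor (fun w => dist (e x) (e w)) _ hne
      have hw' : r ≤ dist x w := by
        rw [mem_compl_iff, Metric.mem_ball, not_lt, dist_comm] at hw
        exact hw
      refine ⟨dist (e x) (e w), ?_, fun v hv => (he.2 _ _ _).1 (hv.trans_le hw'), fun v hv => ?_⟩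
      · rw [dist_pos]
        intro h
        rw [e.injective h] at hw'
        simp at hw'
        linarith
      · have hv' : v ∈ (Metric.ball x r)ᶜ := by
          rw [mem_compl_iff, Metric.mem_ball, not_lt, dist_comm]
          exact hv
        rcases le_total (dist (e x) (e w)) (dist (e x) (e v)) with h | h
        · exact h
        · exact hmin hv' h
    · rw [not_nonempty_iff_eq_empty] at hne
      have hall : ∀ v, dist x v < r := by
        intro v
        by_contra hv
        have : v ∈ (Metric.ball x r)ᶜ := by
          rwa [mem_compl_iff, Metric.mem_ball, dist_comm]
        rw [hne] at this
        exact this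
      obtain ⟨w, -, hmax⟩ := (finite_univ (α := A)).exists_maximalFor
        (fun w => dist (e x) (e w)) _ ⟨x, mem_univ _⟩
      refine ⟨dist (e x) (e w) + 1, by positivity, fun v _ => ?_, fun v hv =>
        absurd (hall v) hv.not_gt⟩
      rcases le_total (dist (e x) (e w)) (dist (e x) (e v)) with h | h
      · have := hmax (mem_univ v) h
        simp only at this
        linarith
      · linarith
  refine ⟨e x, r', hr', ?_⟩
  ext z
  obtain ⟨v, rfl⟩ := e.surjective z
  rw [e.injective.mem_set_image, Metric.mem_ball, Metric.mem_ball, dist_comm, dist_comm (e v)]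
  exact ⟨hlt v, fun h => not_le.1 fun h' => (hge v h').not_gt h⟩

/-- On finite domains the two notions of embedding agree. On infinite ones a set cut out by a
comparison of distances need not be a ball, which is the concern of `NodeHom`. -/
theorem IsTreeEmb.isOrderedBPInjection [Finite A] {f : A → B} (hf : IsTreeEmb f) :
    IsOrderedBPInjection f := by
  have he : IsTreeEmb (Equiv.ofInjective f hf.injective) := ⟨hf.1, hf.2⟩
  refine ⟨hf.injective, fun s => ⟨isBall_image_of_finite he, fun hs => ?_⟩, he.1⟩
  have : Finite (range f) := finite_range f
  have := isBall_image_of_finite he.symm hs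
  rwa [Equiv.symm_image_image] at this

theorem leftBranches_image {e : A ≃ B} (he : IsTreeEmb e) (x y : A) :
    leftBranches (e x) (dist (e x) (e y)) = (fun s => e '' s) '' leftBranches x (dist x y) := by
  have hball : ∀ u, dist u x = dist x y →
      e '' Metric.ball u (dist x y) = Metric.ball (e u) (dist (e x) (e y)) := by
    intro u hu
    have hu' : dist (e u) (e x) = dist (e x) (e y) := by
      rw [dist_comm, ← he.dist_eq_iff, dist_comm, hu]
    ext z
    obtain ⟨v, rfl⟩ := e.surjective z
    rw [e.injective.mem_set_image, Metric.mem_ball, Metric.mem_ball, dist_comm, dist_comm (e v),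
      ← hu, ← hu', he.2]
  ext s
  constructor
  · rintro ⟨u', hu, hur, rfl⟩
    obtain ⟨u, rfl⟩ := e.surjective u'
    have hur' : dist u x = dist x y := by
      rw [dist_comm, he.dist_eq_iff, dist_comm, hur]
    exact ⟨_, ⟨u, (he.1 _ _).2 hu, hur', rfl⟩, hball u hur'⟩
  · rintro ⟨_, ⟨u, hu, hur, rfl⟩, rfl⟩
    refine ⟨e u, (he.1 _ _).1 hu, ?_, hball u hur⟩
    rw [dist_comm, ← he.dist_eq_iff, dist_comm, hur]

/-- Bijectivity matters: an embedding may miss branches of the target and so change labels. -/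
theorem lab_equiv {e : A ≃ B} (he : IsTreeEmb e) (x y : A) :
    lab N (e x) (e y) = lab N x y := by
  unfold lab
  rw [leftBranches_image he, ncard_image_of_injective _ e.injective.image_injective]

end TreeEmb

end OrdUltra

namespace OrdUltra

open Set

universe u v w

/-! ### Partial isomorphisms -/

section PIso

variable {N : ℕ∞} {A : Type u} {B : Type v} [MetricSpace A] [LinearOrder A]
  [MetricSpace B] [LinearOrder B]

/-- A relation which is a partial isomorphism for the order, the comparison of distances from a
point, and the labels of branches. -/
structure PIso (N : ℕ∞) (R : Set (A × B)) : Prop where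
  lt : ∀ p ∈ R, ∀ q ∈ R, p.1 < q.1 ↔ p.2 < q.2
  dist : ∀ p ∈ R, ∀ q ∈ R, ∀ r ∈ R,
    dist p.1 q.1 < dist p.1 r.1 ↔ dist p.2 q.2 < dist p.2 r.2
  lab : ∀ p ∈ R, ∀ q ∈ R, lab N p.1 q.1 = lab N p.2 q.2

theorem lab_self (x : A) : lab N x x = 0 := by
  unfold OrdUltra.lab
  split_ifs
  · rfl
  · have : leftBranches x (dist x x) = ∅ := by
      rw [eq_empty_iff_forall_notMem]
      rintro s ⟨u, hu, hur, -⟩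
      rw [dist_self, dist_eq_zero] at hur
      exact hu.ne hur
    rw [this, ncard_empty]

namespace PIso

variable {R : Set (A × B)}

theorem mono {S : Set (A × B)} (hR : PIso N R) (hS : S ⊆ R) : PIso N S :=
  ⟨fun p hp q hq => hR.lt p (hS hp) q (hS hq),
    fun p hp q hq r hr => hR.dist p (hS hp) q (hS hq) r (hS hr),
    fun p hp q hq => hR.lab p (hS hp) q (hS hq)⟩

theorem swap (hR : PIso N R) : PIso N (Prod.swap ⁻¹' R) :=
  ⟨fun _ hp _ hq => (hR.lt _ hp _ hq).symm,
    fun _ hp _ hq _ hr => (hR.dist _ hp _ hq _ hr).symm,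
    fun _ hp _ hq => (hR.lab _ hp _ hq).symm⟩

theorem singleton (x : A) (x' : B) : PIso N {(x, x')} := by
  constructor
  · rintro p rfl q rfl
    simp
  · rintro p rfl q rfl r rfl
    simp
  · rintro p rfl q rfl
    simp [lab_self]

theorem eq_iff (hR : PIso N R) {p q : A × B} (hp : p ∈ R) (hq : q ∈ R) :
    p.1 = q.1 ↔ p.2 = q.2 := by
  have h1 := hR.lt p hp q hq
  have h2 := hR.lt q hq p hp
  constructor
  · intro h
    exact le_antisymm (not_lt.1 fun h3 => (h2.2 h3).ne' h) (not_lt.1 fun h3 => (h1.2 h3).ne h)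
  · intro h
    exact le_antisymm (not_lt.1 fun h3 => (h2.1 h3).ne' h) (not_lt.1 fun h3 => (h1.1 h3).ne h)

theorem dist_eq_iff (hR : PIso N R) {p q r : A × B} (hp : p ∈ R) (hq : q ∈ R) (hr : r ∈ R) :
    Dist.dist p.1 q.1 = Dist.dist p.1 r.1 ↔ Dist.dist p.2 q.2 = Dist.dist p.2 r.2 := by
  have h1 := hR.dist p hp q hq r hr
  have h2 := hR.dist p hp r hr q hq
  constructor
  · intro h
    exact le_antisymm (not_lt.1 fun h3 => (h2.2 h3).ne' h) (not_lt.1 fun h3 => (h1.2 h3).ne h)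
  · intro h
    exact le_antisymm (not_lt.1 fun h3 => (h2.1 h3).ne' h) (not_lt.1 fun h3 => (h1.1 h3).ne h)

theorem col_eq (hR : PIso N R) {p q : A × B} (hp : p ∈ R) (hq : q ∈ R) :
    col N p.1 q.1 = col N p.2 q.2 := by
  unfold col
  rw [hR.lab p hp q hq, hR.lab q hq p hp, propext (hR.lt p hp q hq)]

/-- A partial isomorphism is recognized from a point `y` of its domain. -/
theorem of_link (hA : IsOrderedUltrametric N A) (hB : IsOrderedUltrametric N B) {y : A} {y' : B}
    (h1 : ∀ p ∈ R, ∀ q ∈ R,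
      Dist.dist y p.1 < Dist.dist y q.1 ↔ Dist.dist y' p.2 < Dist.dist y' q.2)
    (h2 : ∀ p ∈ R, ∀ q ∈ R,
      Dist.dist p.1 q.1 < Dist.dist p.1 y ↔ Dist.dist p.2 q.2 < Dist.dist p.2 y')
    (h3 : ∀ p ∈ R, ∀ q ∈ R, Dist.dist y p.1 = Dist.dist y q.1 → (p.1 < q.1 ↔ p.2 < q.2))
    (h4 : ∀ p ∈ R, col N y p.1 = col N y' p.2)
    (h5 : ∀ p ∈ R, ∀ q ∈ R, ∀ r ∈ R, Dist.dist p.1 q.1 < Dist.dist p.1 y →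
      Dist.dist p.1 r.1 < Dist.dist p.1 y →
      (Dist.dist p.1 q.1 < Dist.dist p.1 r.1 ↔ Dist.dist p.2 q.2 < Dist.dist p.2 r.2))
    (h6 : ∀ p ∈ R, ∀ q ∈ R, Dist.dist p.1 q.1 < Dist.dist p.1 y →
      OrdUltra.lab N p.1 q.1 = OrdUltra.lab N p.2 q.2) : PIso N R := by
  have hlab1 : ∀ p ∈ R, OrdUltra.lab N y p.1 = OrdUltra.lab N y' p.2 := fun p hp =>
    congrArg Prod.fst (h4 p hp)
  have hlab2 : ∀ p ∈ R, OrdUltra.lab N p.1 y = OrdUltra.lab N p.2 y' := fun p hp =>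
    congrArg (fun k => k.2.1) (h4 p hp)
  have hside : ∀ p ∈ R, (y < p.1 ↔ y' < p.2) := fun p hp =>
    iff_of_eq (congrArg (fun k => k.2.2) (h4 p hp))
  constructor
  · intro p hp q hq
    rcases lt_trichotomy (Dist.dist y p.1) (Dist.dist y q.1) with h | h | h
    · rw [← hA.lt_iff_of_near h, ← hB.lt_iff_of_near ((h1 p hp q hq).1 h)]
      exact hside q hq
    · exact h3 p hp q hq h
    · have h' := (h1 q hq p hp).1 h
      rw [← hA.gt_iff_of_near h, ← hB.gt_iff_of_near h']
      have hy : y ≠ p.1 := dist_pos.1 (dist_nonneg.trans_lt h)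
      have hy' : y' ≠ p.2 := dist_pos.1 (dist_nonneg.trans_lt h')
      have := hside p hp
      constructor
      · intro h6
        exact lt_of_le_of_ne (not_lt.1 fun h7 => (this.2 h7).not_gt h6) hy'.symm
      · intro h6
        exact lt_of_le_of_ne (not_lt.1 fun h7 => (this.1 h7).not_gt h6) hy.symm
  · intro p hp q hq r hr
    by_cases hpq : Dist.dist p.1 q.1 < Dist.dist p.1 y <;>
      by_cases hpr : Dist.dist p.1 r.1 < Dist.dist p.1 y
    · exact h5 p hp q hq r hr hpq hpr
    · have hpq' := (h2 p hp q hq).1 hpq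
      have hpr' := mt (h2 p hp r hr).2 hpr
      exact iff_of_true (hpq.trans_le (not_lt.1 hpr)) (hpq'.trans_le (not_lt.1 hpr'))
    · have hpq' := mt (h2 p hp q hq).2 hpq
      have hpr' := (h2 p hp r hr).1 hpr
      exact iff_of_false (hpr.trans_le (not_lt.1 hpq)).not_gt
        (hpr'.trans_le (not_lt.1 hpq')).not_gt
    · have hpq' := mt (h2 p hp q hq).2 hpq
      have hpr' := mt (h2 p hp r hr).2 hpr
      -- Neither `q` nor `r` is closer to `p` than `y` is, so the distances from `p` are maxima of
      -- distances from `y`, whose comparison is given by `h1`.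
      rw [hA.dist_eq_max (not_lt.1 hpq), hA.dist_eq_max (not_lt.1 hpr),
        hB.dist_eq_max (not_lt.1 hpq'), hB.dist_eq_max (not_lt.1 hpr')]
      have e1 := h1 p hp r hr
      have e2 := h1 q hq r hr
      simp only [max_lt_iff, lt_max_iff, lt_irrefl, false_and, false_or]
      rw [e1, e2]
  · intro p hp q hq
    by_cases hpq : Dist.dist p.1 q.1 < Dist.dist p.1 y
    · exact h6 p hp q hq hpq
    have hpq' := mt (h2 p hp q hq).2 hpq
    rcases lt_or_ge (Dist.dist y p.1) (Dist.dist y q.1) with h | h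
    · rw [lab_congr_left hA h, lab_congr_left hB ((h1 p hp q hq).1 h), hlab1 q hq]
    · have h' : Dist.dist y' q.2 ≤ Dist.dist y' p.2 := not_lt.1 (mt (h1 p hp q hq).2 h.not_gt)
      have e : Dist.dist p.1 q.1 = Dist.dist p.1 y := by
        rw [hA.dist_eq_max (not_lt.1 hpq), max_eq_left h, dist_comm]
      have e' : Dist.dist p.2 q.2 = Dist.dist p.2 y' := by
        rw [hB.dist_eq_max (not_lt.1 hpq'), max_eq_left h', dist_comm]
      rw [lab_congr_right e, lab_congr_right e', hlab2 p hp]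

/-- Extending a partial isomorphism by points lying in new branches around `y`. -/
theorem union_fresh (hA : IsOrderedUltrametric N A) (hB : IsOrderedUltrametric N B)
    (hR : PIso N R) {y : A} {y' : B} (hy : (y, y') ∈ R) {O : Set (A × B)}
    (h1 : ∀ p ∈ O, ∀ q ∈ R ∪ O,
      (Dist.dist y p.1 < Dist.dist y q.1 ↔ Dist.dist y' p.2 < Dist.dist y' q.2) ∧
      (Dist.dist y q.1 < Dist.dist y p.1 ↔ Dist.dist y' q.2 < Dist.dist y' p.2))
    (h2 : ∀ p ∈ O, ∀ q ∈ R ∪ O, p ≠ q →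
      Dist.dist p.1 y ≤ Dist.dist p.1 q.1 ∧ Dist.dist p.2 y' ≤ Dist.dist p.2 q.2)
    (h3 : ∀ p ∈ O, ∀ q ∈ R ∪ O, Dist.dist y p.1 = Dist.dist y q.1 →
      (p.1 < q.1 ↔ p.2 < q.2) ∧ (q.1 < p.1 ↔ q.2 < p.2))
    (h4 : ∀ p ∈ O, col N y p.1 = col N y' p.2) : PIso N (R ∪ O) := by
  have h1' : ∀ p ∈ R ∪ O, ∀ q ∈ R ∪ O,
      (Dist.dist y p.1 < Dist.dist y q.1 ↔ Dist.dist y' p.2 < Dist.dist y' q.2) := by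
    rintro p (hp | hp) q (hq | hq)
    · exact hR.dist _ hy p hp q hq
    · exact (h1 q hq p (Or.inl hp)).2
    · exact (h1 p hp q (Or.inl hq)).1
    · exact (h1 p hp q (Or.inr hq)).1
  have hfar : ∀ p ∈ R ∪ O, ∀ q ∈ R ∪ O, p ≠ q → (p ∈ O ∨ q ∈ O) →
      ¬ Dist.dist p.1 q.1 < Dist.dist p.1 y ∧ ¬ Dist.dist p.2 q.2 < Dist.dist p.2 y' := by
    rintro p hp q hq hpq (h | h)
    · exact ⟨not_lt.2 (h2 p h q hq hpq).1, not_lt.2 (h2 p h q hq hpq).2⟩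
    · obtain ⟨e1, e2⟩ := h2 q h p hp hpq.symm
      constructor
      · intro h5
        rw [← hA.dist_eq_of_near h5, dist_comm p.1] at h5
        exact e1.not_gt h5
      · intro h5
        rw [← hB.dist_eq_of_near h5, dist_comm p.2] at h5
        exact e2.not_gt h5
  have hyO : (y, y') ∈ R ∪ O := Or.inl hy
  have hself : ∀ p ∈ R ∪ O, Dist.dist p.1 p.1 < Dist.dist p.1 y ↔
      Dist.dist p.2 p.2 < Dist.dist p.2 y' := by
    intro p hp
    have := h1' _ hyO p hp
    simp only [dist_self] at this ⊢
    rwa [dist_comm p.1, dist_comm p.2]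
  have hnear : ∀ p ∈ R ∪ O, ∀ q ∈ R ∪ O, Dist.dist p.1 q.1 < Dist.dist p.1 y →
      p = q ∨ (p ∈ R ∧ q ∈ R) := by
    intro p hp q hq h
    by_contra hcon
    push Not at hcon
    obtain ⟨hne, himp⟩ := hcon
    refine (hfar p hp q hq hne ?_).1 h
    rcases hp with hp | hp
    · exact Or.inr (hq.resolve_left (himp hp))
    · exact Or.inl hp
  refine of_link hA hB h1' ?_ ?_ ?_ ?_ ?_
  · intro p hp q hq
    by_cases hpq : p = q
    · subst hpq
      exact hself p hp
    by_cases hO : p ∈ O ∨ q ∈ O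
    · have := hfar p hp q hq hpq hO
      exact iff_of_false this.1 this.2
    · push Not at hO
      exact hR.dist p (hp.resolve_right hO.1) q (hq.resolve_right hO.2) _ hy
  · rintro p (hp | hp) q (hq | hq) h
    · exact hR.lt p hp q hq
    · exact (h3 q hq p (Or.inl hp) h.symm).2
    · exact (h3 p hp q (Or.inl hq) h).1
    · exact (h3 p hp q (Or.inr hq) h).1
  · rintro p (hp | hp)
    · exact hR.col_eq hy hp
    · exact h4 p hp
  · intro p hp q hq r hr hpq hpr
    rcases hnear p hp q hq hpq with rfl | ⟨hp', hq'⟩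
    · rcases hnear p hp r hr hpr with rfl | ⟨hp', hr'⟩
      · simp
      · exact hR.dist p hp' p hp' r hr'
    · rcases hnear p hp r hr hpr with rfl | ⟨-, hr'⟩
      · exact hR.dist p hp' q hq' p hp'
      · exact hR.dist p hp' q hq' r hr'
  · intro p hp q hq hpq
    rcases hnear p hp q hq hpq with rfl | ⟨hp', hq'⟩
    · rw [lab_self, lab_self]
    · exact hR.lab p hp' q hq'

/-- When `y` is a closest point to `x`, the point `x` opens a branch of its own. Its position is
then determined by its level around `y`, its color, and its order relative to the points on the same
level. -/
theorem insert_fresh (hA : IsOrderedUltrametric N A) (hB : IsOrderedUltrametric N B)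
    (hR : PIso N R) {y : A} {y' : B} (hy : (y, y') ∈ R) {x : A} {x' : B}
    (hx : x ≠ y) (hx' : x' ≠ y')
    (hfar : ∀ q ∈ R, Dist.dist x y ≤ Dist.dist x q.1)
    (hfar' : ∀ q ∈ R, Dist.dist x' y' ≤ Dist.dist x' q.2)
    (hlev : ∀ q ∈ R, (Dist.dist y x < Dist.dist y q.1 ↔ Dist.dist y' x' < Dist.dist y' q.2) ∧
      (Dist.dist y q.1 < Dist.dist y x ↔ Dist.dist y' q.2 < Dist.dist y' x'))
    (hord : ∀ q ∈ R, Dist.dist y x = Dist.dist y q.1 → (x < q.1 ↔ x' < q.2))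
    (hcol : col N y x = col N y' x') : PIso N (insert (x, x') R) := by
  rw [← union_singleton]
  have hne : ∀ q ∈ R, x ≠ q.1 := fun q hq => dist_pos.1 ((dist_pos.2 hx).trans_le (hfar q hq))
  have hne' : ∀ q ∈ R, x' ≠ q.2 := fun q hq =>
    dist_pos.1 ((dist_pos.2 hx').trans_le (hfar' q hq))
  refine hR.union_fresh hA hB hy ?_ ?_ ?_ ?_
  · rintro p rfl q (hq | rfl)
    · exact hlev q hq
    · simp
  · rintro p rfl q (hq | rfl) hpq
    · exact ⟨hfar q hq, hfar' q hq⟩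
    · exact absurd rfl hpq
  · rintro p rfl q (hq | rfl) h
    · have h1 := hord q hq h
      refine ⟨h1, ⟨fun h2 => ?_, fun h2 => ?_⟩⟩
      · exact lt_of_le_of_ne (not_lt.1 fun h3 => (h1.2 h3).not_gt h2) (hne' q hq).symm
      · exact lt_of_le_of_ne (not_lt.1 fun h3 => (h1.1 h3).not_gt h2) (hne q hq).symm
    · simp
  · rintro p rfl
    exact hcol

end PIso

end PIso

/-! ### Generic spaces -/

/-- The extension properties which characterize the ordered `N`-ultrametric Urysohn spaces. -/
structure IsGeneric (N : ℕ∞) (X : Type u) [MetricSpace X] [LinearOrder X] : Prop where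
  ordered : IsOrderedUltrametric N X
  nonempty : Nonempty X
  level : ∀ (y : X) (S T : Finset X), (∀ a ∈ S, ∀ b ∈ T, dist y a < dist y b) →
    (∀ b ∈ T, b ≠ y) → ∀ k ∈ colors N, ∃ z, z ≠ y ∧ col N y z = k ∧
      (∀ a ∈ S, dist y a < dist y z) ∧ ∀ b ∈ T, dist y z < dist y b
  node_top : N = ⊤ → ∀ (y w : X), y ≠ w → ∀ S T : Finset X,
    (∀ a ∈ S, dist y a ≤ dist y w) → (∀ b ∈ T, dist y b ≤ dist y w) →
    (∀ a ∈ S, ∀ b ∈ T, a < b ∧ dist a b = dist y w) →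
    ∃ z, dist y z ≤ dist y w ∧ (∀ a ∈ S, a < z ∧ dist a z = dist y w) ∧
      ∀ b ∈ T, z < b ∧ dist z b = dist y w
  node_fin : N ≠ ⊤ → ∀ (y w : X), y ≠ w → ∃ P : Set X, IsPolygon (dist y w) P ∧ P.encard = N ∧
    ∀ p ∈ P, dist p y ≤ dist y w

section Generic

variable {N : ℕ∞} {A : Type u} {B : Type v} [MetricSpace A] [LinearOrder A]
  [MetricSpace B] [LinearOrder B]

theorem IsOrderedUltrametric.level_eq_of_near (h : IsOrderedUltrametric N A) {y z q : A}
    (hq : dist z q < dist z y) : dist y q = dist y z := by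
  rw [dist_comm y q, h.dist_eq_of_near hq, dist_comm]

/-- In the increasing enumeration of a full polygon from index `0`, the point with index `j` has
exactly `j` polygon points, hence `j` branches, to its left. -/
theorem IsGeneric.exists_label (h : IsGeneric N A) (hN : N ≠ ⊤) {y w : A} (hyw : y ≠ w) {j : ℕ}
    (hj : (j : ℕ∞) < N) :
    ∃ z, dist z y ≤ dist y w ∧ (leftBranches z (dist y w)).ncard = j := by
  obtain ⟨P, hP, hPN, hPy⟩ := h.node_fin hN y w hyw
  have hfin : P.Finite := by
    rw [← encard_lt_top_iff, hPN]
    exact lt_top_iff_ne_top.2 hN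
  obtain ⟨Q, rfl⟩ := hfin.exists_finset_coe
  have hQ : (Q.card : ℕ∞) = N := by rw [← hPN, encard_coe_eq_coe_finsetCard]
  have hjQ : j < Q.card := by
    rw [← hQ] at hj
    exact_mod_cast hj
  set e := Q.orderEmbOfFin rfl with he
  set z := e ⟨j, hjQ⟩ with hz
  have hzQ : z ∈ Q := Q.orderEmbOfFin_mem rfl _
  refine ⟨z, hPy z hzQ, ?_⟩
  rw [ncard_leftBranches_of_polygon h.ordered hN (dist_pos.2 hyw) hP hPN]
  · have : {p | p ∈ (Q : Set A) ∧ p < z ∧ dist p z = dist y w} =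
        e '' (Set.Iio (⟨j, hjQ⟩ : Fin Q.card)) := by
      ext p
      constructor
      · rintro ⟨hp, hpz, -⟩
        obtain ⟨i, rfl⟩ : p ∈ range e := by rw [he, Finset.range_orderEmbOfFin]; exact hp
        exact ⟨i, e.lt_iff_lt.1 hpz, rfl⟩
      · rintro ⟨i, hi, rfl⟩
        have hiz : e i < z := e.lt_iff_lt.2 hi
        have hiQ : e i ∈ Q := Q.orderEmbOfFin_mem rfl _
        exact ⟨hiQ, hiz, hP _ hiQ _ hzQ hiz.ne⟩
    rw [this, ncard_image_of_injective _ e.injective, ← Finset.coe_Iio, ncard_coe_finset,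
      Fin.card_Iio]
  · intro p hp
    refine (h.ordered.ultrametric p y z).trans (max_le (hPy p hp) ?_)
    rw [dist_comm]
    exact hPy z hzQ

theorem IsGeneric.exists_level (h : IsGeneric N A) {y : A} (S T : Set A) (hS : S.Finite)
    (hT : T.Finite) (hST : ∀ a ∈ S, ∀ b ∈ T, dist y a < dist y b) (hTy : y ∉ T)
    {k : ℕ × ℕ × Prop} (hk : k ∈ colors N) :
    ∃ z, z ≠ y ∧ col N y z = k ∧
      (∀ a ∈ S, dist y a < dist y z) ∧ ∀ b ∈ T, dist y z < dist y b := by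
  obtain ⟨S, rfl⟩ := hS.exists_finset_coe
  obtain ⟨T, rfl⟩ := hT.exists_finset_coe
  exact h.level y S T hST (fun b hb hby => hTy (hby ▸ hb)) k hk

theorem IsGeneric.exists_branch (h : IsGeneric N A) (hN : N = ⊤) {y w : A} (hyw : y ≠ w)
    (S T : Set A) (hS : S.Finite) (hT : T.Finite) (hSw : ∀ a ∈ S, dist y a ≤ dist y w)
    (hTw : ∀ a ∈ T, dist y a ≤ dist y w) (hST : ∀ a ∈ S, ∀ b ∈ T, a < b ∧ dist a b = dist y w) :
    ∃ z, dist y z ≤ dist y w ∧ (∀ a ∈ S, a < z ∧ dist a z = dist y w) ∧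
      ∀ b ∈ T, z < b ∧ dist z b = dist y w := by
  obtain ⟨S, rfl⟩ := hS.exists_finset_coe
  obtain ⟨T, rfl⟩ := hT.exists_finset_coe
  exact h.node_top hN y w hyw S T hSw hTw hST

theorem col_top (hN : N = ⊤) {y x : A} {y' x' : B} (h : y < x ↔ y' < x') :
    col N y x = col N y' x' := by
  unfold col
  rw [lab_top hN, lab_top hN, lab_top hN, lab_top hN, propext h]

/-- Finite partial isomorphisms into a generic space extend by one point. -/
theorem exists_extension (hA : IsOrderedUltrametric N A) (hB : IsGeneric N B) {R : Set (A × B)}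
    (hfin : R.Finite) (hR : PIso N R) (x : A) : ∃ x', PIso N (insert (x, x') R) := by
  have hBo := hB.ordered
  rcases R.eq_empty_or_nonempty with rfl | hne
  · obtain ⟨b⟩ := hB.nonempty
    exact ⟨b, by simpa using PIso.singleton x b⟩
  by_cases hdom : ∃ p ∈ R, p.1 = x
  · obtain ⟨⟨a, b⟩, hp, rfl⟩ := hdom
    exact ⟨b, by rwa [insert_eq_of_mem hp]⟩
  push Not at hdom
  -- With `y` a closest point to `x` in the domain, `x` lies in a fresh branch around `y`, on a
  -- level that is either new or already occupied.
  obtain ⟨⟨y, y'⟩, hy, hmin⟩ := hfin.exists_minimalFor (fun p => dist x p.1) _ hne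
  have hfar : ∀ q ∈ R, dist x y ≤ dist x q.1 := by
    intro q hq
    rcases le_total (dist x y) (dist x q.1) with h | h
    · exact h
    · exact hmin hq h
  have hxy : x ≠ y := fun h => hdom _ hy h.symm
  by_cases hlev : ∃ p ∈ R, dist y p.1 = dist y x
  swap
  · push Not at hlev
    obtain ⟨z, hzy, hcol, hzS, hzT⟩ := hB.exists_level (y := y')
      (Prod.snd '' {p | p ∈ R ∧ dist y p.1 < dist y x})
      (Prod.snd '' {p | p ∈ R ∧ dist y x < dist y p.1})
      ((hfin.subset (sep_subset _ _)).image _) ((hfin.subset (sep_subset _ _)).image _)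
      (by
        rintro _ ⟨p, ⟨hp, hpx⟩, rfl⟩ _ ⟨q, ⟨hq, hqx⟩, rfl⟩
        exact (hR.dist _ hy p hp q hq).1 (hpx.trans hqx))
      (by
        rintro ⟨p, ⟨hp, hpx⟩, hpy⟩
        have : p.1 = y := (hR.eq_iff hp hy).2 hpy
        rw [this, dist_self] at hpx
        exact hpx.not_ge dist_nonneg)
      (col_mem_colors hA hxy.symm)
    have hl : ∀ q ∈ R, (dist y x < dist y q.1 ∧ dist y' z < dist y' q.2) ∨
        (dist y q.1 < dist y x ∧ dist y' q.2 < dist y' z) := by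
      intro q hq
      rcases lt_trichotomy (dist y x) (dist y q.1) with h | h | h
      · exact Or.inl ⟨h, hzT _ ⟨q, ⟨hq, h⟩, rfl⟩⟩
      · exact absurd h.symm (hlev q hq)
      · exact Or.inr ⟨h, hzS _ ⟨q, ⟨hq, h⟩, rfl⟩⟩
    refine ⟨z, hR.insert_fresh hA hBo hy hxy hzy hfar ?_ ?_ ?_ hcol.symm⟩
    · intro q hq
      by_contra hcon
      have h1 := hBo.level_eq_of_near (not_le.1 hcon)
      rcases hl q hq with h | h <;> linarith [h.2]
    · intro q hq
      rcases hl q hq with h | h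
      · exact ⟨iff_of_true h.1 h.2, iff_of_false h.1.not_gt h.2.not_gt⟩
      · exact ⟨iff_of_false h.1.not_gt h.2.not_gt, iff_of_true h.1 h.2⟩
    · intro q hq h
      exact absurd h.symm (hlev q hq)
  obtain ⟨⟨u, u'⟩, hu, hux⟩ := hlev
  simp only at hux
  have hyu : y ≠ u := dist_pos.1 (by rw [hux]; exact dist_pos.2 hxy.symm)
  have hyu' : y' ≠ u' := fun h => hyu ((hR.eq_iff hy hu).2 h)
  -- comparison of levels transfers as soon as the new point has the level of `u'`
  have hlevel : ∀ z, dist y' z = dist y' u' → ∀ q ∈ R,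
      (dist y x < dist y q.1 ↔ dist y' z < dist y' q.2) ∧
      (dist y q.1 < dist y x ↔ dist y' q.2 < dist y' z) := by
    intro z hz q hq
    rw [hz, ← hux]
    exact ⟨hR.dist _ hy _ hu q hq, hR.dist _ hy q hq _ hu⟩
  by_cases hN : N = ⊤
  · have hle : ∀ p ∈ R, dist y p.1 ≤ dist y x → dist y' p.2 ≤ dist y' u' := by
      intro p hp h
      rw [← hux] at h
      exact not_lt.1 fun h1 => h.not_gt ((hR.dist _ hy _ hu p hp).2 h1)
    -- Points of the node on opposite sides of `x` lie in different branches: by convexity they are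
    -- at least as far apart as the left one is from `x`, and no point of the domain is nearer to
    -- `x` than `y`.
    have hsep : ∀ p ∈ R, ∀ q ∈ R, dist y p.1 ≤ dist y x → dist y q.1 ≤ dist y x →
        p.1 < x → x < q.1 → dist p.2 q.2 = dist y' u' := by
      intro p hp q hq hpx hqx h1 h2
      have hd : dist y x ≤ dist p.1 q.1 := by
        refine le_trans ?_ (hA.dist_left_le h1.le h2.le)
        rw [dist_comm p.1, dist_comm y]
        exact hfar p hp
      have hpy : dist p.1 y ≤ dist p.1 q.1 := by
        rw [dist_comm]
        exact hpx.trans hd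
      have hpy' : dist p.2 y' ≤ dist p.2 q.2 :=
        not_lt.1 fun h3 => hpy.not_gt ((hR.dist p hp q hq _ hy).2 h3)
      rw [hA.dist_eq_max hpy] at hd
      rw [hBo.dist_eq_max hpy']
      rcases le_max_iff.1 hd with h3 | h3
      · have e := (hR.dist_eq_iff hy hp hu).1 ((hpx.antisymm h3).trans hux.symm)
        simp only at e
        rw [e, max_eq_left (hle q hq hqx)]
      · have e := (hR.dist_eq_iff hy hq hu).1 ((hqx.antisymm h3).trans hux.symm)
        simp only at e
        rw [e, max_eq_right (hle p hp hpx)]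
    obtain ⟨z, hz, hzS, hzT⟩ := hB.exists_branch hN hyu'
      (Prod.snd '' {p | p ∈ R ∧ dist y p.1 ≤ dist y x ∧ p.1 < x})
      (Prod.snd '' {p | p ∈ R ∧ dist y p.1 ≤ dist y x ∧ x < p.1})
      ((hfin.subset (sep_subset _ _)).image _) ((hfin.subset (sep_subset _ _)).image _)
      (by rintro _ ⟨p, ⟨hp, hpx, -⟩, rfl⟩; exact hle p hp hpx)
      (by rintro _ ⟨p, ⟨hp, hpx, -⟩, rfl⟩; exact hle p hp hpx)
      (by
        rintro _ ⟨p, ⟨hp, hpx, h1⟩, rfl⟩ _ ⟨q, ⟨hq, hqx, h2⟩, rfl⟩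
        exact ⟨(hR.lt p hp q hq).1 (h1.trans h2), hsep p hp q hq hpx hqx h1 h2⟩)
    have hpos : ∀ q ∈ R, dist y q.1 ≤ dist y x → (x < q.1 ↔ z < q.2) ∧
        dist z q.2 = dist y' u' := by
      intro q hq h
      rcases lt_or_gt_of_ne (hdom q hq) with h1 | h1
      · obtain ⟨h2, h3⟩ := hzS _ ⟨q, ⟨hq, h, h1⟩, rfl⟩
        exact ⟨iff_of_false h1.not_gt h2.not_gt, by rw [dist_comm, h3]⟩
      · obtain ⟨h2, h3⟩ := hzT _ ⟨q, ⟨hq, h, h1⟩, rfl⟩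
        exact ⟨iff_of_true h1 h2, h3⟩
    have hzy := hpos _ hy (by simp)
    simp only at hzy
    have hzl : dist y' z = dist y' u' := by rw [dist_comm, hzy.2]
    have hne' : z ≠ y' := dist_pos.1 (by rw [hzy.2]; exact dist_pos.2 hyu')
    refine ⟨z, hR.insert_fresh hA hBo hy hxy hne' hfar ?_ (hlevel z hzl) ?_ ?_⟩
    · intro q hq
      rcases le_or_gt (dist y q.1) (dist y x) with h | h
      · rw [(hpos q hq h).2, hzy.2]
      · by_contra hcon
        have h1 := hBo.level_eq_of_near (not_le.1 hcon)
        have h2 := ((hlevel z hzl q hq).1).1 h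
        linarith
    · intro q hq h
      exact (hpos q hq h.symm.le).1
    · apply col_top hN
      have h1 : y < x ↔ ¬ x < y := by
        rw [not_lt]
        exact ⟨le_of_lt, fun h => lt_of_le_of_ne h hxy.symm⟩
      have h2 : y' < z ↔ ¬ z < y' := by
        rw [not_lt]
        exact ⟨le_of_lt, fun h => lt_of_le_of_ne h hne'.symm⟩
      rw [h1, h2, hzy.1]
  -- For finite `N` the branch of the image is forced to be the one with the label of `x`. It avoids
  -- `y'` and the other points of the range because distinct branches of the domain have distinct
  -- labels.
  · obtain ⟨z, hz, hzlab⟩ := hB.exists_label hN hyu' (lab_lt hA hN hxy)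
    have hlu : lab N y' u' = lab N y x := by
      rw [← hR.lab _ hy _ hu]
      exact lab_congr_right hux
    have hzl : dist y' z = dist y' u' := by
      rw [dist_comm] at hz
      refine hz.eq_of_not_lt fun hlt => ?_
      have : lab N y' u' = lab N x y := by
        rw [← hzlab, ← leftBranches_congr hBo hlt]
        unfold lab
        rw [if_neg hN]
      rw [hlu] at this
      exact lab_ne hA hN hxy this.symm
    have hne' : z ≠ y' := dist_pos.1 (by rw [dist_comm, hzl]; exact dist_pos.2 hyu')
    have hlabz : lab N z y' = lab N x y := by
      rw [← hzlab]
      unfold lab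
      rw [if_neg hN, dist_comm, hzl]
    have hlaby : lab N y' z = lab N y x := by
      rw [← hlu]
      exact lab_congr_right hzl
    have hside : ∀ q ∈ R, dist y x = dist y q.1 → dist y' z = dist y' q.2 := by
      intro q hq h
      rw [hzl]
      exact (hR.dist_eq_iff hy hu hq).1 (hux.trans h)
    have hdxq : ∀ q ∈ R, dist y x = dist y q.1 → dist x q.1 = dist x y := by
      intro q hq h
      rw [hA.dist_eq_max (hfar q hq), ← h, max_self, dist_comm]
    have hfar' : ∀ q ∈ R, dist z y' ≤ dist z q.2 := by
      intro q hq
      by_contra hcon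
      have h0 := not_le.1 hcon
      have h1 := hBo.level_eq_of_near h0
      have h2 := hlevel z hzl q hq
      have h3 : dist y x = dist y q.1 := by
        rcases lt_trichotomy (dist y x) (dist y q.1) with h | h | h
        · exact absurd h1 (h2.1.1 h).ne'
        · exact h
        · exact absurd h1 (h2.2.1 h).ne
      have h4 : lab N q.1 y = lab N x y := by
        rw [hR.lab q hq _ hy, ← hlabz]
        exact lab_congr_left hBo h0
      apply lab_ne hA hN (fun h => hdom q hq h.symm : x ≠ q.1)
      rw [lab_congr_right (hdxq q hq h3), ← h4]
      apply lab_congr_right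
      rw [dist_comm, ← h3, dist_comm q.1, hdxq q hq h3, dist_comm]
    refine ⟨z, hR.insert_fresh hA hBo hy hxy hne' hfar hfar' (hlevel z hzl) ?_ ?_⟩
    · intro q hq h
      have h' := hside q hq h
      have e' : dist z q.2 = dist z y' := by
        rw [hBo.dist_eq_max (hfar' q hq), ← h', max_self, dist_comm]
      rw [lt_iff_lab_lt hA hN, lt_iff_lab_lt hBo hN, lab_congr_right (hdxq q hq h),
        lab_congr_right e', hlabz]
      have e1 : lab N q.1 x = lab N q.1 y := by
        apply lab_congr_right
        rw [dist_comm, hdxq q hq h, dist_comm, h, dist_comm]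
      have e2 : lab N q.2 z = lab N q.2 y' := by
        apply lab_congr_right
        rw [dist_comm, e', dist_comm, h', dist_comm]
      rw [e1, e2, hR.lab q hq _ hy]
    · unfold col
      rw [hlaby, hlabz, propext (lt_iff_lab_lt hA hN), propext (lt_iff_lab_lt hBo hN), hlaby,
        hlabz]

end Generic

end OrdUltra

namespace OrdUltra

open Set

universe u v w

/-! ### Back and forth -/

/-- The relations are not required to be finite, since the construction also serves for systems of
whole orbits. The increasing sequence `D` is returned so that properties involving finitely many
points pass to `e`. -/
theorem exists_equiv_of_back_and_forth {A : Type u} {B : Type v} [Countable A] [Countable B]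
    (P : Set (A × B) → Prop)
    (hforth : ∀ R, P R → ∀ x, ∃ R', P R' ∧ R ⊆ R' ∧ ∃ x', (x, x') ∈ R')
    (hback : ∀ R, P R → ∀ x', ∃ R', P R' ∧ R ⊆ R' ∧ ∃ x, (x, x') ∈ R')
    (hinj : ∀ R, P R → ∀ p ∈ R, ∀ q ∈ R, p.1 = q.1 ↔ p.2 = q.2) {R : Set (A × B)} (hR : P R) :
    ∃ (e : A ≃ B) (D : ℕ → Set (A × B)), Monotone D ∧ (∀ n, P (D n)) ∧ (∀ a, ∃ n, (a, e a) ∈ D n) ∧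
      ∀ p ∈ R, e p.1 = p.2 := by
  have := Encodable.ofCountable A
  have := Encodable.ofCountable B
  have hstep : ∀ (n : ℕ) (R : {R // P R}), ∃ R' : {R // P R}, R.1 ⊆ R'.1 ∧
      (∀ a ∈ (Encodable.decode n : Option A), ∃ x', (a, x') ∈ R'.1) ∧
      ∀ b ∈ (Encodable.decode n : Option B), ∃ x, (x, b) ∈ R'.1 := by
    rintro n ⟨R, hR⟩
    obtain ⟨R₁, hR₁, hsub₁, hx₁⟩ : ∃ R', P R' ∧ R ⊆ R' ∧
        ∀ a ∈ (Encodable.decode n : Option A), ∃ x', (a, x') ∈ R' := by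
      cases h : (Encodable.decode n : Option A) with
      | none => exact ⟨R, hR, le_rfl, by simp⟩
      | some a =>
        obtain ⟨R', h1, h2, h3⟩ := hforth R hR a
        exact ⟨R', h1, h2, by simpa using h3⟩
    obtain ⟨R₂, hR₂, hsub₂, hx₂⟩ : ∃ R', P R' ∧ R₁ ⊆ R' ∧
        ∀ b ∈ (Encodable.decode n : Option B), ∃ x, (x, b) ∈ R' := by
      cases h : (Encodable.decode n : Option B) with
      | none => exact ⟨R₁, hR₁, le_rfl, by simp⟩
      | some a =>
        obtain ⟨R', h1, h2, h3⟩ := hback R₁ hR₁ a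
        exact ⟨R', h1, h2, by simpa using h3⟩
    exact ⟨⟨R₂, hR₂⟩, hsub₁.trans hsub₂, fun a ha => (hx₁ a ha).imp fun _ h => hsub₂ h, hx₂⟩
  choose step hsub hstepA hstepB using hstep
  set D : ℕ → {R // P R} := fun n => Nat.rec ⟨R, hR⟩ (fun n R => step n R) n with hD
  have hmono : Monotone fun n => (D n).1 := monotone_nat_of_le_succ fun n => hsub n (D n)
  have hA : ∀ a, ∃ b n, (a, b) ∈ (D n).1 := by
    intro a
    obtain ⟨b, hb⟩ := hstepA (Encodable.encode a) (D (Encodable.encode a)) a (by simp)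
    exact ⟨b, Encodable.encode a + 1, hb⟩
  have hB : ∀ b, ∃ a n, (a, b) ∈ (D n).1 := by
    intro b
    obtain ⟨a, ha⟩ := hstepB (Encodable.encode b) (D (Encodable.encode b)) b (by simp)
    exact ⟨a, Encodable.encode b + 1, ha⟩
  have hinj' : ∀ {m n p q}, p ∈ (D m).1 → q ∈ (D n).1 → (p.1 = q.1 ↔ p.2 = q.2) := by
    intro m n p q hp hq
    exact hinj _ (D (max m n)).2 p (hmono (le_max_left m n) hp) q (hmono (le_max_right m n) hq)
  choose f nf hf using hA
  choose g ng hg using hB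
  refine ⟨⟨f, g, fun a => ?_, fun b => ?_⟩, fun n => (D n).1, hmono, fun n => (D n).2,
    fun a => ⟨nf a, hf a⟩, fun p hp => ?_⟩
  · exact (hinj' (hg (f a)) (hf a)).2 rfl
  · exact (hinj' (hf (g b)) (hg b)).1 rfl
  · exact (hinj' (hf p.1) (n := 0) (show p ∈ (D 0).1 from hp)).1 rfl

/-! ### Extensions of finite partial isomorphisms -/

section Extension

variable {N : ℕ∞} {A : Type u} {B : Type v} [MetricSpace A] [LinearOrder A]
  [MetricSpace B] [LinearOrder B]

theorem exists_extension_finite (hA : IsOrderedUltrametric N A) (hB : IsGeneric N B)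
    {R : Set (A × B)} (hfin : R.Finite) (hR : PIso N R) {F : Set A} (hF : F.Finite) :
    ∃ R', R'.Finite ∧ PIso N R' ∧ R ⊆ R' ∧ ∀ x ∈ F, ∃ x', (x, x') ∈ R' := by
  induction F, hF using Set.Finite.induction_on with
  | empty => exact ⟨R, hfin, hR, le_rfl, by simp⟩
  | @insert a s _ _ ih =>
    obtain ⟨R', h1, h2, h3, h4⟩ := ih
    obtain ⟨x', hx'⟩ := exists_extension hA hB h1 h2 a
    refine ⟨_, h1.insert _, hx', h3.trans (subset_insert _ _), ?_⟩
    rintro x (rfl | hx)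
    · exact ⟨x', mem_insert _ _⟩
    · exact (h4 x hx).imp fun _ h => mem_insert_of_mem _ h

theorem PIso.isTreeEmb {R : Set (A × B)} (hR : PIso N R) {D : Set A} {f : D → B}
    (hf : ∀ a : D, ((a : A), f a) ∈ R) : IsTreeEmb f :=
  ⟨fun x y => hR.lt _ (hf x) _ (hf y), fun x y z => hR.dist _ (hf x) _ (hf y) _ (hf z)⟩

theorem exists_treeEmb [Finite A] (hA : IsOrderedUltrametric N A) (hB : IsGeneric N B) :
    ∃ f : A → B, IsTreeEmb f := by
  obtain ⟨R, -, hR, -, hdom⟩ := exists_extension_finite hA hB (R := ∅) finite_empty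
    ⟨by simp, by simp, by simp⟩ (finite_univ (α := A))
  choose f hf using fun a => hdom a (mem_univ a)
  exact ⟨f, fun x y => hR.lt _ (hf x) _ (hf y), fun x y z => hR.dist _ (hf x) _ (hf y) _ (hf z)⟩

theorem PIso.pair (hA : IsOrderedUltrametric N A) (hB : IsOrderedUltrametric N B) {x u : A}
    {p q : B} (hxu : u ≠ x) (hpq : q ≠ p) (h : col N x u = col N p q) :
    PIso N (insert (u, q) {(x, p)}) := by
  refine (PIso.singleton x p).insert_fresh hA hB rfl hxu hpq ?_ ?_ ?_ ?_ h
  · rintro r rfl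
    exact le_rfl
  · rintro r rfl
    exact le_rfl
  · rintro r rfl
    simp only [dist_self, dist_pos]
    exact ⟨iff_of_false dist_nonneg.not_gt dist_nonneg.not_gt, iff_of_true hxu.symm hpq.symm⟩
  · rintro r rfl hr
    simp only [dist_self, dist_eq_zero] at hr
    exact absurd hr.symm hxu

/-- Only distances with a common endpoint can be compared directly. Here `dist a b` and `dist y w`
have none, so the comparison goes through `y` and `a`, both of which belong to the node. -/
theorem IsTreeEmb.dist_eq_of_node (hA : IsOrderedUltrametric N A)
    (hB : IsOrderedUltrametric N B) {f : A → B} (hf : IsTreeEmb f) {y w a b : A}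
    (ha : dist y a ≤ dist y w) (hab : dist a b = dist y w) :
    dist (f a) (f b) = dist (f y) (f w) := by
  rcases ha.eq_or_lt with h | h
  · have h1 : dist (f a) (f b) = dist (f a) (f y) :=
      (hf.dist_eq_iff a b y).1 (by rw [hab, dist_comm a, h])
    rw [h1, dist_comm, (hf.dist_eq_iff y a w).1 h]
  · rw [← hab, dist_comm y] at h
    have h1 : dist y b = dist a b := hA.dist_eq_of_near h
    have h2 : dist (f a) (f y) < dist (f a) (f b) := (hf.2 _ _ _).1 h
    rw [← hB.dist_eq_of_near h2]
    exact (hf.dist_eq_iff _ _ _).1 (h1.trans hab)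

theorem IsTreeEmb.dist_le_iff {f : A → B} (hf : IsTreeEmb f) (x y z : A) :
    dist x y ≤ dist x z ↔ dist (f x) (f y) ≤ dist (f x) (f z) := by
  rw [← not_lt, ← not_lt, hf.2]

theorem isPolygon_image (hA : IsOrderedUltrametric N A)
    (hB : IsOrderedUltrametric N B) {f : A → B} (hf : IsTreeEmb f) {y w : A} {P : Set A}
    (hP : IsPolygon (dist y w) P) (hPy : ∀ p ∈ P, dist p y ≤ dist y w) :
    IsPolygon (dist (f y) (f w)) (f '' P) ∧ ∀ p ∈ f '' P, dist p (f y) ≤ dist (f y) (f w) := by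
  constructor
  · rintro _ ⟨a, ha, rfl⟩ _ ⟨b, hb, rfl⟩ hab
    refine hf.dist_eq_of_node hA hB ?_ (hP a ha b hb fun h => hab (by rw [h]))
    rw [dist_comm]
    exact hPy a ha
  · rintro _ ⟨a, ha, rfl⟩
    rw [dist_comm, ← hf.dist_le_iff, dist_comm]
    exact hPy a ha

/-- Full nodes force a map to respect labels. -/
theorem lab_eq_of_polygon (hA : IsOrderedUltrametric N A) (hB : IsOrderedUltrametric N B)
    (hN : N ≠ ⊤) {f : A → B} (hf : IsTreeEmb f) {x y : A} (hxy : x ≠ y) {P : Set A}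
    (hP : IsPolygon (dist x y) P) (hPN : P.encard = N) (hPx : ∀ p ∈ P, dist p x ≤ dist x y) :
    lab N (f x) (f y) = lab N x y := by
  obtain ⟨h1, h2⟩ := isPolygon_image hA hB hf hP hPx
  unfold lab
  rw [if_neg hN, if_neg hN, ncard_leftBranches_of_polygon hA hN (dist_pos.2 hxy) hP hPN hPx,
    ncard_leftBranches_of_polygon hB hN (dist_pos.2 (hf.injective.ne hxy)) h1
      (by rw [hf.injective.encard_image, hPN]) h2, ← ncard_image_of_injective _ hf.injective]
  congr 1
  ext p
  constructor
  · rintro ⟨⟨a, ha, rfl⟩, hax, had⟩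
    refine ⟨a, ⟨ha, (hf.1 _ _).2 hax, ?_⟩, rfl⟩
    rw [dist_comm, hf.dist_eq_iff, dist_comm, had]
  · rintro ⟨a, ⟨ha, hax, had⟩, rfl⟩
    refine ⟨⟨a, ha, rfl⟩, (hf.1 _ _).1 hax, ?_⟩
    rw [dist_comm, ← hf.dist_eq_iff, dist_comm, had]

end Extension

/-! ### The automorphism group -/

section Homogeneous

variable {N : ℕ∞} {X : Type u} [MetricSpace X] [LinearOrder X]

/-- Whether a closed ball is a ball does not depend on the closed ball, apart from points. -/
def NodeHom (X : Type u) [MetricSpace X] : Prop :=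
  ∀ x u x' u' : X, (x = u ↔ x' = u') → IsBall {z | dist x z ≤ dist x u} →
    IsBall {z | dist x' z ≤ dist x' u'}

theorem isBall_image (hn : NodeHom X) {e : X ≃ X}
    (he : IsTreeEmb e) {s : Set X} (hs : IsBall s) : IsBall (e '' s) := by
  obtain ⟨x, r, hr, rfl⟩ := hs
  by_cases huniv : ∀ w, dist x w < r
  · have : Metric.ball x r = univ := by
      ext z
      simpa [dist_comm] using huniv z
    rw [this, image_univ_of_surjective e.surjective, ← this]
    exact ⟨x, r, hr, rfl⟩
  push Not at huniv
  obtain ⟨w, hw⟩ := huniv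
  -- If the distances inside the ball have a maximum, the ball is a closed ball and `NodeHom`
  -- applies. Otherwise the supremum of the image distances is not attained and serves as radius; it
  -- is finite because `w` is outside.
  by_cases hmax : ∃ u, dist x u < r ∧ ∀ v, dist x v < r → dist x v ≤ dist x u
  · obtain ⟨u, hur, hu⟩ := hmax
    have hset : Metric.ball x r = {z | dist x z ≤ dist x u} := by
      ext z
      rw [Metric.mem_ball, dist_comm]
      exact ⟨hu z, fun h => lt_of_le_of_lt h hur⟩
    have himg : e '' Metric.ball x r = {z | dist (e x) z ≤ dist (e x) (e u)} := by
      rw [hset]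
      ext z
      obtain ⟨v, rfl⟩ := e.surjective z
      rw [e.injective.mem_set_image]
      exact he.dist_le_iff _ _ _
    rw [himg]
    exact hn x u _ _ e.injective.eq_iff.symm (hset ▸ ⟨x, r, hr, rfl⟩)
  · push Not at hmax
    set I : Set ℝ := (fun v => dist (e x) (e v)) '' {v | dist x v < r} with hI
    have hbdd : BddAbove I := by
      refine ⟨dist (e x) (e w), ?_⟩
      rintro _ ⟨v, hv, rfl⟩
      exact ((he.2 _ _ _).1 (lt_of_lt_of_le hv hw)).le
    have hlt : ∀ v, dist x v < r → dist (e x) (e v) < sSup I := by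
      intro v hv
      obtain ⟨v', hv', hvv⟩ := hmax v hv
      exact ((he.2 _ _ _).1 hvv).trans_le (le_csSup hbdd ⟨v', hv', rfl⟩)
    have hx := hlt x (by simpa using hr)
    rw [dist_self] at hx
    refine ⟨e x, sSup I, hx, ?_⟩
    ext z
    obtain ⟨v, rfl⟩ := e.surjective z
    rw [e.injective.mem_set_image, Metric.mem_ball, Metric.mem_ball, dist_comm, dist_comm (e v)]
    refine ⟨hlt v, fun h => not_le.1 fun h' => h.not_ge ?_⟩
    refine csSup_le ⟨dist (e x) (e x), x, by simpa using hr, rfl⟩ ?_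
    rintro _ ⟨v', hv', rfl⟩
    exact ((he.2 _ _ _).1 (lt_of_lt_of_le hv' h')).le

theorem mem_BP_of_isTreeEmb (hn : NodeHom X) {g : Equiv.Perm X} (hg : IsTreeEmb g) :
    g ∈ BP X := by
  refine ⟨fun s => ⟨isBall_image hn hg, fun hs => ?_⟩, hg.1⟩
  have := isBall_image hn hg.symm hs
  rwa [Equiv.symm_image_image] at this

/-- Countable generic spaces in which finite partial isomorphisms extend to automorphisms, and
automorphisms are the bijections preserving order and tree structure. -/
structure IsHomogeneous (N : ℕ∞) (X : Type u) [MetricSpace X] [LinearOrder X] : Prop extends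
    IsGeneric N X where
  countable : Countable X
  extend : ∀ R : Set (X × X), R.Finite → PIso N R → ∃ g ∈ BP X, ∀ p ∈ R, g p.1 = p.2
  mem_BP : ∀ g : Equiv.Perm X, IsTreeEmb g → g ∈ BP X

theorem isTreeEmb_of_graph {A : Type u} {B : Type v} [MetricSpace A] [LinearOrder A]
    [MetricSpace B] [LinearOrder B] {e : A ≃ B} {D : ℕ → Set (A × B)} (hmono : Monotone D)
    (hD : ∀ n, PIso N (D n)) (hgraph : ∀ a, ∃ n, (a, e a) ∈ D n) : IsTreeEmb e := by
  choose n hn using hgraph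
  refine ⟨fun x y => ?_, fun x y z => ?_⟩
  · exact (hD (max (n x) (n y))).lt _ (hmono (le_max_left _ _) (hn x)) _
      (hmono (le_max_right _ _) (hn y))
  · exact (hD (max (n x) (max (n y) (n z)))).dist _ (hmono (le_max_left _ _) (hn x)) _
      (hmono ((le_max_left _ _).trans (le_max_right _ _)) (hn y)) _
      (hmono ((le_max_right _ _).trans (le_max_right _ _)) (hn z))

theorem IsGeneric.isHomogeneous (h : IsGeneric N X) (hc : Countable X) (hn : NodeHom X) :
    IsHomogeneous N X where
  toIsGeneric := h
  countable := hc
  mem_BP g hg := mem_BP_of_isTreeEmb hn hg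
  extend R hfin hR := by
    obtain ⟨e, D, hmono, hD, hgraph, hext⟩ := exists_equiv_of_back_and_forth
      (fun R : Set (X × X) => R.Finite ∧ PIso N R)
      (by
        rintro R ⟨h1, h2⟩ x
        obtain ⟨x', hx'⟩ := exists_extension h.ordered h h1 h2 x
        exact ⟨_, ⟨h1.insert _, hx'⟩, subset_insert _ _, x', mem_insert _ _⟩)
      (by
        rintro R ⟨h1, h2⟩ x'
        obtain ⟨x, hx⟩ := exists_extension h.ordered h
          (h1.preimage Prod.swap_injective.injOn) h2.swap x'
        refine ⟨_, ⟨(h1.insert (x, x')), hx.swap.mono ?_⟩, subset_insert _ _, x, mem_insert _ _⟩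
        rintro p (rfl | hp)
        · exact mem_insert _ _
        · exact mem_insert_of_mem _ hp)
      (fun R hR p hp q hq => hR.2.eq_iff hp hq) ⟨hfin, hR⟩
    exact ⟨e, mem_BP_of_isTreeEmb hn (isTreeEmb_of_graph hmono (fun n => (hD n).2) hgraph), hext⟩

end Homogeneous

end OrdUltra

namespace OrdUltra

open Set

universe u v w

/-! ### A model -/

/-- Positive rational numbers, used as levels. -/
abbrev Level : Type := {t : ℚ // 0 < t}

/-- Functions on the levels which agree with `c` up to finitely many levels. -/
def Model {L : Type} (c : Level → L) : Type := {x : Level → L // {t | x t ≠ c t}.Finite}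

namespace Model

variable {L : Type} {c : Level → L}

/-- The level `t` is the highest one at which `x` and `y` differ. -/
def IsTop (x y : Model c) (t : Level) : Prop := x.1 t ≠ y.1 t ∧ ∀ s, t < s → x.1 s = y.1 s

theorem IsTop.symm {x y : Model c} {t : Level} (h : IsTop x y t) : IsTop y x t :=
  ⟨h.1.symm, fun s hs => (h.2 s hs).symm⟩

theorem exists_isTop {x y : Model c} (h : x ≠ y) : ∃ t, IsTop x y t := by
  have hfin : {t | x.1 t ≠ y.1 t}.Finite := by
    refine (x.2.union y.2).subset fun t ht => ?_
    by_contra hcon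
    simp only [mem_union, mem_ofPred_eq, not_or, not_not] at hcon
    exact ht (hcon.1.trans hcon.2.symm)
  have hne : {t | x.1 t ≠ y.1 t}.Nonempty := by
    by_contra hcon
    rw [not_nonempty_iff_eq_empty, eq_empty_iff_forall_notMem] at hcon
    exact h (Subtype.ext (funext fun t => not_not.1 (hcon t)))
  obtain ⟨t, ht⟩ := hfin.exists_maximal hne
  refine ⟨t, ht.prop, fun s hs => ?_⟩
  by_contra hcon
  exact (ht.le_of_ge (y := s) hcon hs.le).not_gt hs

theorem IsTop.eq {x y : Model c} {t s : Level} (h : IsTop x y t) (h' : IsTop x y s) : t = s := by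
  rcases lt_trichotomy t s with h1 | h1 | h1
  · exact absurd (h.2 s h1) h'.1
  · exact h1
  · exact absurd (h'.2 t h1) h.1

open Classical in
/-- The highest level at which `x` and `y` differ, or zero. -/
noncomputable def gap (x y : Model c) : ℝ :=
  if h : ∃ t, IsTop x y t then ((h.choose : Level) : ℚ) else 0

theorem IsTop.gap_eq {x y : Model c} {t : Level} (h : IsTop x y t) : gap x y = ((t : ℚ) : ℝ) := by
  have h' : ∃ t, IsTop x y t := ⟨t, h⟩
  unfold gap
  rw [dif_pos h', h'.choose_spec.eq h]

theorem gap_self (x : Model c) : gap x x = 0 := by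
  unfold gap
  rw [dif_neg]
  rintro ⟨t, ht⟩
  exact ht.1 rfl

theorem le_gap {x y : Model c} {t : Level} (h : x.1 t ≠ y.1 t) : ((t : ℚ) : ℝ) ≤ gap x y := by
  obtain ⟨s, hs⟩ := exists_isTop (x := x) (y := y) fun he => h (by rw [he])
  rw [hs.gap_eq]
  have : t ≤ s := not_lt.1 fun h1 => h (hs.2 t h1)
  exact_mod_cast this

theorem gap_pos {x y : Model c} (h : x ≠ y) : 0 < gap x y := by
  obtain ⟨t, ht⟩ := exists_isTop h
  rw [ht.gap_eq]
  exact_mod_cast t.2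

theorem gap_nonneg (x y : Model c) : 0 ≤ gap x y := by
  rcases eq_or_ne x y with rfl | h
  · rw [gap_self]
  · exact (gap_pos h).le

theorem gap_comm (x y : Model c) : gap x y = gap y x := by
  rcases eq_or_ne x y with rfl | h
  · rfl
  · obtain ⟨t, ht⟩ := exists_isTop h
    rw [ht.gap_eq, ht.symm.gap_eq]

theorem gap_ultra (x y z : Model c) : gap x z ≤ max (gap x y) (gap y z) := by
  rcases eq_or_ne x z with rfl | h
  · rw [gap_self]
    exact (gap_nonneg _ _).trans (le_max_left _ _)
  · obtain ⟨t, ht⟩ := exists_isTop h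
    rw [ht.gap_eq]
    by_cases hxy : x.1 t = y.1 t
    · exact (le_gap (hxy ▸ ht.1)).trans (le_max_right _ _)
    · exact (le_gap hxy).trans (le_max_left _ _)

noncomputable instance : MetricSpace (Model c) where
  dist := gap
  dist_self := gap_self
  dist_comm := gap_comm
  dist_triangle x y z := (gap_ultra x y z).trans
    (max_le_add_of_nonneg (gap_nonneg _ _) (gap_nonneg _ _))
  eq_of_dist_eq_zero {x y} h := by
    by_contra hne
    exact (gap_pos hne).ne' h

theorem IsTop.dist_eq {x y : Model c} {t : Level} (h : IsTop x y t) :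
    dist x y = ((t : ℚ) : ℝ) := h.gap_eq

open Classical in
/-- Change the value of `x` at the level `t`. -/
noncomputable def update (x : Model c) (t : Level) (l : L) : Model c :=
  ⟨Function.update x.1 t l, by
    refine (x.2.insert t).subset fun s hs => ?_
    by_cases hst : s = t
    · exact Or.inl hst
    · rw [mem_ofPred_eq, Function.update_of_ne hst] at hs
      exact Or.inr hs⟩

theorem update_self (x : Model c) (t : Level) (l : L) : (x.update t l).1 t = l :=
  Function.update_self _ _ _

theorem update_ne (x : Model c) {t s : Level} (h : s ≠ t) (l : L) :
    (x.update t l).1 s = x.1 s := Function.update_of_ne h _ _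

theorem isTop_update {x y : Model c} {t : Level} {l : L} (hl : x.1 t ≠ l)
    (hxy : ∀ s, t < s → x.1 s = y.1 s) : IsTop x (y.update t l) t := by
  refine ⟨by rwa [update_self], fun s hs => ?_⟩
  rw [update_ne _ hs.ne']
  exact hxy s hs

theorem isTop_update_update {x : Model c} {t : Level} {l m : L} (hl : l ≠ m) :
    IsTop (x.update t l) (x.update t m) t := by
  refine isTop_update (by rwa [update_self]) fun s hs => update_ne _ hs.ne' _

theorem eq_above {x y : Model c} {t : Level} (h : dist x y ≤ ((t : ℚ) : ℝ)) {s : Level}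
    (hs : t < s) : x.1 s = y.1 s := by
  by_contra hne
  have h1 : ((s : ℚ) : ℝ) ≤ dist x y := le_gap hne
  have h2 : ((s : ℚ) : ℝ) ≤ ((t : ℚ) : ℝ) := h1.trans h
  exact hs.not_ge (by exact_mod_cast h2)

theorem dist_le_of_eq_above {x y : Model c} {t : Level} (h : ∀ s, t < s → x.1 s = y.1 s) :
    dist x y ≤ ((t : ℚ) : ℝ) := by
  rcases eq_or_ne x y with rfl | hne
  · rw [dist_self]
    exact_mod_cast t.2.le
  · obtain ⟨s, hs⟩ := exists_isTop hne
    rw [hs.dist_eq]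
    have : s ≤ t := not_lt.1 fun h1 => hs.1 (h s h1)
    exact_mod_cast this

theorem countable [Countable L] : Countable (Model c) := by
  classical
  have hinj : Function.Injective
      (fun x : Model c => (x.2.toFinset.image fun t => (t, x.1 t) : Finset (Level × L))) := by
    intro x y hxy
    have key : ∀ {x y : Model c}, (x.2.toFinset.image fun t => (t, x.1 t) : Finset (Level × L)) =
        (y.2.toFinset.image fun t => (t, y.1 t) : Finset (Level × L)) →
        ∀ t, x.1 t ≠ c t → x.1 t = y.1 t := by
      intro x y h t ht
      have : (t, x.1 t) ∈ (x.2.toFinset.image fun t => (t, x.1 t) : Finset (Level × L)) :=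
        Finset.mem_image.2 ⟨t, by simpa using ht, rfl⟩
      rw [h, Finset.mem_image] at this
      obtain ⟨s, -, hs⟩ := this
      rw [Prod.mk.injEq] at hs
      rw [← hs.2, hs.1]
    refine Subtype.ext (funext fun t => ?_)
    by_cases h1 : x.1 t = c t
    · by_cases h2 : y.1 t = c t
      · rw [h1, h2]
      · exact (key hxy.symm t h2).symm
    · exact key hxy t h1
  exact hinj.countable

/-- The condition is vacuous: every positive rational is a distance from `x`, so a ball containing
`x` and `u` also contains points slightly farther from `x` than `u`. -/
theorem nodeHom [Nontrivial L] : NodeHom (Model c) := by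
  rintro x u - - - ⟨y, r, hr, hball⟩
  exfalso
  have hx : x ∈ Metric.ball y r := by
    rw [← hball, mem_ofPred_eq, dist_self]
    exact dist_nonneg
  have hu : u ∈ Metric.ball y r := by
    rw [← hball, mem_ofPred_eq]
  have hult : ∀ a b z : Model c, dist a z ≤ max (dist a b) (dist b z) := gap_ultra
  have hxu : dist x u < r := by
    refine (hult x y u).trans_lt (max_lt hx ?_)
    rw [dist_comm]
    exact hu
  obtain ⟨q, h1, h2⟩ := exists_rat_btwn hxu
  have hq : 0 < q := by exact_mod_cast (dist_nonneg.trans_lt h1)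
  obtain ⟨l, hl⟩ := exists_ne (x.1 ⟨q, hq⟩)
  have htop : IsTop x (x.update ⟨q, hq⟩ l) ⟨q, hq⟩ := isTop_update hl.symm fun _ _ => rfl
  have hmem : x.update ⟨q, hq⟩ l ∈ Metric.ball y r := by
    refine (hult _ x y).trans_lt (max_lt ?_ hx)
    rw [dist_comm, htop.dist_eq]
    exact h2
  rw [← hball, mem_ofPred_eq, htop.dist_eq] at hmem
  exact hmem.not_gt h1

variable [LinearOrder L]

/-- The order is decided at the highest level of difference. -/
def Lt (x y : Model c) : Prop := ∃ t, IsTop x y t ∧ x.1 t < y.1 t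

/-- Besides transitivity this yields convexity, since `dist x z` is read off at the larger of the
two levels. -/
theorem Lt.isTop_max {x y z : Model c} {t s : Level} (h1 : IsTop x y t) (h2 : x.1 t < y.1 t)
    (h3 : IsTop y z s) (h4 : y.1 s < z.1 s) :
    IsTop x z (max t s) ∧ x.1 (max t s) < z.1 (max t s) := by
  have hlt : x.1 (max t s) < z.1 (max t s) := by
    rcases lt_trichotomy t s with h | rfl | h
    · rw [max_eq_right h.le, h1.2 s h]
      exact h4
    · rw [max_self]
      exact h2.trans h4
    · rw [max_eq_left h.le, ← h3.2 t h]
      exact h2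
  refine ⟨⟨hlt.ne, fun r hr => ?_⟩, hlt⟩
  rw [max_lt_iff] at hr
  exact (h1.2 r hr.1).trans (h3.2 r hr.2)

open Classical in
noncomputable instance : LinearOrder (Model c) where
  le x y := x = y ∨ Lt x y
  lt x y := Lt x y
  le_refl x := Or.inl rfl
  le_trans := by
    rintro x y z (rfl | ⟨t, h1, h2⟩) (rfl | ⟨s, h3, h4⟩)
    · exact Or.inl rfl
    · exact Or.inr ⟨s, h3, h4⟩
    · exact Or.inr ⟨t, h1, h2⟩
    · exact Or.inr ⟨_, Lt.isTop_max h1 h2 h3 h4⟩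
  le_antisymm := by
    rintro x y (rfl | ⟨t, h1, h2⟩) (h | ⟨s, h3, h4⟩)
    · rfl
    · rfl
    · exact h.symm
    · rw [h1.eq h3.symm] at h2
      exact absurd h2 h4.not_gt
  le_total x y := by
    rcases eq_or_ne x y with rfl | h
    · exact Or.inl (Or.inl rfl)
    · obtain ⟨t, ht⟩ := exists_isTop h
      rcases lt_or_gt_of_ne ht.1 with h1 | h1
      · exact Or.inl (Or.inr ⟨t, ht, h1⟩)
      · exact Or.inr (Or.inr ⟨t, ht.symm, h1⟩)
  toDecidableLE := Classical.decRel _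
  lt_iff_le_not_ge x y := by
    constructor
    · rintro ⟨t, h1, h2⟩
      refine ⟨Or.inr ⟨t, h1, h2⟩, ?_⟩
      rintro (rfl | ⟨s, h3, h4⟩)
      · exact lt_irrefl _ h2
      · rw [h1.eq h3.symm] at h2
        exact h2.not_gt h4
    · rintro ⟨rfl | h1, h2⟩
      · exact absurd (Or.inl rfl) h2
      · exact h1

theorem lt_def (x y : Model c) : x < y ↔ ∃ t, IsTop x y t ∧ x.1 t < y.1 t := Iff.rfl

theorem IsTop.lt_iff {x y : Model c} {t : Level} (h : IsTop x y t) : x < y ↔ x.1 t < y.1 t := by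
  rw [lt_def]
  constructor
  · rintro ⟨s, hs, hlt⟩
    rwa [h.eq hs]
  · exact fun hlt => ⟨t, h, hlt⟩

theorem isOrderedUltrametric {N : ℕ∞}
    (hN : ∀ s : Set L, s.encard ≤ N) (h1 : 1 ≤ N) : IsOrderedUltrametric N (Model c) where
  ultrametric := gap_ultra
  rational x y := by
    rcases eq_or_ne x y with rfl | h
    · exact ⟨0, by simp⟩
    · obtain ⟨t, ht⟩ := exists_isTop h
      exact ⟨t, ht.dist_eq⟩
  convex := by
    rintro x y z ⟨t, h1, h2⟩ ⟨s, h3, h4⟩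
    rw [h1.dist_eq, (Lt.isTop_max h1 h2 h3 h4).1.dist_eq]
    exact_mod_cast le_max_left t s
  polygon r hr P hP := by
    by_cases hsub : P.Subsingleton
    · exact (encard_le_one_iff_subsingleton.2 hsub).trans h1
    · rw [not_subsingleton_iff] at hsub
      obtain ⟨a, ha, b, hb, hab⟩ := hsub
      obtain ⟨t, ht⟩ := exists_isTop hab
      have hrt : r = ((t : ℚ) : ℝ) := (hP a ha b hb hab).symm.trans ht.dist_eq
      -- All pairs of points of the polygon differ for the first time at the same level `t`, so the
      -- value at `t` separates them.
      have hinj : InjOn (fun x : Model c => x.1 t) P := by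
        intro x hx y hy hxy
        by_contra hne
        obtain ⟨s, hs⟩ := exists_isTop hne
        have : ((s : ℚ) : ℝ) = ((t : ℚ) : ℝ) := by
          rw [← hrt, ← hP x hx y hy hne, hs.dist_eq]
        have hst : s = t := Subtype.ext (by exact_mod_cast this)
        exact hs.1 (by rw [hst]; exact hxy)
      rw [← hinj.encard_image]
      exact hN _

/-- The set of colors which are dense among the levels. -/
def IsDenseColor (c : Level → L) (l : L) : Prop :=
  ∀ r s : ℝ, 0 ≤ r → r < s → ∃ t : Level, r < ((t : ℚ) : ℝ) ∧ ((t : ℚ) : ℝ) < s ∧ c t = l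

/-- Just above the levels of `S` there is an interval below the levels of `T` which avoids the
finitely many levels where `y` differs from `c`. There `y` has the values of `c`, among which `l` is
dense. -/
theorem exists_level_value {l : L} (hl : IsDenseColor c l) (y : Model c) (S T : Finset (Model c))
    (hST : ∀ a ∈ S, ∀ b ∈ T, dist y a < dist y b) (hT : ∀ b ∈ T, b ≠ y) :
    ∃ t : Level, (∀ a ∈ S, dist y a < ((t : ℚ) : ℝ)) ∧ (∀ b ∈ T, ((t : ℚ) : ℝ) < dist y b) ∧
      y.1 t = l := by
  obtain ⟨r, hr, hrS, hrT⟩ : ∃ r : ℝ, 0 ≤ r ∧ (∀ a ∈ S, dist y a ≤ r) ∧ ∀ b ∈ T, r < dist y b := by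
    rcases S.eq_empty_or_nonempty with rfl | hS
    · exact ⟨0, le_rfl, by simp, fun b hb => dist_pos.2 (hT b hb).symm⟩
    · obtain ⟨a, ha, hmax⟩ := S.exists_max_image (fun a => dist y a) hS
      exact ⟨dist y a, dist_nonneg, hmax, hST a ha⟩
  obtain ⟨s, hrs, hsT, hsE⟩ : ∃ s : ℝ, r < s ∧ (∀ b ∈ T, s ≤ dist y b) ∧
      ∀ t : Level, y.1 t ≠ c t → r < ((t : ℚ) : ℝ) → s ≤ ((t : ℚ) : ℝ) := by
    classical
    set E : Finset ℝ := (T.image fun b => dist y b) ∪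
      ((y.2.toFinset.image fun t : Level => ((t : ℚ) : ℝ)).filter fun v => r < v) with hE
    have hgt : ∀ v ∈ insert (r + 1) E, r < v := by
      intro v hv
      simp only [hE, Finset.mem_insert, Finset.mem_union, Finset.mem_image, Finset.mem_filter] at hv
      rcases hv with rfl | ⟨b, hb, rfl⟩ | ⟨-, hv⟩
      · linarith
      · exact hrT b hb
      · exact hv
    refine ⟨(insert (r + 1) E).min' ⟨_, Finset.mem_insert_self _ _⟩,
      hgt _ (Finset.min'_mem _ _), fun b hb => Finset.min'_le _ _ ?_,
      fun t ht hrt => Finset.min'_le _ _ ?_⟩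
    · simp only [hE, Finset.mem_insert, Finset.mem_union, Finset.mem_image]
      exact Or.inr (Or.inl ⟨b, hb, rfl⟩)
    · simp only [hE, Finset.mem_insert, Finset.mem_union, Finset.mem_image, Finset.mem_filter]
      exact Or.inr (Or.inr ⟨⟨t, (Set.Finite.mem_toFinset _).2 ht, rfl⟩, hrt⟩)
  obtain ⟨t, h1, h2, h3⟩ := hl r s hr hrs
  refine ⟨t, fun a ha => (hrS a ha).trans_lt h1, fun b hb => h2.trans_le (hsT b hb), ?_⟩
  by_contra hne
  rw [← h3] at hne
  exact (hsE t hne h1).not_gt h2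

theorem leftBranches_eq (x : Model c) (t : Level) :
    leftBranches x ((t : ℚ) : ℝ) =
      (fun l => Metric.ball (x.update t l) ((t : ℚ) : ℝ)) '' Iio (x.1 t) := by
  ext s
  constructor
  · rintro ⟨u, hu, hut, rfl⟩
    obtain ⟨s, hs⟩ := exists_isTop hu.ne
    have hst : s = t := Subtype.ext (by
      have := hs.dist_eq.symm.trans hut
      exact_mod_cast this)
    subst hst
    refine ⟨u.1 s, hs.lt_iff.1 hu, ?_⟩
    have hlt : dist (x.update s (u.1 s)) u < ((s : ℚ) : ℝ) := by
      rcases eq_or_ne (x.update s (u.1 s)) u with h | h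
      · rw [h, dist_self]
        exact_mod_cast s.2
      · obtain ⟨r, hr⟩ := exists_isTop h
        rw [hr.dist_eq]
        have : r < s := by
          by_contra hcon
          rcases (not_lt.1 hcon).eq_or_lt with h1 | h1
          · exact hr.1 (by rw [← h1, update_self])
          · exact hr.1 (by rw [update_ne _ h1.ne', ← hs.2 r h1])
        exact_mod_cast this
    have h := isOrderedUltrametric (c := c) (N := ⊤) (fun _ => le_top) le_top
    exact h.ball_eq hlt
  · rintro ⟨l, hl, rfl⟩
    have htop : IsTop (x.update t l) x t := (isTop_update (ne_of_gt hl) fun _ _ => rfl).symm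
    refine ⟨_, ?_, htop.dist_eq, rfl⟩
    rw [htop.lt_iff, update_self]
    exact hl

theorem ncard_leftBranches (x : Model c) (t : Level) :
    (leftBranches x ((t : ℚ) : ℝ)).ncard = (Iio (x.1 t)).ncard := by
  rw [leftBranches_eq]
  refine ncard_image_of_injective _ fun l m hlm => ?_
  by_contra hne
  refine ball_ne_ball ?_ (isTop_update_update (x := x) (t := t) hne).dist_eq hlm
  exact_mod_cast t.2

end Model

/-- The model with branching of size `n`. -/
theorem isGeneric_model_fin {n : ℕ} (hn : 2 ≤ n) {c : Level → Fin n}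
    (hc : ∀ l, Model.IsDenseColor c l) : IsGeneric (n : ℕ∞) (Model c) := by
  have hord : IsOrderedUltrametric (n : ℕ∞) (Model c) := by
    refine Model.isOrderedUltrametric (fun s => ?_) (by exact_mod_cast (by omega : 1 ≤ n))
    refine (encard_le_encard (subset_univ s)).trans ?_
    rw [encard_univ, ENat.card_eq_coe_fintype_card, Fintype.card_fin]
  have hlab : ∀ {x y : Model c} {t : Level}, Model.IsTop x y t →
      lab (n : ℕ∞) x y = (x.1 t).val := by
    intro x y t ht
    unfold lab
    rw [if_neg (ENat.natCast_ne_top n), ht.dist_eq, Model.ncard_leftBranches, ← Finset.coe_Iio,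
      ncard_coe_finset, Fin.card_Iio]
  refine ⟨hord, ⟨⟨c, by simp⟩⟩, ?_, fun h => absurd h (ENat.natCast_ne_top n), ?_⟩
  · rintro y S T hST hT ⟨i, j, s⟩ hk
    obtain ⟨hi, hj, hij, hs⟩ := hk.2 (ENat.natCast_ne_top n)
    simp only at hi hj hij hs
    have hi' : i < n := by exact_mod_cast hi
    have hj' : j < n := by exact_mod_cast hj
    -- The label of a point at level `t` is its value there. So a level where `y` has value `i` is
    -- needed, and changing this value to `j` produces the color.
    obtain ⟨t, h1, h2, h3⟩ := Model.exists_level_value (hc ⟨i, hi'⟩) y S T hST hT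
    have htop : Model.IsTop y (y.update t ⟨j, hj'⟩) t := by
      refine Model.isTop_update ?_ fun _ _ => rfl
      rw [h3]
      intro h
      exact hij (Fin.mk.inj_iff.1 h)
    refine ⟨y.update t ⟨j, hj'⟩, ?_, ?_, ?_, ?_⟩
    · intro h
      exact htop.1 (by rw [h])
    · unfold col
      rw [hlab htop, hlab htop.symm, Model.update_self, h3, htop.lt_iff, Model.update_self, h3,
        propext hs]
      rfl
    · rw [htop.dist_eq]
      exact h1
    · rw [htop.dist_eq]
      exact h2
  · intro _ y w hyw
    obtain ⟨t, ht⟩ := Model.exists_isTop hyw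
    rw [ht.dist_eq]
    refine ⟨range fun l => y.update t l, ?_, ?_, ?_⟩
    · rintro _ ⟨l, rfl⟩ _ ⟨m, rfl⟩ hlm
      exact (Model.isTop_update_update fun h => hlm (by rw [h])).dist_eq
    · rw [← image_univ, Function.Injective.encard_image, encard_univ,
        ENat.card_eq_coe_fintype_card, Fintype.card_fin]
      intro l m hlm
      have := congrArg (fun x : Model c => x.1 t) hlm
      simpa [Model.update_self] using this
    · rintro _ ⟨l, rfl⟩
      exact Model.dist_le_of_eq_above fun s hs => Model.update_ne _ hs.ne' _

/-- The model with unbounded branching. -/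
theorem isGeneric_model_rat : IsGeneric ⊤ (Model fun _ : Level => (0 : ℚ)) := by
  have hord : IsOrderedUltrametric ⊤ (Model fun _ : Level => (0 : ℚ)) :=
    Model.isOrderedUltrametric (fun _ => le_top) le_top
  refine ⟨hord, ⟨⟨fun _ => 0, by simp⟩⟩, ?_, ?_, fun h => absurd rfl h⟩
  · rintro y S T hST hT ⟨i, j, s⟩ hk
    obtain ⟨hi, hj⟩ := hk.1 rfl
    simp only at hi hj
    subst hi hj
    have hdense : Model.IsDenseColor (fun _ : Level => (0 : ℚ)) 0 := by
      intro r s hr hrs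
      obtain ⟨q, h1, h2⟩ := exists_rat_btwn hrs
      exact ⟨⟨q, by exact_mod_cast hr.trans_lt h1⟩, h1, h2, rfl⟩
    obtain ⟨t, h1, h2, h3⟩ := Model.exists_level_value hdense y S T hST hT
    obtain ⟨l, hl0, hls⟩ : ∃ l : ℚ, l ≠ 0 ∧ (0 < l ↔ s) := by
      by_cases hs : s
      · exact ⟨1, by norm_num, by simpa using hs⟩
      · exact ⟨-1, by norm_num, iff_of_false (by norm_num) hs⟩
    have htop : Model.IsTop y (y.update t l) t :=
      Model.isTop_update (by rw [h3]; exact hl0.symm) fun _ _ => rfl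
    refine ⟨y.update t l, ?_, ?_, ?_, ?_⟩
    · intro h
      exact htop.1 (by rw [h])
    · unfold col
      rw [lab_top rfl, lab_top rfl, htop.lt_iff, Model.update_self, h3, propext hls]
    · rw [htop.dist_eq]
      exact h1
    · rw [htop.dist_eq]
      exact h2
  · intro _ y w hyw S T hS hT hST
    obtain ⟨t, ht⟩ := Model.exists_isTop hyw
    rw [ht.dist_eq] at *
    classical
    obtain ⟨l, hl1, hl2⟩ := Order.exists_between_finsets (S.image fun a => a.1 t)
      (T.image fun a => a.1 t) (by
        simp only [Finset.mem_image]
        rintro _ ⟨a, ha, rfl⟩ _ ⟨b, hb, rfl⟩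
        obtain ⟨h1, h2⟩ := hST a ha b hb
        obtain ⟨s, hs⟩ := Model.exists_isTop h1.ne
        have hst : s = t := Subtype.ext (by
          have := hs.dist_eq.symm.trans h2
          exact_mod_cast this)
        rw [← hst]
        exact hs.lt_iff.1 h1)
    refine ⟨y.update t l, ?_, fun a ha => ?_, fun b hb => ?_⟩
    · rw [dist_comm]
      exact Model.dist_le_of_eq_above fun s hs => Model.update_ne _ hs.ne' _
    · have hlt := hl1 _ (Finset.mem_image_of_mem _ ha)
      have htop : Model.IsTop a (y.update t l) t :=
        Model.isTop_update hlt.ne fun s hs => (Model.eq_above (hS a ha) hs).symm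
      exact ⟨htop.lt_iff.2 (by rwa [Model.update_self]), htop.dist_eq⟩
    · have hlt := hl2 _ (Finset.mem_image_of_mem _ hb)
      have htop : Model.IsTop b (y.update t l) t :=
        Model.isTop_update hlt.ne' fun s hs => (Model.eq_above (hT b hb) hs).symm
      exact ⟨htop.symm.lt_iff.2 (by rwa [Model.update_self]), htop.symm.dist_eq⟩

/-- A coloring of the levels with `n` dense colors. -/
theorem exists_dense_coloring {n : ℕ} (hn : 0 < n) :
    ∃ c : Level → Fin n, ∀ l, Model.IsDenseColor c l := by
  -- A reduced dyadic fraction with denominator `2 ^ e` has color `e % n`, and such fractions are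
  -- dense even with `e` restricted to one residue class.
  refine ⟨fun t => ⟨Nat.log 2 t.1.den % n, Nat.mod_lt _ hn⟩, fun l r s hr hrs => ?_⟩
  obtain ⟨k, hk⟩ := exists_pow_lt_of_lt_one (show (0 : ℝ) < (s - r) / 4 by linarith)
    (show (1 / 2 : ℝ) < 1 by norm_num)
  -- This exponent is congruent to `l` and at least `k`, hence `(s - r) * 2 ^ e > 4`. That leaves
  -- room for the odd numerator `2 * m + 1`, which exceeds `r * 2 ^ e` by at most `3`.
  set e := n * (k + 1) + l.val with he
  have hek : k ≤ e := by
    have : k + 1 ≤ n * (k + 1) := Nat.le_mul_of_pos_left _ hn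
    omega
  have he0 : e ≠ 0 := by
    have : 0 < n * (k + 1) := by positivity
    omega
  have hpow : (1 / 2 : ℝ) ^ e < (s - r) / 4 :=
    (pow_le_pow_of_le_one (by norm_num) (by norm_num) hek).trans_lt hk
  have h2e : (0 : ℝ) < 2 ^ e := by positivity
  set m : ℤ := ⌊r * 2 ^ e / 2⌋ + 1 with hm
  have hm1 : r * 2 ^ e / 2 < m := by
    rw [hm]
    push_cast
    exact Int.lt_floor_add_one _
  have hm2 : (m : ℝ) ≤ r * 2 ^ e / 2 + 1 := by
    rw [hm]
    push_cast
    have := Int.floor_le (r * 2 ^ e / 2)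
    linarith
  have hm0 : 0 < m := by
    have : (0 : ℝ) < m := lt_of_le_of_lt (by positivity) hm1
    exact_mod_cast this
  set q : ℚ := ((2 * m + 1 : ℤ) : ℚ) / ((2 ^ e : ℤ) : ℚ) with hq
  have hqr : (q : ℝ) = (2 * m + 1) / 2 ^ e := by
    rw [hq]
    push_cast
    rfl
  have hden : q.den = 2 ^ e := by
    have hcop : Nat.Coprime (2 * m + 1).natAbs (2 ^ e : ℤ).natAbs := by
      rw [Int.natAbs_pow]
      apply Nat.Coprime.pow_right
      rw [show (2 : ℤ).natAbs = 2 from rfl, Nat.coprime_two_right, Int.natAbs_odd]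
      exact ⟨m, rfl⟩
    have := Rat.den_div_eq_of_coprime (a := 2 * m + 1) (b := 2 ^ e) (by positivity) hcop
    have h3 : ((q.den : ℤ)) = ((2 ^ e : ℕ) : ℤ) := by
      rw [hq, this]
      push_cast
      rfl
    exact_mod_cast h3
  have hqpos : 0 < q := by
    have : (0 : ℝ) < q := by
      rw [hqr]
      have : (0 : ℝ) < m := by exact_mod_cast hm0
      positivity
    exact_mod_cast this
  refine ⟨⟨q, hqpos⟩, ?_, ?_, ?_⟩
  · change r < (q : ℝ)
    rw [hqr, lt_div_iff₀ h2e]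
    linarith
  · change (q : ℝ) < s
    rw [hqr, div_lt_iff₀ h2e]
    have h4 : (1 / 2 : ℝ) ^ e * 2 ^ e = 1 := by
      rw [← mul_pow]
      norm_num
    have h5 := mul_lt_mul_of_pos_right hpow h2e
    rw [h4] at h5
    linarith
  · apply Fin.ext
    change Nat.log 2 q.den % n = l.val
    rw [hden, Nat.log_pow (by norm_num), he, Nat.mul_add_mod, Nat.mod_eq_of_lt l.2]

end OrdUltra

namespace OrdUltra

open Set

universe u v w

/-! ### Urysohn spaces and homogeneous spaces -/

theorem exists_isHomogeneous (N : ℕ∞) (hN : 2 ≤ N) :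
    ∃ (X : Type) (_ : MetricSpace X) (_ : LinearOrder X), IsHomogeneous N X := by
  rcases eq_or_ne N ⊤ with rfl | htop
  · exact ⟨_, _, _, isGeneric_model_rat.isHomogeneous Model.countable Model.nodeHom⟩
  · lift N to ℕ using htop
    have hN' : 2 ≤ N := by exact_mod_cast hN
    obtain ⟨c, hc⟩ := exists_dense_coloring (show 0 < N by omega)
    have : Nontrivial (Fin N) := Fin.nontrivial_iff_two_le.2 hN'
    exact ⟨_, _, _, (isGeneric_model_fin hN' hc).isHomogeneous Model.countable Model.nodeHom⟩

section Urysohn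

variable {N : ℕ∞} {X : Type u} [MetricSpace X] [LinearOrder X]

/-- The graph of a map on a subset respecting labels is a partial isomorphism. -/
theorem IsTreeEmb.pIso {D : Set X} {f : D → X} (hf : IsTreeEmb f) {S : Set X}
    (hlab : ∀ x y : D, (x : X) ∈ S → (y : X) ∈ S → lab N (f x) (f y) = lab N (x : X) y) :
    PIso N ((fun a : D => ((a : X), f a)) '' {a | (a : X) ∈ S}) := by
  constructor
  · rintro _ ⟨p, -, rfl⟩ _ ⟨q, -, rfl⟩
    exact hf.1 p q
  · rintro _ ⟨p, -, rfl⟩ _ ⟨q, -, rfl⟩ _ ⟨r, -, rfl⟩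
    exact hf.2 p q r
  · rintro _ ⟨p, hp, rfl⟩ _ ⟨q, hq, rfl⟩
    exact (hlab p q hp hq).symm

/-- This explains why homogeneity is only weak. An embedding of `A` alone may change labels, but
once full polygons at all nodes spanned by `A` belong to the domain it cannot. -/
theorem IsGeneric.exists_full (h : IsGeneric N X) (hN : N ≠ ⊤) {A : Set X} (hA : A.Finite) :
    ∃ A', A'.Finite ∧ A ⊆ A' ∧ ∀ x ∈ A, ∀ y ∈ A, x ≠ y → ∃ P ⊆ A', IsPolygon (dist x y) P ∧
      P.encard = N ∧ ∀ p ∈ P, dist p x ≤ dist x y := by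
  choose! P h1 h2 h3 using h.node_fin hN
  have hPfin : ∀ x y, x ≠ y → (P x y).Finite := by
    intro x y hxy
    rw [← encard_lt_top_iff, h2 x y hxy]
    exact lt_top_iff_ne_top.2 hN
  refine ⟨A ∪ ⋃ p ∈ (A ×ˢ A) ∩ {p | p.1 ≠ p.2}, P p.1 p.2, ?_, subset_union_left, ?_⟩
  · refine hA.union (((hA.prod hA).subset inter_subset_left).biUnion ?_)
    rintro p ⟨-, hp⟩
    exact hPfin _ _ hp
  · intro x hx y hy hxy
    refine ⟨P x y, ?_, h1 x y hxy, h2 x y hxy, h3 x y hxy⟩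
    refine subset_union_of_subset_right ?_ _
    exact subset_biUnion_of_mem (u := fun p : X × X => P p.1 p.2)
      (show (x, y) ∈ (A ×ˢ A) ∩ {p | p.1 ≠ p.2} from ⟨⟨hx, hy⟩, hxy⟩)

/-- Both sides equal the label computed inside `D`, since `f` and the inclusion of `D` both carry
the full polygon along. -/
theorem lab_eq_of_full (h : IsOrderedUltrametric N X) (hN : N ≠ ⊤) {B : Type v} [MetricSpace B]
    [LinearOrder B] (hB : IsOrderedUltrametric N B) {D : Set X} {f : D → B} (hf : IsTreeEmb f)
    {x y : D} (hxy : x ≠ y) {P : Set X} (hPD : P ⊆ D) (hP : IsPolygon (dist (x : X) y) P)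
    (hPN : P.encard = N) (hPx : ∀ p ∈ P, dist p x ≤ dist (x : X) y) :
    lab N (f x) (f y) = lab N (x : X) y := by
  set Q : Set D := Subtype.val ⁻¹' P with hQ
  have hQP : Subtype.val '' Q = P := by
    rw [hQ, Subtype.image_preimage_coe, inter_eq_self_of_subset_right hPD]
  have hQ1 : IsPolygon (dist x y) Q := fun a ha b hb hab =>
    hP a ha b hb fun he => hab (Subtype.ext he)
  have hQN : Q.encard = N := by
    rw [← hPN, ← hQP, Subtype.val_injective.encard_image]
  have hQx : ∀ p ∈ Q, dist p x ≤ dist x y := fun p hp => hPx p hp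
  rw [lab_eq_of_polygon (h.subtype D) hB hN hf hxy hQ1 hQN hQx]
  exact (lab_eq_of_polygon (h.subtype D) h hN (isTreeEmb_subtype D) hxy hQ1 hQN hQx).symm

theorem IsHomogeneous.isUrysohn (h : IsHomogeneous N X) : IsUrysohn N X where
  countable := h.countable
  ordered := h.ordered
  universal B _ _ _ hB := by
    obtain ⟨f, hf⟩ := exists_treeEmb hB h.toIsGeneric
    exact ⟨f, hf.isOrderedBPInjection⟩
  homogeneous A hA := by
    have hord := h.ordered
    obtain ⟨A', hA', hsub, hfull⟩ : ∃ A' : Set X, A'.Finite ∧ A ⊆ A' ∧ ∀ f : A' → X, IsTreeEmb f →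
        ∀ x y : A', (x : X) ∈ A → (y : X) ∈ A → lab N (f x) (f y) = lab N (x : X) y := by
      by_cases hN : N = ⊤
      · exact ⟨A, hA, le_rfl, fun f hf x y _ _ => by rw [lab_top hN, lab_top hN]⟩
      · obtain ⟨A', h1, h2, h3⟩ := h.exists_full hN hA
        refine ⟨A', h1, h2, fun f hf x y hx hy => ?_⟩
        rcases eq_or_ne x y with rfl | hxy
        · rw [lab_self, lab_self]
        · obtain ⟨P, h4, h5, h6, h7⟩ := h3 x hx y hy fun he => hxy (Subtype.ext he)
          exact lab_eq_of_full hord hN hord hf hxy h4 h5 h6 h7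
    refine ⟨A', hA', hsub, fun f hf => ?_⟩
    have hf' := hf.isTreeEmb (hord.subtype A') hord
    have := hA'.to_subtype
    obtain ⟨g, hg, hgf⟩ := h.extend _ ((toFinite _).image _) (hf'.pIso (hfull f hf'))
    exact ⟨g, hg, fun a ha => hgf _ ⟨a, ha, rfl⟩⟩

/-- Finite parts of a Urysohn space can be enlarged as in any generic space. -/
theorem IsUrysohn.exists_transfer (h : IsUrysohn N X) {Y : Type} [MetricSpace Y] [LinearOrder Y]
    (hY : IsGeneric N Y) {A : Set X} (hA : A.Finite) :
    ∃ φ : A → Y, IsTreeEmb φ ∧ ∀ Q : Set Y, Q.Finite → ∃ ψ : (Q ∪ range φ : Set Y) → X,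
      IsTreeEmb ψ ∧ ∀ a : A, ψ ⟨φ a, Or.inr (mem_range_self a)⟩ = a := by
  obtain ⟨A', hA', hsub, hhom⟩ := h.homogeneous A hA
  have := hA'.to_subtype
  have := hA.to_subtype
  obtain ⟨φ', hφ'⟩ := exists_treeEmb (h.ordered.subtype A') hY
  have hincl : IsTreeEmb (inclusion hsub) := ⟨fun _ _ => Iff.rfl, fun _ _ _ => Iff.rfl⟩
  refine ⟨φ' ∘ inclusion hsub, hφ'.comp hincl, fun Q hQ => ?_⟩
  set Q' : Set Y := Q ∪ range φ' with hQ'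
  have hQfin : Finite Q' := (hQ.union (finite_range φ')).to_subtype
  obtain ⟨ψ', hψ'⟩ := h.universal Q' inferInstance (hY.ordered.subtype Q')
  have hψ := hψ'.isTreeEmb (hY.ordered.subtype Q') h.ordered
  have hlift : IsTreeEmb (fun a : A' => (⟨φ' a, Or.inr (mem_range_self a)⟩ : Q')) :=
    ⟨fun x y => hφ'.1 x y, fun x y z => hφ'.2 x y z⟩
  -- Going from `A'` to `Y` and back to `X` agrees on `A` with an automorphism `g`. Undoing `g`
  -- turns the copy of `Q` in `X` into one over `A` itself.
  obtain ⟨g, hg, hgf⟩ := hhom _ (hψ.comp hlift).isOrderedBPInjection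
  have hsub' : Q ∪ range (φ' ∘ inclusion hsub) ⊆ Q' :=
    union_subset_union_right _ (range_comp_subset_range _ _)
  have hincl' : IsTreeEmb (inclusion hsub') := ⟨fun _ _ => Iff.rfl, fun _ _ _ => Iff.rfl⟩
  have hgt : IsTreeEmb g.symm := IsTreeEmb.symm (IsOrderedBP.isTreeEmb h.ordered h.ordered hg)
  refine ⟨g.symm ∘ ψ' ∘ inclusion hsub', hgt.comp (hψ.comp hincl'), fun a => ?_⟩
  have := hgf (inclusion hsub a) a.2
  rw [Function.comp_apply, Equiv.symm_apply_eq]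
  exact this.symm

/-- Each extension property asks for finitely many points over a finite configuration. The
configuration is moved to a homogeneous model, the points are found there, and `exists_transfer`
brings them back. -/
theorem IsUrysohn.isGeneric (h : IsUrysohn N X) (hN : 2 ≤ N) : IsGeneric N X := by
  obtain ⟨Y, _, _, hY⟩ := exists_isHomogeneous N hN
  have hYo := hY.ordered
  refine ⟨h.ordered, ?_, ?_, ?_, ?_⟩
  · obtain ⟨y⟩ := hY.nonempty
    obtain ⟨f, -⟩ := h.universal ({y} : Set Y) inferInstance (hYo.subtype _)
    exact ⟨f ⟨y, rfl⟩⟩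
  · classical
    intro y S T hST hT k hk
    obtain ⟨φ, hφ, htr⟩ := h.exists_transfer hY.toIsGeneric
      (((S ∪ T).finite_toSet).insert y)
    have hy : y ∈ insert y ((S ∪ T : Finset X) : Set X) := mem_insert _ _
    have hS : ∀ a ∈ S, a ∈ insert y ((S ∪ T : Finset X) : Set X) := fun a ha =>
      mem_insert_of_mem _ (by simp [ha])
    have hT' : ∀ a ∈ T, a ∈ insert y ((S ∪ T : Finset X) : Set X) := fun a ha =>
      mem_insert_of_mem _ (by simp [ha])
    obtain ⟨z, hzy, hcol, hzS, hzT⟩ := hY.exists_level (y := φ ⟨y, hy⟩)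
      (φ '' {a | (a : X) ∈ S}) (φ '' {a | (a : X) ∈ T})
      ((S.finite_toSet.preimage Subtype.val_injective.injOn).image _)
      ((T.finite_toSet.preimage Subtype.val_injective.injOn).image _)
      (by
        rintro _ ⟨a, ha, rfl⟩ _ ⟨b, hb, rfl⟩
        exact (hφ.2 _ _ _).1 (hST a ha b hb))
      (by
        rintro ⟨b, hb, hby⟩
        exact hT b hb (congrArg Subtype.val (hφ.injective hby))) hk
    -- For finite `N` a full polygon at the node of `y` and `z` is transferred together with `z`, so
    -- that the color survives.
    obtain ⟨P, hPfin, hP⟩ : ∃ P : Set Y, P.Finite ∧ (N ≠ ⊤ →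
        IsPolygon (dist (φ ⟨y, hy⟩) z) P ∧ P.encard = N ∧
        ∀ p ∈ P, dist p (φ ⟨y, hy⟩) ≤ dist (φ ⟨y, hy⟩) z) := by
      by_cases hN : N = ⊤
      · exact ⟨∅, finite_empty, fun h => absurd hN h⟩
      · obtain ⟨P, h1, h2, h3⟩ := hY.node_fin hN _ _ hzy.symm
        refine ⟨P, ?_, fun _ => ⟨h1, h2, h3⟩⟩
        rw [← encard_lt_top_iff, h2]
        exact lt_top_iff_ne_top.2 hN
    obtain ⟨ψ, hψ, hψφ⟩ := htr (insert z P) (hPfin.insert z)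
    have hzm : z ∈ insert z P ∪ range φ := Or.inl (mem_insert _ _)
    have hne : (⟨φ ⟨y, hy⟩, Or.inr (mem_range_self _)⟩ : (insert z P ∪ range φ : Set Y)) ≠
        ⟨z, hzm⟩ := fun he => hzy (congrArg Subtype.val he).symm
    refine ⟨ψ ⟨z, hzm⟩, ?_, ?_, ?_, ?_⟩
    · intro he
      exact hne (hψ.injective (he.trans (hψφ ⟨y, hy⟩).symm)).symm
    · rw [← hcol]
      have hside : y < ψ ⟨z, hzm⟩ ↔ φ ⟨y, hy⟩ < z := by
        have h1 := hψ.1 ⟨φ ⟨y, hy⟩, Or.inr (mem_range_self _)⟩ ⟨z, hzm⟩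
        rw [hψφ] at h1
        exact h1.symm
      by_cases hN : N = ⊤
      · exact col_top hN hside
      · obtain ⟨h1, h2, h3⟩ := hP hN
        have hsub : P ⊆ insert z P ∪ range φ := fun p hp => Or.inl (mem_insert_of_mem _ hp)
        have e1 := lab_eq_of_full hYo hN h.ordered hψ hne hsub h1 h2 h3
        have e2 := lab_eq_of_full hYo hN h.ordered hψ hne.symm hsub
          (by simpa only [dist_comm] using h1) h2 (by
            intro p hp
            refine (hYo.ultrametric _ (φ ⟨y, hy⟩) _).trans (max_le ?_ ?_)
            · rw [dist_comm z]
              exact h3 p hp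
            · rw [dist_comm z])
        rw [hψφ] at e1 e2
        unfold col
        rw [e1, e2, propext hside]
    · intro a ha
      have := hzS _ ⟨⟨a, hS a ha⟩, ha, rfl⟩
      have := (hψ.2 ⟨φ ⟨y, hy⟩, Or.inr (mem_range_self _)⟩
        ⟨φ ⟨a, hS a ha⟩, Or.inr (mem_range_self _)⟩ ⟨z, hzm⟩).1 this
      rwa [hψφ, hψφ] at this
    · intro a ha
      have := hzT _ ⟨⟨a, hT' a ha⟩, ha, rfl⟩
      have := (hψ.2 ⟨φ ⟨y, hy⟩, Or.inr (mem_range_self _)⟩ ⟨z, hzm⟩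
        ⟨φ ⟨a, hT' a ha⟩, Or.inr (mem_range_self _)⟩).1 this
      rwa [hψφ, hψφ] at this
  · classical
    intro hNt y w hyw S T hS hT hST
    obtain ⟨φ, hφ, htr⟩ := h.exists_transfer hY.toIsGeneric
      ((((S ∪ T).finite_toSet).insert w).insert y)
    have hy : y ∈ insert y (insert w ((S ∪ T : Finset X) : Set X)) := mem_insert _ _
    have hw : w ∈ insert y (insert w ((S ∪ T : Finset X) : Set X)) :=
      mem_insert_of_mem _ (mem_insert _ _)
    have hS' : ∀ a ∈ S, a ∈ insert y (insert w ((S ∪ T : Finset X) : Set X)) := fun a ha =>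
      mem_insert_of_mem _ (mem_insert_of_mem _ (by simp [ha]))
    have hT' : ∀ a ∈ T, a ∈ insert y (insert w ((S ∪ T : Finset X) : Set X)) := fun a ha =>
      mem_insert_of_mem _ (mem_insert_of_mem _ (by simp [ha]))
    have hne : φ ⟨y, hy⟩ ≠ φ ⟨w, hw⟩ := fun he =>
      hyw (congrArg Subtype.val (hφ.injective he))
    obtain ⟨z, hz, hzS, hzT⟩ := hY.exists_branch hNt hne
      (φ '' {a | (a : X) ∈ S}) (φ '' {a | (a : X) ∈ T})
      ((S.finite_toSet.preimage Subtype.val_injective.injOn).image _)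
      ((T.finite_toSet.preimage Subtype.val_injective.injOn).image _)
      (by
        rintro _ ⟨a, ha, rfl⟩
        exact (hφ.dist_le_iff _ _ _).1 (hS a ha))
      (by
        rintro _ ⟨a, ha, rfl⟩
        exact (hφ.dist_le_iff _ _ _).1 (hT a ha))
      (by
        rintro _ ⟨a, ha, rfl⟩ _ ⟨b, hb, rfl⟩
        obtain ⟨h1, h2⟩ := hST a ha b hb
        exact ⟨(hφ.1 _ _).1 h1, hφ.dist_eq_of_node (h.ordered.subtype _) hYo (hS a ha) h2⟩)
    obtain ⟨ψ, hψ, hψφ⟩ := htr {z} (finite_singleton z)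
    have hzm : z ∈ {z} ∪ range φ := Or.inl rfl
    have hmem : ∀ a, φ a ∈ {z} ∪ range φ := fun a => Or.inr (mem_range_self a)
    refine ⟨ψ ⟨z, hzm⟩, ?_, ?_, ?_⟩
    · have := (hψ.dist_le_iff ⟨φ ⟨y, hy⟩, hmem _⟩ ⟨z, hzm⟩ ⟨φ ⟨w, hw⟩, hmem _⟩).1 hz
      rwa [hψφ, hψφ] at this
    · intro a ha
      obtain ⟨h1, h2⟩ := hzS _ ⟨⟨a, hS' a ha⟩, ha, rfl⟩
      have h3 := (hψ.1 ⟨φ ⟨a, hS' a ha⟩, hmem _⟩ ⟨z, hzm⟩).1 h1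
      have h4 := hψ.dist_eq_of_node (hYo.subtype _) h.ordered (y := ⟨φ ⟨y, hy⟩, hmem _⟩)
        (w := ⟨φ ⟨w, hw⟩, hmem _⟩) (a := ⟨φ ⟨a, hS' a ha⟩, hmem _⟩) (b := ⟨z, hzm⟩)
        ((hφ.dist_le_iff _ _ _).1 (hS a ha)) h2
      rw [hψφ] at h3
      rw [hψφ, hψφ, hψφ] at h4
      exact ⟨h3, h4⟩
    · intro a ha
      obtain ⟨h1, h2⟩ := hzT _ ⟨⟨a, hT' a ha⟩, ha, rfl⟩
      have h3 := (hψ.1 ⟨z, hzm⟩ ⟨φ ⟨a, hT' a ha⟩, hmem _⟩).1 h1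
      have h4 := hψ.dist_eq_of_node (hYo.subtype _) h.ordered (y := ⟨φ ⟨y, hy⟩, hmem _⟩)
        (w := ⟨φ ⟨w, hw⟩, hmem _⟩) (a := ⟨z, hzm⟩) (b := ⟨φ ⟨a, hT' a ha⟩, hmem _⟩) hz h2
      rw [hψφ] at h3
      rw [hψφ, hψφ, hψφ] at h4
      exact ⟨h3, h4⟩
  · intro hNt y w hyw
    obtain ⟨φ, hφ, htr⟩ := h.exists_transfer hY.toIsGeneric ((finite_singleton w).insert y)
    have hy : y ∈ ({y, w} : Set X) := mem_insert _ _
    have hw : w ∈ ({y, w} : Set X) := mem_insert_of_mem _ rfl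
    have hne : φ ⟨y, hy⟩ ≠ φ ⟨w, hw⟩ := fun he =>
      hyw (congrArg Subtype.val (hφ.injective he))
    obtain ⟨P, h1, h2, h3⟩ := hY.node_fin hNt _ _ hne
    have hPfin : P.Finite := by
      rw [← encard_lt_top_iff, h2]
      exact lt_top_iff_ne_top.2 hNt
    obtain ⟨ψ, hψ, hψφ⟩ := htr P hPfin
    have hmem : ∀ a, φ a ∈ P ∪ range φ := fun a => Or.inr (mem_range_self a)
    set Q : Set (P ∪ range φ : Set Y) := Subtype.val ⁻¹' P with hQ
    have hQP : Subtype.val '' Q = P := by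
      rw [hQ, Subtype.image_preimage_coe, inter_eq_self_of_subset_right subset_union_left]
    have hQ1 : IsPolygon (dist (⟨φ ⟨y, hy⟩, hmem _⟩ : (P ∪ range φ : Set Y))
        ⟨φ ⟨w, hw⟩, hmem _⟩) Q := fun a ha b hb hab =>
      h1 a ha b hb fun he => hab (Subtype.ext he)
    obtain ⟨h4, h5⟩ := isPolygon_image (hYo.subtype _) h.ordered hψ hQ1 (fun p hp => h3 p hp)
    rw [hψφ, hψφ] at h4 h5
    refine ⟨ψ '' Q, h4, ?_, h5⟩
    rw [hψ.injective.encard_image, ← Subtype.val_injective.encard_image, hQP, h2]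

/-- The automorphisms produced by extension preserve balls by definition and act transitively on
points and on nodes. In a Urysohn space the closed balls of nodes are therefore all balls or none of
them is, whatever its metric; likewise for points. -/
theorem nodeHom_of_extend (h : IsGeneric N X)
    (hext : ∀ R : Set (X × X), R.Finite → PIso N R → ∃ g ∈ BP X, ∀ p ∈ R, g p.1 = p.2) :
    NodeHom X := by
  have hord := h.ordered
  intro x u x' u' hiff hball
  have himg : ∀ g ∈ BP X, IsBall {z | dist (g x) z ≤ dist (g x) (g u)} := by
    intro g hg
    have ht := IsOrderedBP.isTreeEmb hord hord hg
    have : g '' {z | dist x z ≤ dist x u} = {z | dist (g x) z ≤ dist (g x) (g u)} := by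
      ext z
      obtain ⟨v, rfl⟩ := g.surjective z
      rw [g.injective.mem_set_image]
      exact ht.dist_le_iff _ _ _
    rw [← this]
    exact (hg.1 _).1 hball
  by_cases hxu : x = u
  · obtain ⟨g, hg, hgR⟩ := hext {(x, x')} (finite_singleton _) (PIso.singleton x x')
    have := himg g hg
    rw [← hxu, show g x = x' from hgR _ rfl] at this
    rwa [← hiff.1 hxu]
  have hxu' : x' ≠ u' := fun he => hxu (hiff.2 he)
  -- The pair `x'`, `u'` may have another color than `x`, `u`, so it is replaced by a pair of the
  -- right color spanning the same node.
  obtain ⟨p, q, hp, hpq, hcol⟩ : ∃ p q, dist p x' ≤ dist x' u' ∧ dist p q = dist x' u' ∧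
      col N x u = col N p q := by
    by_cases hN : N = ⊤
    · by_cases hs : x < u ↔ x' < u'
      · exact ⟨x', u', by simp, rfl, col_top hN hs⟩
      · refine ⟨u', x', (dist_comm _ _).le, dist_comm _ _, col_top hN ?_⟩
        rcases lt_or_gt_of_ne hxu with h1 | h1 <;> rcases lt_or_gt_of_ne hxu' with h2 | h2
        · exact absurd (iff_of_true h1 h2) hs
        · exact iff_of_true h1 h2
        · exact iff_of_false h1.not_gt h2.not_gt
        · exact absurd (iff_of_false h1.not_gt h2.not_gt) hs
    · obtain ⟨p, hp, hpl⟩ := h.exists_label hN hxu' (lab_lt hord hN hxu)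
      obtain ⟨q, hq, hql⟩ := h.exists_label hN hxu' (lab_lt hord hN (Ne.symm hxu))
      have hpq : dist p q = dist x' u' := by
        refine le_antisymm ?_ (not_lt.1 fun hlt => ?_)
        · refine (hord.ultrametric p x' q).trans (max_le hp ?_)
          rwa [dist_comm]
        · have := leftBranches_congr hord hlt
          rw [this, hql] at hpl
          exact lab_ne hord hN hxu hpl.symm
      refine ⟨p, q, hp, hpq, ?_⟩
      have e1 : lab N p q = lab N x u := by
        rw [← hpl]
        unfold lab
        rw [if_neg hN, hpq]
      have e2 : lab N q p = lab N u x := by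
        rw [← hql]
        unfold lab
        rw [if_neg hN, dist_comm, hpq]
      unfold col
      rw [e1, e2, propext (lt_iff_lab_lt hord hN), propext (lt_iff_lab_lt (u := p) hord hN), e1, e2]
  have hqp : q ≠ p := by
    rintro rfl
    rw [dist_self] at hpq
    exact hxu' (dist_eq_zero.1 hpq.symm)
  obtain ⟨g, hg, hgR⟩ := hext _ ((finite_singleton _).insert _)
    (PIso.pair hord hord (Ne.symm hxu) hqp hcol)
  have e1 : g x = p := hgR (x, p) (mem_insert_of_mem _ rfl)
  have e2 : g u = q := hgR (u, q) (mem_insert _ _)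
  have := himg g hg
  rw [e1, e2, hpq] at this
  convert this using 1
  ext z
  constructor
  · intro hz
    exact (hord.ultrametric p x' z).trans (max_le hp hz)
  · intro hz
    refine (hord.ultrametric x' p z).trans (max_le ?_ hz)
    rwa [dist_comm]

theorem IsUrysohn.isHomogeneous (h : IsUrysohn N X) (hN : 2 ≤ N) : IsHomogeneous N X := by
  have hgen := h.isGeneric hN
  have hext : ∀ R : Set (X × X), R.Finite → PIso N R → ∃ g ∈ BP X, ∀ p ∈ R, g p.1 = p.2 := by
    intro R hfin hR
    obtain ⟨A', hA', hsub, hhom⟩ := h.homogeneous (Prod.fst '' R) (hfin.image _)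
    -- Weak homogeneity concerns embeddings of the larger set `A'`, so `R` is first extended to all
    -- of it.
    obtain ⟨R', -, hR', hRR', hdom⟩ := exists_extension_finite h.ordered hgen hfin hR hA'
    choose f hf using fun a : A' => hdom a a.2
    have := hA'.to_subtype
    obtain ⟨g, hg, hgf⟩ := hhom f (hR'.isTreeEmb hf).isOrderedBPInjection
    refine ⟨g, hg, fun p hp => ?_⟩
    have hpA : p.1 ∈ Prod.fst '' R := ⟨p, hp, rfl⟩
    rw [hgf ⟨p.1, hsub hpA⟩ hpA]
    exact (hR'.eq_iff (hf ⟨p.1, hsub hpA⟩) (hRR' hp)).1 rfl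
  exact ⟨hgen, h.countable, hext, fun g hg => mem_BP_of_isTreeEmb (nodeHom_of_extend hgen hext) hg⟩

end Urysohn

end OrdUltra

namespace OrdUltra

open Set Topology

universe u v w

/-! ### Topology of permutation groups -/

section PermTopology

variable {X : Type u}

theorem isOpen_perm_iff {U : Set (Equiv.Perm X)} :
    IsOpen U ↔ ∀ f ∈ U, ∃ F : Finset X, ∀ f' : Equiv.Perm X, (∀ x ∈ F, f' x = f x) → f' ∈ U := by
  let _ : TopologicalSpace X := ⊥
  have : DiscreteTopology X := ⟨rfl⟩
  have hind : Topology.IsInducing (fun (g : Equiv.Perm X) (x : X) => g x) := ⟨rfl⟩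
  constructor
  · intro hU f hf
    obtain ⟨V, hV, rfl⟩ := hind.isOpen_iff.1 hU
    obtain ⟨I, u, hu, hsub⟩ := isOpen_pi_iff.1 hV _ hf
    refine ⟨I, fun f' hf' => hsub fun x hx => ?_⟩
    simp only
    rw [hf' x hx]
    exact (hu x hx).2
  · intro h
    rw [isOpen_iff_forall_mem_open]
    intro f hf
    obtain ⟨F, hF⟩ := h f hf
    refine ⟨{f' | ∀ x ∈ F, f' x = f x}, hF, ?_, fun x _ => rfl⟩
    have : {f' : Equiv.Perm X | ∀ x ∈ F, f' x = f x} =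
        (fun (g : Equiv.Perm X) (x : X) => g x) ⁻¹' ((F : Set X).pi fun x => {f x}) := by
      ext f'
      simp [Set.mem_pi]
    rw [this]
    exact (isOpen_set_pi F.finite_toSet fun _ _ => isOpen_discrete _).preimage hind.continuous

variable {G : Subgroup (Equiv.Perm X)}

theorem isOpen_subgroup_of {U : Set G}
    (h : ∀ f ∈ U, ∃ F : Finset X, ∀ f' : G, (∀ x ∈ F, f'.1 x = f.1 x) → f' ∈ U) : IsOpen U := by
  rw [isOpen_iff_forall_mem_open]
  intro f hf
  obtain ⟨F, hF⟩ := h f hf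
  refine ⟨{f' | ∀ x ∈ F, f'.1 x = f.1 x}, hF, ?_, fun x _ => rfl⟩
  have : IsOpen {f' : Equiv.Perm X | ∀ x ∈ F, f' x = f.1 x} :=
    isOpen_perm_iff.2 fun g hg => ⟨F, fun f' hf' x hx => (hf' x hx).trans (hg x hx)⟩
  exact this.preimage continuous_subtype_val

theorem exists_finset_of_isOpen {U : Set G} (hU : IsOpen U) {f : G} (hf : f ∈ U) :
    ∃ F : Finset X, ∀ f' : G, (∀ x ∈ F, f'.1 x = f.1 x) → f' ∈ U := by
  obtain ⟨V, hV, rfl⟩ := isOpen_induced_iff.1 hU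
  obtain ⟨F, hF⟩ := isOpen_perm_iff.1 hV _ hf
  exact ⟨F, fun f' hf' => hF _ hf'⟩

theorem mem_residual_of_dense {U : Set G}
    (ho : ∀ f ∈ U, ∃ F : Finset X, ∀ f' : G, (∀ x ∈ F, f'.1 x = f.1 x) → f' ∈ U)
    (hd : ∀ (f : G) (F : Finset X), ∃ f' ∈ U, ∀ x ∈ F, f'.1 x = f.1 x) : U ∈ residual G := by
  refine residual_of_dense_open (isOpen_subgroup_of ho) ?_
  rw [dense_iff_inter_open]
  rintro V hV ⟨f, hf⟩
  obtain ⟨F, hF⟩ := exists_finset_of_isOpen hV hf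
  obtain ⟨f', hf', hag⟩ := hd f F
  exact ⟨f', hF f' hag, hf'⟩

theorem isOpen_pi_subgroup_of {ι : Type} [Finite ι] {U : Set (ι → G)}
    (h : ∀ f ∈ U, ∃ F : Finset X, ∀ f' : ι → G, (∀ i, ∀ x ∈ F, (f' i).1 x = (f i).1 x) → f' ∈ U) :
    IsOpen U := by
  rw [isOpen_iff_forall_mem_open]
  intro f hf
  obtain ⟨F, hF⟩ := h f hf
  refine ⟨{f' | ∀ i, ∀ x ∈ F, (f' i).1 x = (f i).1 x}, hF, ?_, fun i x _ => rfl⟩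
  have : {f' : ι → G | ∀ i, ∀ x ∈ F, (f' i).1 x = (f i).1 x} =
      univ.pi fun i => {g : G | ∀ x ∈ F, g.1 x = (f i).1 x} := by
    ext f'
    simp [Set.mem_pi]
  rw [this]
  refine isOpen_set_pi finite_univ fun i _ => isOpen_subgroup_of fun g hg => ⟨F, fun f' hf' x hx => ?_⟩
  exact (hf' x hx).trans (hg x hx)

theorem exists_finset_of_isOpen_pi {ι : Type} [Finite ι] {U : Set (ι → G)} (hU : IsOpen U)
    {f : ι → G} (hf : f ∈ U) :
    ∃ F : Finset X, ∀ f' : ι → G, (∀ i, ∀ x ∈ F, (f' i).1 x = (f i).1 x) → f' ∈ U := by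
  classical
  obtain ⟨I, u, hu, hsub⟩ := isOpen_pi_iff.1 hU f hf
  choose! F hF using fun i (hi : i ∈ I) => exists_finset_of_isOpen (hu i hi).1 (hu i hi).2
  refine ⟨I.biUnion F, fun f' hf' => hsub fun i hi => hF i hi _ fun x hx => hf' i x ?_⟩
  exact Finset.mem_biUnion.2 ⟨i, hi, hx⟩

/-- A permutation is recorded together with its inverse, because a pointwise limit of permutations
need not be surjective. The pairs coming from a closed group then form a closed subset of a Polish
space. -/
theorem polishSpace_of_closed [Countable X]
    (hG : ∀ g : Equiv.Perm X, (∀ F : Finset X, ∃ h ∈ G, ∀ x ∈ F, h x = g x) → g ∈ G) :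
    PolishSpace G := by
  let _ : TopologicalSpace X := ⊥
  have : DiscreteTopology X := ⟨rfl⟩
  set ι : G → (X → X) × (X → X) := fun g => (fun x => g.1 x, fun x => g.1.symm x) with hι
  have hcont : Continuous ι := by
    refine Continuous.prodMk (continuous_pi fun x => ?_) (continuous_pi fun x => ?_)
    · refine ⟨fun s _ => isOpen_subgroup_of fun f hf => ⟨{x}, fun f' hf' => ?_⟩⟩
      have := hf' x (by simp)
      rw [mem_preimage, this]
      exact hf
    · refine ⟨fun s _ => isOpen_subgroup_of fun f hf => ⟨{f.1.symm x}, fun f' hf' => ?_⟩⟩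
      have := hf' (f.1.symm x) (by simp)
      rw [Equiv.apply_symm_apply] at this
      have : f'.1.symm x = f.1.symm x := by
        rw [Equiv.symm_apply_eq, this]
      rw [mem_preimage, this]
      exact hf
  have hemb : IsClosedEmbedding ι := by
    refine ⟨⟨⟨?_⟩, ?_⟩, ?_⟩
    · refine le_antisymm hcont.le_induced ?_
      intro U hU
      rw [isOpen_induced_iff]
      refine ⟨⋃ f ∈ U, ⋃ F ∈ {F : Finset X | ∀ f' : G, (∀ x ∈ F, f'.1 x = f.1 x) → f' ∈ U},
        {p | ∀ x ∈ F, p.1 x = f.1 x}, ?_, ?_⟩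
      · refine isOpen_iUnion fun f => isOpen_iUnion fun _ => isOpen_iUnion fun F =>
          isOpen_iUnion fun _ => ?_
        have : {p : (X → X) × (X → X) | ∀ x ∈ F, p.1 x = f.1 x} =
            Prod.fst ⁻¹' ((F : Set X).pi fun x => {f.1 x}) := by
          ext p
          simp [Set.mem_pi]
        rw [this]
        exact (isOpen_set_pi F.finite_toSet fun _ _ => isOpen_discrete _).preimage continuous_fst
      · ext g
        simp only [mem_preimage, mem_iUnion, mem_ofPred_eq, exists_prop, hι]
        constructor
        · rintro ⟨f, -, F, hF, hg⟩
          exact hF g hg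
        · intro hg
          obtain ⟨F, hF⟩ := exists_finset_of_isOpen hU hg
          exact ⟨g, hg, F, hF, fun _ _ => rfl⟩
    · intro f g hfg
      exact Subtype.ext (Equiv.ext fun x => congrFun (congrArg Prod.fst hfg) x)
    · have hrange : range ι = {p | (∀ x, p.1 (p.2 x) = x) ∧ (∀ x, p.2 (p.1 x) = x) ∧
          ∀ F : Finset X, ∃ h ∈ G, ∀ x ∈ F, h x = p.1 x} := by
        ext p
        constructor
        · rintro ⟨g, rfl⟩
          exact ⟨fun x => g.1.apply_symm_apply x, fun x => g.1.symm_apply_apply x,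
            fun F => ⟨g.1, g.2, fun _ _ => rfl⟩⟩
        · rintro ⟨h1, h2, h3⟩
          exact ⟨⟨⟨p.1, p.2, h2, h1⟩, hG _ h3⟩, rfl⟩
      have hdet : ∀ {V : Set ((X → X) × (X → X))}, (∀ p ∈ V, ∃ E : Finset X,
          ∀ q : (X → X) × (X → X), (∀ x ∈ E, q.1 x = p.1 x ∧ q.2 x = p.2 x) → q ∈ V) →
          IsOpen V := by
        intro V hV
        rw [isOpen_iff_forall_mem_open]
        intro p hp
        obtain ⟨E, hE⟩ := hV p hp
        refine ⟨((E : Set X).pi fun x => {p.1 x}) ×ˢ ((E : Set X).pi fun x => {p.2 x}), ?_,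
          (isOpen_set_pi E.finite_toSet fun _ _ => isOpen_discrete _).prod
            (isOpen_set_pi E.finite_toSet fun _ _ => isOpen_discrete _), by simp [Set.mem_pi]⟩
        rintro q ⟨hq1, hq2⟩
        exact hE q fun x hx => ⟨hq1 x hx, hq2 x hx⟩
      rw [hrange, ← isOpen_compl_iff]
      classical
      refine hdet fun p hp => ?_
      rw [mem_compl_iff, mem_ofPred_eq, not_and_or, not_and_or] at hp
      rcases hp with hp | hp | hp
      · push Not at hp
        obtain ⟨x, hx⟩ := hp
        refine ⟨{x, p.2 x}, fun q hq hmem => hx ?_⟩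
        have := hmem.1 x
        rwa [(hq x (by simp)).2, (hq (p.2 x) (by simp)).1] at this
      · push Not at hp
        obtain ⟨x, hx⟩ := hp
        refine ⟨{x, p.1 x}, fun q hq hmem => hx ?_⟩
        have := hmem.2.1 x
        rwa [(hq x (by simp)).1, (hq (p.1 x) (by simp)).2] at this
      · push Not at hp
        obtain ⟨F, hF⟩ := hp
        refine ⟨F, fun q hq hmem => ?_⟩
        obtain ⟨h, hh, hx⟩ := hmem.2.2 F
        obtain ⟨x, hxF, hne⟩ := hF h hh
        exact hne ((hx x hxF).trans (hq x hxF).1)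
  have : SecondCountableTopology X := inferInstance
  have : TopologicalSpace.IsCompletelyMetrizableSpace X := inferInstance
  have : PolishSpace X := ⟨⟩
  exact hemb.polishSpace

end PermTopology

/-- Membership in `BP X` amounts to being a tree embedding, a condition on at most three points at a
time, hence closed. Completeness is needed for the Baire category arguments. -/
theorem IsHomogeneous.polishSpace {N : ℕ∞} {X : Type u} [MetricSpace X] [LinearOrder X]
    (h : IsHomogeneous N X) : PolishSpace (BP X) := by
  have := h.countable
  classical
  refine polishSpace_of_closed fun g hg => h.mem_BP g ⟨fun x y => ?_, fun x y z => ?_⟩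
  · obtain ⟨f, hf, hfg⟩ := hg {x, y}
    have := (IsOrderedBP.isTreeEmb h.ordered h.ordered hf).1 x y
    rwa [hfg x (by simp), hfg y (by simp)] at this
  · obtain ⟨f, hf, hfg⟩ := hg {x, y, z}
    have := (IsOrderedBP.isTreeEmb h.ordered h.ordered hf).2 x y z
    rwa [hfg x (by simp), hfg y (by simp), hfg z (by simp)] at this

end OrdUltra

namespace OrdUltra

open Set Topology

universe u v w

theorem perm_apply_inv_self {X : Type u} (f : Equiv.Perm X) (x : X) : f (f⁻¹ x) = x :=
  f.apply_symm_apply x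

theorem perm_inv_apply_self {X : Type u} (f : Equiv.Perm X) (x : X) : f⁻¹ (f x) = x :=
  f.symm_apply_apply x

/-! ### Chains -/

/-- A colored weak order on a subset of a type. -/
structure Chain (X : Type u) (K : Type v) where
  carrier : Set X
  lt : X → X → Prop
  col : X → K
  cols : Set K

namespace Chain

variable {X : Type u} {K : Type v}

/-- A weak order in which every color is dense, without endpoints. -/
structure IsDense (C : Chain X K) : Prop where
  asymm : ∀ a ∈ C.carrier, ∀ b ∈ C.carrier, C.lt a b → ¬ C.lt b a
  cotrans : ∀ a ∈ C.carrier, ∀ b ∈ C.carrier, ∀ c ∈ C.carrier, C.lt a b → C.lt a c ∨ C.lt c b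
  col_mem : ∀ a ∈ C.carrier, C.col a ∈ C.cols
  dense : ∀ S T : Finset X, ↑S ⊆ C.carrier → ↑T ⊆ C.carrier → (∀ a ∈ S, ∀ b ∈ T, C.lt a b) →
    ∀ k ∈ C.cols, ∃ z ∈ C.carrier, C.col z = k ∧ (∀ a ∈ S, C.lt a z) ∧ ∀ b ∈ T, C.lt z b

/-- The permutation preserves the chain. -/
structure Preserves (C : Chain X K) (f : Equiv.Perm X) : Prop where
  mem : ∀ u, u ∈ C.carrier ↔ f u ∈ C.carrier
  lt : ∀ u v, C.lt u v ↔ C.lt (f u) (f v)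
  col : ∀ u ∈ C.carrier, C.col (f u) = C.col u

/-- The permutation acts generically on the chain. -/
structure IsNice (C : Chain X K) (f : Equiv.Perm X) : Prop where
  exists_fixed : ∀ S T : Finset X, ↑S ⊆ C.carrier → ↑T ⊆ C.carrier →
    (∀ a ∈ S, ∀ b ∈ T, ∀ n : ℤ, C.lt ((f ^ n) a) b) → ∀ k ∈ C.cols,
    ∃ z ∈ C.carrier, f z = z ∧ C.col z = k ∧ (∀ a ∈ S, C.lt a z) ∧ ∀ b ∈ T, C.lt z b
  exists_up : ∀ a ∈ C.carrier, ∀ b ∈ C.carrier, f a = a → f b = b → C.lt a b → ∀ k ∈ C.cols,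
    ∃ z ∈ C.carrier, C.col z = k ∧ C.lt a z ∧ C.lt z b ∧ C.lt z (f z)
  exists_down : ∀ a ∈ C.carrier, ∀ b ∈ C.carrier, f a = a → f b = b → C.lt a b → ∀ k ∈ C.cols,
    ∃ z ∈ C.carrier, C.col z = k ∧ C.lt a z ∧ C.lt z b ∧ C.lt (f z) z

variable {C : Chain X K} {f : Equiv.Perm X}

theorem IsDense.irrefl (hC : C.IsDense) {a : X} (ha : a ∈ C.carrier) : ¬ C.lt a a :=
  fun h => hC.asymm a ha a ha h h

theorem IsDense.trans (hC : C.IsDense) {a b c : X} (ha : a ∈ C.carrier) (hb : b ∈ C.carrier)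
    (hc : c ∈ C.carrier) (hab : C.lt a b) (hbc : C.lt b c) : C.lt a c :=
  (hC.cotrans a ha b hb c hc hab).resolve_right (hC.asymm b hb c hc hbc)

theorem Preserves.inv (hf : C.Preserves f) : C.Preserves f⁻¹ where
  mem u := by rw [hf.mem (f⁻¹ u), perm_apply_inv_self]
  lt u v := by rw [hf.lt (f⁻¹ u), perm_apply_inv_self, perm_apply_inv_self]
  col u hu := by
    have h : f⁻¹ u ∈ C.carrier := by rwa [hf.mem, perm_apply_inv_self]
    rw [← hf.col _ h, perm_apply_inv_self]

theorem Preserves.one : C.Preserves 1 := ⟨fun _ => Iff.rfl, fun _ _ => Iff.rfl, fun _ _ => rfl⟩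

theorem Preserves.mul {g : Equiv.Perm X} (hf : C.Preserves f) (hg : C.Preserves g) :
    C.Preserves (f * g) where
  mem u := (hg.mem u).trans (hf.mem _)
  lt u v := (hg.lt u v).trans (hf.lt _ _)
  col u hu := (hf.col _ ((hg.mem u).1 hu)).trans (hg.col u hu)

theorem Preserves.pow (hf : C.Preserves f) (n : ℕ) : C.Preserves (f ^ n) := by
  induction n with
  | zero => exact Preserves.one
  | succ n ih =>
    rw [pow_succ]
    exact ih.mul hf

theorem Preserves.zpow (hf : C.Preserves f) (n : ℤ) : C.Preserves (f ^ n) := by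
  cases n with
  | ofNat n => exact hf.pow n
  | negSucc n =>
    rw [zpow_negSucc]
    exact (hf.pow _).inv

theorem zpow_apply_add (f : Equiv.Perm X) (m n : ℤ) (a : X) :
    (f ^ (m + n)) a = (f ^ m) ((f ^ n) a) := by
  rw [_root_.zpow_add]
  rfl

theorem Preserves.zpow_lt_zpow (hf : C.Preserves f) (hC : C.IsDense) {c : X} (hc : c ∈ C.carrier)
    (hup : C.lt c (f c)) {i j : ℤ} (hij : i < j) : C.lt ((f ^ i) c) ((f ^ j) c) := by
  have hstep : ∀ n : ℤ, C.lt ((f ^ n) c) ((f ^ (n + 1)) c) := fun n => by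
    rw [zpow_apply_add, zpow_one]
    exact ((hf.zpow n).lt _ _).1 hup
  have hmem : ∀ n : ℤ, (f ^ n) c ∈ C.carrier := fun n => ((hf.zpow n).mem c).1 hc
  induction j, (show i + 1 ≤ j from hij) using Int.leInduction with
  | base => exact hstep i
  | succ j hj ih =>
    exact hC.trans (hmem _) (hmem _) (hmem _) (ih hj) (hstep j)

theorem exists_consecutive {P : ℤ → Prop} {m n : ℤ} (hm : P m) (hn : ¬ P n) :
    ∃ i j, (j = i + 1 ∨ i = j + 1) ∧ P i ∧ ¬ P j := by
  by_contra hcon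
  push Not at hcon
  have h1 : ∀ k, P k → P (k + 1) := fun k hk => hcon k _ (Or.inl rfl) hk
  have h2 : ∀ k, P k → P (k - 1) := fun k hk => hcon k _ (Or.inr (by ring)) hk
  apply hn
  induction n using Int.inductionOn' (b := m) with
  | zero => exact hm
  | succ k _ ih => exact h1 k (by_contra fun h => absurd (h) (by simpa using ih))
  | pred k _ ih => exact h2 k (by_contra fun h => absurd (h) (by simpa using ih))

/-- The two elements of an orbit which are adjacent to a point between elements of the orbit. -/
theorem Preserves.exists_adjacent (hf : C.Preserves f) (hC : C.IsDense) {c x : X}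
    (hc : c ∈ C.carrier) (hx : x ∈ C.carrier)
    (hcomp : ∀ n : ℤ, C.lt ((f ^ n) c) x ∨ C.lt x ((f ^ n) c))
    (hm : ∃ m : ℤ, C.lt ((f ^ m) c) x) (hn : ∃ n : ℤ, C.lt x ((f ^ n) c)) :
    ∃ i j : ℤ, (j = i + 1 ∨ i = j + 1) ∧ C.lt ((f ^ i) c) x ∧ C.lt x ((f ^ j) c) ∧
      (∀ k : ℤ, C.lt ((f ^ k) c) x → ¬ C.lt ((f ^ i) c) ((f ^ k) c)) ∧
      ∀ k : ℤ, C.lt x ((f ^ k) c) → ¬ C.lt ((f ^ k) c) ((f ^ j) c) := by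
  have hmem : ∀ n : ℤ, (f ^ n) c ∈ C.carrier := fun n => ((hf.zpow n).mem c).1 hc
  obtain ⟨m, hm⟩ := hm
  obtain ⟨n, hn⟩ := hn
  obtain ⟨i, j, hij, hi, hj⟩ := exists_consecutive (P := fun k => C.lt ((f ^ k) c) x) hm
    (hC.asymm x hx _ (hmem n) hn)
  have hj' := (hcomp j).resolve_left hj
  have hlt : C.lt ((f ^ i) c) ((f ^ j) c) := hC.trans (hmem _) hx (hmem _) hi hj'
  -- Whether the element of the orbit just above `x` comes after or before the one just below it in
  -- the enumeration tells whether the orbit moves up or down.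
  have hmono : ∀ k l : ℤ, C.lt ((f ^ k) c) ((f ^ l) c) →
      (j = i + 1 → k < l) ∧ (i = j + 1 → l < k) := by
    intro k l hkl
    refine ⟨fun h => ?_, fun h => ?_⟩
    · have hup : C.lt c (f c) := by
        rw [h, zpow_apply_add, zpow_one] at hlt
        exact ((hf.zpow i).lt _ _).2 hlt
      rcases lt_trichotomy k l with h1 | rfl | h1
      · exact h1
      · exact absurd hkl (hC.irrefl (hmem _))
      · exact absurd hkl (hC.asymm _ (hmem _) _ (hmem _) (hf.zpow_lt_zpow hC hc hup h1))
    · have hup : C.lt c (f⁻¹ c) := by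
        have h2 : j = i + (-1) := by omega
        rw [h2, zpow_apply_add, zpow_neg_one] at hlt
        exact ((hf.zpow i).lt _ _).2 hlt
      rcases lt_trichotomy k l with h1 | rfl | h1
      · have h3 := hf.inv.zpow_lt_zpow hC hc hup (neg_lt_neg h1)
        rw [inv_zpow', inv_zpow', neg_neg, neg_neg] at h3
        exact absurd hkl (hC.asymm _ (hmem _) _ (hmem _) h3)
      · exact absurd hkl (hC.irrefl (hmem _))
      · exact h1
  refine ⟨i, j, hij, hi, hj', fun k hk hik => ?_, fun k hk hkj => ?_⟩
  · have h1 := hmono i k hik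
    have h2 := hmono k j (hC.trans (hmem _) hx (hmem _) hk hj')
    rcases hij with h | h
    · have := h1.1 h
      have := h2.1 h
      omega
    · have := h1.2 h
      have := h2.2 h
      omega
  · have h1 := hmono k j hkj
    have h2 := hmono i k (hC.trans (hmem _) hx (hmem _) hi hk)
    rcases hij with h | h
    · have := h1.1 h
      have := h2.1 h
      omega
    · have := h1.2 h
      have := h2.2 h
      omega

theorem IsDense.exists_between (hC : C.IsDense) {S T : Set X} (hS : S.Finite) (hT : T.Finite)
    (hSC : S ⊆ C.carrier) (hTC : T ⊆ C.carrier) (hST : ∀ a ∈ S, ∀ b ∈ T, C.lt a b) {k : K}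
    (hk : k ∈ C.cols) :
    ∃ z ∈ C.carrier, C.col z = k ∧ (∀ a ∈ S, C.lt a z) ∧ ∀ b ∈ T, C.lt z b := by
  obtain ⟨S, rfl⟩ := hS.exists_finset_coe
  obtain ⟨T, rfl⟩ := hT.exists_finset_coe
  exact hC.dense S T hSC hTC hST k hk

theorem IsNice.exists_fixed_between (hf : C.IsNice f) {S T : Set X} (hS : S.Finite) (hT : T.Finite)
    (hSC : S ⊆ C.carrier) (hTC : T ⊆ C.carrier)
    (hST : ∀ a ∈ S, ∀ b ∈ T, ∀ n : ℤ, C.lt ((f ^ n) a) b) {k : K} (hk : k ∈ C.cols) :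
    ∃ z ∈ C.carrier, f z = z ∧ C.col z = k ∧ (∀ a ∈ S, C.lt a z) ∧ ∀ b ∈ T, C.lt z b := by
  obtain ⟨S, rfl⟩ := hS.exists_finset_coe
  obtain ⟨T, rfl⟩ := hT.exists_finset_coe
  exact hf.exists_fixed S T hSC hTC hST k hk

theorem zpow_fixed {z : X} (hz : f z = z) (n : ℤ) : (f ^ n) z = z :=
  Function.IsFixedPt.perm_zpow hz n

/-- Invariant partial isomorphisms of chains with finitely many orbits extend to a further point. -/
theorem exists_extension {X' : Type u} {C' : Chain X' K} {f' : Equiv.Perm X'} (hC : C.IsDense)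
    (hC' : C'.IsDense) (hcols : C.cols ⊆ C'.cols) (hf : C.Preserves f) (hf' : C'.Preserves f')
    (hnice : C'.IsNice f') {R R₀ : Set (X × X')} (hR₀ : R₀.Finite) (hR₀R : R₀ ⊆ R)
    (hR : ∀ p ∈ R, ∃ r ∈ R₀, ∃ n : ℤ, p = ((f ^ n) r.1, (f' ^ n) r.2))
    (hinv : ∀ p ∈ R, ∀ n : ℤ, ((f ^ n) p.1, (f' ^ n) p.2) ∈ R)
    (hmem : ∀ p ∈ R, p.1 ∈ C.carrier) (hmem' : ∀ p ∈ R, p.2 ∈ C'.carrier)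
    (hiso : ∀ p ∈ R, ∀ q ∈ R, C.lt p.1 q.1 ↔ C'.lt p.2 q.2) {x : X} (hx : x ∈ C.carrier)
    (hfresh : ∀ p ∈ R, C.lt p.1 x ∨ C.lt x p.1)
    (hfx : f x = x ∨ C.lt x (f x) ∨ C.lt (f x) x) :
    ∃ x' ∈ C'.carrier, C'.col x' = C.col x ∧
      (∀ p ∈ R, (C.lt p.1 x → C'.lt p.2 x') ∧ (C.lt x p.1 → C'.lt x' p.2)) ∧
      (f x = x → f' x' = x') ∧ (C.lt x (f x) → C'.lt x' (f' x')) ∧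
      (C.lt (f x) x → C'.lt (f' x') x') := by
  have hk := hcols (hC.col_mem x hx)
  have hexcl : ∀ p ∈ R, C.lt p.1 x → ¬ C.lt x p.1 := fun p hp h =>
    hC.asymm _ (hmem p hp) _ hx h
  have hmfx : f x ∈ C.carrier := (hf.mem x).1 hx
  by_cases htwo : ∃ c ∈ R₀, (∃ m : ℤ, C.lt ((f ^ m) c.1) x) ∧ ∃ n : ℤ, C.lt x ((f ^ n) c.1)
  -- Some orbit has elements on both sides of `x`. It then dictates the direction in which `x`
  -- moves, and only finitely many constraints on `x'` matter.
  · obtain ⟨c, hcR₀, hc1, hc2⟩ := htwo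
    have hadj : ∀ r ∈ R₀, ((∃ m : ℤ, C.lt ((f ^ m) r.1) x) ∧ ∃ n : ℤ, C.lt x ((f ^ n) r.1)) →
        ∃ i j : ℤ, (j = i + 1 ∨ i = j + 1) ∧ C.lt ((f ^ i) r.1) x ∧ C.lt x ((f ^ j) r.1) ∧
          (∀ k : ℤ, C.lt ((f ^ k) r.1) x → ¬ C.lt ((f ^ i) r.1) ((f ^ k) r.1)) ∧
          ∀ k : ℤ, C.lt x ((f ^ k) r.1) → ¬ C.lt ((f ^ k) r.1) ((f ^ j) r.1) :=
      fun r hr h => hf.exists_adjacent hC (hmem r (hR₀R hr)) hx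
        (fun n => hfresh _ (hinv r (hR₀R hr) n)) h.1 h.2
    choose! i j hij hi hj hi' hj' using hadj
    -- Representatives of all orbits, and for each orbit surrounding `x` its two elements adjacent
    -- to `x`.
    set E : Set (X × X') := (R₀ ∪ (fun r => ((f ^ i r) r.1, (f' ^ i r) r.2)) '' R₀) ∪
      (fun r => ((f ^ j r) r.1, (f' ^ j r) r.2)) '' R₀ with hE
    have hEfin : E.Finite := (hR₀.union (hR₀.image _)).union (hR₀.image _)
    have hER : E ⊆ R := by
      rintro p ((hp | ⟨r, hr, rfl⟩) | ⟨r, hr, rfl⟩)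
      · exact hR₀R hp
      · exact hinv r (hR₀R hr) _
      · exact hinv r (hR₀R hr) _
    obtain ⟨x', hx', hcol, hS, hT⟩ := hC'.exists_between
      (S := Prod.snd '' {p | p ∈ E ∧ C.lt p.1 x}) (T := Prod.snd '' {p | p ∈ E ∧ C.lt x p.1})
      ((hEfin.subset (sep_subset _ _)).image _) ((hEfin.subset (sep_subset _ _)).image _)
      (by rintro _ ⟨p, hp, rfl⟩; exact hmem' p (hER hp.1))
      (by rintro _ ⟨p, hp, rfl⟩; exact hmem' p (hER hp.1))
      (by
        rintro _ ⟨p, hp, rfl⟩ _ ⟨q, hq, rfl⟩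
        exact (hiso p (hER hp.1) q (hER hq.1)).1
          (hC.trans (hmem p (hER hp.1)) hx (hmem q (hER hq.1)) hp.2 hq.2)) hk
    have hS' : ∀ p ∈ E, C.lt p.1 x → C'.lt p.2 x' := fun p hp h => hS _ ⟨p, ⟨hp, h⟩, rfl⟩
    have hT' : ∀ p ∈ E, C.lt x p.1 → C'.lt x' p.2 := fun p hp h => hT _ ⟨p, ⟨hp, h⟩, rfl⟩
    have hEi : ∀ r ∈ R₀, ((f ^ i r) r.1, (f' ^ i r) r.2) ∈ E := fun r hr =>
      Or.inl (Or.inr ⟨r, hr, rfl⟩)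
    have hEj : ∀ r ∈ R₀, ((f ^ j r) r.1, (f' ^ j r) r.2) ∈ E := fun r hr => Or.inr ⟨r, hr, rfl⟩
    have hci := hi c hcR₀ ⟨hc1, hc2⟩
    have hcj := hj c hcR₀ ⟨hc1, hc2⟩
    have hci' := hS' _ (hEi c hcR₀) hci
    have hcj' := hT' _ (hEj c hcR₀) hcj
    have hmi := hmem _ (hER (hEi c hcR₀))
    have hmj := hmem _ (hER (hEj c hcR₀))
    have hmi' := hmem' _ (hER (hEi c hcR₀))
    have hmj' := hmem' _ (hER (hEj c hcR₀))
    have hmfx' : f' x' ∈ C'.carrier := (hf'.mem x').1 hx'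
    refine ⟨x', hx', hcol, fun p hp => ?_, ?_⟩
    · obtain ⟨r, hr, n, rfl⟩ := hR p hp
      simp only at hmi hmj hmi' hmj' hci hcj hci' hcj' ⊢
      have hshift : ∀ k : ℤ, (f ^ k) ((f ^ n) r.1) = (f ^ (k + n)) r.1 := fun k =>
        (zpow_apply_add f k n r.1).symm
      by_cases h2 : (∃ m : ℤ, C.lt ((f ^ m) r.1) x) ∧ ∃ n : ℤ, C.lt x ((f ^ n) r.1)
      · constructor
        · intro h
          have h3 := mt (hiso _ (hER (hEi r hr)) _ hp).2 (hi' r hr h2 n h)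
          exact (hC'.cotrans _ (hmem' _ (hER (hEi r hr))) _ hx' _ (hmem' _ hp)
            (hS' _ (hEi r hr) (hi r hr h2))).resolve_left h3
        · intro h
          have h3 := mt (hiso _ hp _ (hER (hEj r hr))).2 (hj' r hr h2 n h)
          exact (hC'.cotrans _ hx' _ (hmem' _ (hER (hEj r hr))) _ (hmem' _ hp)
            (hT' _ (hEj r hr) (hj r hr h2))).resolve_right h3
      · constructor
        · intro h
          have hall : ∀ k : ℤ, C.lt ((f ^ k) r.1) x := fun k =>
            (hfresh _ (hinv r (hR₀R hr) k)).resolve_right fun h4 => h2 ⟨⟨n, h⟩, k, h4⟩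
          have h5 := hC.trans (hmem _ (hinv r (hR₀R hr) (j c - i c + n))) hx hmj
            (hall (j c - i c + n)) hcj
          -- An orbit entirely below `x` is even below the lower neighbor of `x` in the orbit of
          -- `c`: the power of `f` taking this neighbor to the upper one keeps the orbit below `x`.
          have h6 : C.lt ((f ^ n) r.1) ((f ^ i c) c.1) := by
            rw [(hf.zpow (j c - i c)).lt, hshift, ← zpow_apply_add, sub_add_cancel]
            exact h5
          exact hC'.trans (hmem' _ hp) hmi' hx' ((hiso _ hp _ (hER (hEi c hcR₀))).1 h6) hci'
        · intro h
          have hall : ∀ k : ℤ, C.lt x ((f ^ k) r.1) := fun k =>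
            (hfresh _ (hinv r (hR₀R hr) k)).resolve_left fun h4 => h2 ⟨⟨k, h4⟩, n, h⟩
          have h5 := hC.trans hmi hx (hmem _ (hinv r (hR₀R hr) (i c - j c + n)))
            hci (hall (i c - j c + n))
          have h6 : C.lt ((f ^ j c) c.1) ((f ^ n) r.1) := by
            rw [(hf.zpow (i c - j c)).lt, hshift, ← zpow_apply_add, sub_add_cancel]
            exact h5
          exact hC'.trans hx' hmj' (hmem' _ hp) hcj' ((hiso _ (hER (hEj c hcR₀)) _ hp).1 h6)
    · simp only at hmi hmj hmi' hmj' hci hcj hci' hcj'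
      -- A point between consecutive elements of an orbit is sent by `f` across one of them, in the
      -- direction of the orbit, and the same holds for `x'`.
      rcases hij c hcR₀ ⟨hc1, hc2⟩ with h | h
      · have hup : C.lt x (f x) := by
          have h1 := (hf.lt _ _).1 hci
          have h2 : f ((f ^ i c) c.1) = (f ^ j c) c.1 := by
            rw [h, add_comm, zpow_apply_add, zpow_one]
          rw [h2] at h1
          exact hC.trans hx hmj hmfx hcj h1
        have hup' : C'.lt x' (f' x') := by
          have h1 := (hf'.lt _ _).1 hci'
          have h2 : f' ((f' ^ i c) c.2) = (f' ^ j c) c.2 := by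
            rw [h, add_comm, zpow_apply_add, zpow_one]
          rw [h2] at h1
          exact hC'.trans hx' hmj' hmfx' hcj' h1
        refine ⟨fun h1 => ?_, fun _ => hup', fun h1 => absurd hup (hC.asymm _ hmfx _ hx h1)⟩
        rw [h1] at hup
        exact absurd hup (hC.irrefl hx)
      · have hup : C.lt (f x) x := by
          have h1 := (hf.lt _ _).1 hcj
          have h2 : f ((f ^ j c) c.1) = (f ^ i c) c.1 := by
            rw [h, add_comm, zpow_apply_add, zpow_one]
          rw [h2] at h1
          exact hC.trans hmfx hmi hx h1 hci
        have hup' : C'.lt (f' x') x' := by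
          have h1 := (hf'.lt _ _).1 hcj'
          have h2 : f' ((f' ^ j c) c.2) = (f' ^ i c) c.2 := by
            rw [h, add_comm, zpow_apply_add, zpow_one]
          rw [h2] at h1
          exact hC'.trans hmfx' hmi' hx' h1 hci'
        refine ⟨fun h1 => ?_, fun h1 => absurd hup (hC.asymm _ hx _ hmfx h1), fun _ => hup'⟩
        rw [h1] at hup
        exact absurd hup (hC.irrefl hx)
  · push Not at htwo
    -- every orbit lies on one side of `x`
    have hbelow : ∀ r ∈ R₀, ∀ n : ℤ, C.lt ((f ^ n) r.1) x → ∀ k : ℤ, C.lt ((f ^ k) r.1) x :=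
      fun r hr n h k => (hfresh _ (hinv r (hR₀R hr) k)).resolve_right (htwo r hr ⟨n, h⟩ k)
    have habove : ∀ r ∈ R₀, ∀ n : ℤ, C.lt x ((f ^ n) r.1) → ∀ k : ℤ, C.lt x ((f ^ k) r.1) :=
      fun r hr n h k => (hfresh _ (hinv r (hR₀R hr) k)).resolve_left
        fun h1 => htwo r hr ⟨k, h1⟩ n h
    set S : Set X' := Prod.snd '' {p | p ∈ R₀ ∧ C.lt p.1 x} with hS
    set T : Set X' := Prod.snd '' {p | p ∈ R₀ ∧ C.lt x p.1} with hT
    have hSfin : S.Finite := (hR₀.subset (sep_subset _ _)).image _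
    have hTfin : T.Finite := (hR₀.subset (sep_subset _ _)).image _
    have hSC : S ⊆ C'.carrier := by
      rintro _ ⟨p, hp, rfl⟩
      exact hmem' p (hR₀R hp.1)
    have hTC : T ⊆ C'.carrier := by
      rintro _ ⟨p, hp, rfl⟩
      exact hmem' p (hR₀R hp.1)
    have hsep : ∀ a ∈ S, ∀ b ∈ T, ∀ n : ℤ, C'.lt ((f' ^ n) a) b := by
      rintro _ ⟨p, ⟨hp, hpx⟩, rfl⟩ _ ⟨q, ⟨hq, hqx⟩, rfl⟩ n
      exact (hiso _ (hinv p (hR₀R hp) n) q (hR₀R hq)).1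
        (hC.trans (hmem _ (hinv p (hR₀R hp) n)) hx (hmem q (hR₀R hq))
          (hbelow p hp 0 (by simpa using hpx) n) hqx)
    obtain ⟨z, hz, hzf, hzcol, hzS, hzT⟩ := hnice.exists_fixed_between hSfin hTfin hSC hTC hsep hk
    have hRz : ∀ p ∈ R, (C.lt p.1 x → ∀ y, f' y = y → (∀ a ∈ S, C'.lt a y) → C'.lt p.2 y) ∧
        (C.lt x p.1 → ∀ y, f' y = y → (∀ b ∈ T, C'.lt y b) → C'.lt y p.2) := by
      intro p hp
      obtain ⟨r, hr, n, rfl⟩ := hR p hp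
      constructor
      · intro h y hy hyS
        have h1 : C.lt r.1 x := by simpa using hbelow r hr n h 0
        have h2 := ((hf'.zpow n).lt _ _).1 (hyS _ ⟨r, ⟨hr, h1⟩, rfl⟩)
        rwa [zpow_fixed hy] at h2
      · intro h y hy hyT
        have h1 : C.lt x r.1 := by simpa using habove r hr n h 0
        have h2 := ((hf'.zpow n).lt _ _).1 (hyT _ ⟨r, ⟨hr, h1⟩, rfl⟩)
        rwa [zpow_fixed hy] at h2
    by_cases hxfix : f x = x
    · refine ⟨z, hz, hzcol, fun p hp => ⟨fun h => (hRz p hp).1 h z hzf hzS,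
        fun h => (hRz p hp).2 h z hzf hzT⟩, fun _ => hzf, fun h => ?_, fun h => ?_⟩
      · rw [hxfix] at h
        exact absurd h (hC.irrefl hx)
      · rw [hxfix] at h
        exact absurd h (hC.irrefl hx)
    -- Between the two fixed points `z` and `z₂` no element of `R` interferes, and niceness supplies
    -- points moved in either direction.
    obtain ⟨z₂, hz₂, hz₂f, -, hz₂S, hz₂T⟩ := hnice.exists_fixed_between (hSfin.insert z) hTfin
      (insert_subset hz hSC) hTC (by
        rintro a (rfl | ha) b hb n
        · rw [zpow_fixed hzf]
          exact hzT b hb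
        · exact hsep a ha b hb n) hk
    have hzz := hz₂S z (mem_insert _ _)
    have hfin : ∀ y ∈ C'.carrier, C'.lt z y → C'.lt y z₂ → ∀ p ∈ R,
        (C.lt p.1 x → C'.lt p.2 y) ∧ (C.lt x p.1 → C'.lt y p.2) := by
      intro y hy h1 h2 p hp
      exact ⟨fun h => hC'.trans (hmem' p hp) hz hy ((hRz p hp).1 h z hzf hzS) h1,
        fun h => hC'.trans hy hz₂ (hmem' p hp) h2 ((hRz p hp).2 h z₂ hz₂f hz₂T)⟩
    rcases hfx.resolve_left hxfix with h | h
    · obtain ⟨y, hy, hycol, h1, h2, h3⟩ := hnice.exists_up z hz z₂ hz₂ hzf hz₂f hzz _ hk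
      exact ⟨y, hy, hycol, hfin y hy h1 h2, fun h4 => absurd h4 hxfix, fun _ => h3,
        fun h4 => absurd h (hC.asymm _ hmfx _ hx h4)⟩
    · obtain ⟨y, hy, hycol, h1, h2, h3⟩ := hnice.exists_down z hz z₂ hz₂ hzf hz₂f hzz _ hk
      exact ⟨y, hy, hycol, hfin y hy h1 h2, fun h4 => absurd h4 hxfix,
        fun h4 => absurd h (hC.asymm _ hx _ hmfx h4), fun _ => h3⟩

/-! ### Nice actions on chains are generic -/

theorem exists_finset_zpow (f : Equiv.Perm X) (n : ℤ) (a : X) :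
    ∃ F : Finset X, ∀ f' : Equiv.Perm X, (∀ x ∈ F, f' x = f x) → (f' ^ n) a = (f ^ n) a := by
  classical
  have hpos : ∀ (n : ℕ) (a : X), ∃ F : Finset X, ∀ f' : Equiv.Perm X, (∀ x ∈ F, f' x = f x) →
      (f' ^ n) a = (f ^ n) a := by
    intro n a
    induction n with
    | zero => exact ⟨∅, fun f' _ => rfl⟩
    | succ n ih =>
      obtain ⟨F, hF⟩ := ih
      refine ⟨insert ((f ^ n) a) F, fun f' hf' => ?_⟩
      rw [pow_succ', pow_succ', Equiv.Perm.mul_apply, Equiv.Perm.mul_apply,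
        hF f' fun x hx => hf' x (Finset.mem_insert_of_mem hx),
        hf' _ (Finset.mem_insert_self _ _)]
  cases n with
  | ofNat n => exact hpos n a
  | negSucc n =>
    obtain ⟨F, hF⟩ := hpos (n + 1) ((f ^ (n + 1))⁻¹ a)
    refine ⟨F, fun f' hf' => ?_⟩
    rw [zpow_negSucc, zpow_negSucc, Equiv.Perm.inv_eq_iff_eq, hF f' hf',
      perm_apply_inv_self]

section Residual

variable {G : Subgroup (Equiv.Perm X)} {adm : Equiv.Perm X → Prop} {F₀ : Finset X}

/-- Given a finite set and an invariant cut of the chain, the cut can be filled off the set. -/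
theorem exists_gap (hC : C.IsDense) (hf : C.Preserves f) (F : Finset X) (P : X → Prop)
    (hP : ∀ u ∈ C.carrier, P u ↔ P (f u))
    (hlt : ∀ u ∈ C.carrier, ∀ v ∈ C.carrier, P u → ¬ P v → C.lt u v) {k : K} (hk : k ∈ C.cols) :
    ∃ z ∈ C.carrier, ∃ z' ∈ C.carrier, C.col z = k ∧ C.col z' = k ∧ C.lt z z' ∧
      ∀ u ∈ F, u ∈ C.carrier →
        (P u ∧ C.lt u z ∧ C.lt u z' ∧ C.lt (f u) z ∧ C.lt (f u) z') ∨
        (¬ P u ∧ C.lt z u ∧ C.lt z' u ∧ C.lt z (f u) ∧ C.lt z' (f u)) := by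
  classical
  set E : Set X := (↑F ∪ f '' F) ∩ C.carrier with hE
  have hEfin : E.Finite := (F.finite_toSet.union (F.finite_toSet.image _)).subset inter_subset_left
  have hLfin : (E ∩ {u | P u}).Finite := hEfin.subset inter_subset_left
  have hUfin : (E ∩ {u | ¬ P u}).Finite := hEfin.subset inter_subset_left
  obtain ⟨z, hz, hzk, hzL, hzU⟩ := hC.exists_between hLfin hUfin (fun u hu => hu.1.2)
    (fun u hu => hu.1.2) (fun u hu v hv => hlt u hu.1.2 v hv.1.2 hu.2 hv.2) hk
  obtain ⟨z', hz', hzk', hzL', hzU'⟩ := hC.exists_between (hLfin.insert z) hUfin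
    (insert_subset hz fun u hu => hu.1.2) (fun u hu => hu.1.2) (by
      rintro u (rfl | hu) v hv
      · exact hzU v hv
      · exact hlt u hu.1.2 v hv.1.2 hu.2 hv.2) hk
  refine ⟨z, hz, z', hz', hzk, hzk', hzL' z (mem_insert _ _), fun u hu huC => ?_⟩
  have h1 : u ∈ E := ⟨Or.inl hu, huC⟩
  have h2 : f u ∈ E := ⟨Or.inr ⟨u, hu, rfl⟩, (hf.mem u).1 huC⟩
  by_cases hPu : P u
  · have hPf := (hP u huC).1 hPu
    exact Or.inl ⟨hPu, hzL u ⟨h1, hPu⟩, hzL' u (mem_insert_of_mem _ ⟨h1, hPu⟩),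
      hzL _ ⟨h2, hPf⟩, hzL' _ (mem_insert_of_mem _ ⟨h2, hPf⟩)⟩
  · have hPf := mt (hP u huC).2 hPu
    exact Or.inr ⟨hPu, hzU u ⟨h1, hPu⟩, hzU' u ⟨h1, hPu⟩, hzU _ ⟨h2, hPf⟩, hzU' _ ⟨h2, hPf⟩⟩

/-- Every clause of niceness, for fixed parameters, is an open dense condition, and there are
countably many parameters. Density comes from filling an invariant cut of the chain with new points,
whose images `hins` allows to prescribe. -/
theorem eventually_isNice [Countable X] [Countable K] (hC : C.IsDense)
    (hadm : ∀ f ∈ G, ∀ f' ∈ G, (∀ x ∈ F₀, f' x = f x) → adm f → adm f')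
    (hpres : ∀ f ∈ G, adm f → C.Preserves f)
    (hins : ∀ f ∈ G, adm f → ∀ F : Finset X, F₀ ⊆ F → ∀ z ∈ C.carrier, ∀ z' ∈ C.carrier,
      C.col z = C.col z' →
      (∀ u ∈ F, u ∈ C.carrier → (C.lt u z ∧ C.lt (f u) z') ∨ (C.lt z u ∧ C.lt z' (f u))) →
      ∃ f' ∈ G, (∀ x ∈ F, f' x = f x) ∧ f' z = z') :
    ∀ᶠ f : G in residual G, adm f.1 → C.IsNice f.1 := by
  classical
  have hnadm : ∀ f : G, ¬ adm f.1 → ∀ f' : G, (∀ x ∈ F₀, f'.1 x = f.1 x) → ¬ adm f'.1 :=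
    fun f hf f' hff h => hf (hadm f'.1 f'.2 f.1 f.2 (fun x hx => (hff x hx).symm) h)
  have hmove : ∀ (a b : X) (k : K) (Q : X → X → Prop), (∀ (f : G), adm f.1 →
      f.1 a = a → f.1 b = b → a ∈ C.carrier → b ∈ C.carrier → C.lt a b → k ∈ C.cols →
      ∀ F : Finset X, F₀ ⊆ F → a ∈ F → b ∈ F → ∃ f' ∈ G, (∀ x ∈ F, f' x = f.1 x) ∧
        ∃ z ∈ C.carrier, C.col z = k ∧ C.lt a z ∧ C.lt z b ∧ Q z (f' z)) →
      ∀ᶠ f : G in residual G, adm f.1 → f.1 a = a → f.1 b = b → a ∈ C.carrier → b ∈ C.carrier →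
        C.lt a b → k ∈ C.cols →
        ∃ z ∈ C.carrier, C.col z = k ∧ C.lt a z ∧ C.lt z b ∧ Q z (f.1 z) := by
    intro a b k Q hQ
    refine mem_residual_of_dense ?_ ?_
    · intro f hf
      by_cases h1 : adm f.1 ∧ f.1 a = a ∧ f.1 b = b ∧ a ∈ C.carrier ∧ b ∈ C.carrier ∧
        C.lt a b ∧ k ∈ C.cols
      · obtain ⟨h1, h2, h3, h4, h5, h6, h7⟩ := h1
        obtain ⟨z, hz, hzk, hz1, hz2, hz3⟩ := hf h1 h2 h3 h4 h5 h6 h7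
        refine ⟨{z}, fun f' hf' _ _ _ _ _ _ _ => ⟨z, hz, hzk, hz1, hz2, ?_⟩⟩
        rwa [hf' z (by simp)]
      · refine ⟨F₀ ∪ {a, b}, fun f' hf' g1 g2 g3 g4 g5 g6 g7 => absurd ?_ h1⟩
        refine ⟨hadm f'.1 f'.2 f.1 f.2 (fun x hx => (hf' x (by simp [hx])).symm) g1, ?_, ?_,
          g4, g5, g6, g7⟩
        · rw [← hf' a (by simp), g2]
        · rw [← hf' b (by simp), g3]
    · intro f F
      by_cases h1 : adm f.1 ∧ f.1 a = a ∧ f.1 b = b ∧ a ∈ C.carrier ∧ b ∈ C.carrier ∧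
        C.lt a b ∧ k ∈ C.cols
      · obtain ⟨h1, h2, h3, h4, h5, h6, h7⟩ := h1
        obtain ⟨f', hf', hag, hz⟩ := hQ f h1 h2 h3 h4 h5 h6 h7 (F₀ ∪ {a, b} ∪ F)
          (fun x hx => by simp [hx]) (by simp) (by simp)
        exact ⟨⟨f', hf'⟩, fun _ _ _ _ _ _ _ => hz, fun x hx => hag x (by simp [hx])⟩
      · exact ⟨f, fun g1 g2 g3 g4 g5 g6 g7 => absurd ⟨g1, g2, g3, g4, g5, g6, g7⟩ h1,
          fun _ _ => rfl⟩
  -- The cut immediately above the fixed point `a`.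
  have hcut : ∀ a ∈ C.carrier, ∀ f : G, adm f.1 → f.1 a = a → (∀ u ∈ C.carrier,
      (¬ C.lt a u ↔ ¬ C.lt a (f.1 u))) ∧ ∀ u ∈ C.carrier, ∀ v ∈ C.carrier, ¬ C.lt a u →
        ¬ ¬ C.lt a v → C.lt u v := by
    intro a ha f hf hfa
    refine ⟨fun u hu => ?_, fun u hu v hv h1 h2 => ?_⟩
    · rw [(hpres f.1 f.2 hf).lt a u, hfa]
    · exact (hC.cotrans a ha v hv u hu (not_not.1 h2)).resolve_left h1
  have hup : ∀ (a b : X) (k : K), ∀ᶠ f : G in residual G, adm f.1 → f.1 a = a → f.1 b = b →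
      a ∈ C.carrier → b ∈ C.carrier → C.lt a b → k ∈ C.cols →
      ∃ z ∈ C.carrier, C.col z = k ∧ C.lt a z ∧ C.lt z b ∧ C.lt z (f.1 z) := by
    intro a b k
    refine hmove a b k C.lt fun f hf hfa hfb ha hb hab hk F hF haF hbF => ?_
    obtain ⟨h1, h2⟩ := hcut a ha f hf hfa
    obtain ⟨z, hz, z', hz', hzk, hzk', hzz, hF'⟩ := exists_gap hC (hpres f.1 f.2 hf) F
      (fun u => ¬ C.lt a u) h1 h2 hk
    obtain ⟨f', hf', hag, hfz⟩ := hins f.1 f.2 hf F hF z hz z' hz' (hzk.trans hzk'.symm)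
      fun u hu huC => by
        rcases hF' u hu huC with h | h
        · exact Or.inl ⟨h.2.1, h.2.2.2.2⟩
        · exact Or.inr ⟨h.2.1, h.2.2.2.2⟩
    refine ⟨f', hf', hag, z, hz, hzk, ?_, ?_, by rwa [hfz]⟩
    · rcases hF' a haF ha with h | h
      · exact h.2.1
      · exact absurd (hC.irrefl ha) h.1
    · rcases hF' b hbF hb with h | h
      · exact absurd hab h.1
      · exact h.2.1
  have hdown : ∀ (a b : X) (k : K), ∀ᶠ f : G in residual G, adm f.1 → f.1 a = a → f.1 b = b →
      a ∈ C.carrier → b ∈ C.carrier → C.lt a b → k ∈ C.cols →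
      ∃ z ∈ C.carrier, C.col z = k ∧ C.lt a z ∧ C.lt z b ∧ C.lt (f.1 z) z := by
    intro a b k
    refine hmove a b k (fun z w => C.lt w z) fun f hf hfa hfb ha hb hab hk F hF haF hbF => ?_
    obtain ⟨h1, h2⟩ := hcut a ha f hf hfa
    obtain ⟨z, hz, z', hz', hzk, hzk', hzz, hF'⟩ := exists_gap hC (hpres f.1 f.2 hf) F
      (fun u => ¬ C.lt a u) h1 h2 hk
    obtain ⟨f', hf', hag, hfz⟩ := hins f.1 f.2 hf F hF z' hz' z hz (hzk'.trans hzk.symm)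
      fun u hu huC => by
        rcases hF' u hu huC with h | h
        · exact Or.inl ⟨h.2.2.1, h.2.2.2.1⟩
        · exact Or.inr ⟨h.2.2.1, h.2.2.2.1⟩
    refine ⟨f', hf', hag, z', hz', hzk', ?_, ?_, by rwa [hfz]⟩
    · rcases hF' a haF ha with h | h
      · exact h.2.2.1
      · exact absurd (hC.irrefl ha) h.1
    · rcases hF' b hbF hb with h | h
      · exact absurd hab h.1
      · exact h.2.2.1
  have hfix : ∀ (S T : Finset X) (k : K), ∀ᶠ f : G in residual G, adm f.1 → ↑S ⊆ C.carrier →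
      ↑T ⊆ C.carrier → k ∈ C.cols → (∀ a ∈ S, ∀ b ∈ T, ∀ n : ℤ, C.lt ((f.1 ^ n) a) b) →
      ∃ z ∈ C.carrier, f.1 z = z ∧ C.col z = k ∧ (∀ a ∈ S, C.lt a z) ∧ ∀ b ∈ T, C.lt z b := by
    intro S T k
    refine mem_residual_of_dense ?_ ?_
    · intro f hf
      by_cases h1 : adm f.1 ∧ ↑S ⊆ C.carrier ∧ ↑T ⊆ C.carrier ∧ k ∈ C.cols
      swap
      · refine ⟨F₀, fun f' hf' g1 g2 g3 g4 => absurd ⟨?_, g2, g3, g4⟩ h1⟩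
        exact hadm f'.1 f'.2 f.1 f.2 (fun x hx => (hf' x hx).symm) g1
      obtain ⟨h1, h2, h3, h4⟩ := h1
      by_cases hsep : ∀ a ∈ S, ∀ b ∈ T, ∀ n : ℤ, C.lt ((f.1 ^ n) a) b
      · obtain ⟨z, hz, hzf, hzr⟩ := hf h1 h2 h3 h4 hsep
        refine ⟨{z}, fun f' hf' _ _ _ _ _ => ⟨z, hz, ?_, hzr⟩⟩
        rw [hf' z (by simp), hzf]
      -- If the orbits are not separated, this shows at one power and two points, hence for all
      -- permutations with the same values on a finite set.
      · push Not at hsep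
        obtain ⟨a, ha, b, hb, n, hn⟩ := hsep
        obtain ⟨F, hF⟩ := exists_finset_zpow f.1 n a
        refine ⟨F, fun f' hf' _ _ _ _ h => absurd (h a ha b hb n) ?_⟩
        rwa [hF f'.1 hf']
    · intro f F
      by_cases h1 : adm f.1 ∧ ↑S ⊆ C.carrier ∧ ↑T ⊆ C.carrier ∧ k ∈ C.cols ∧
          ∀ a ∈ S, ∀ b ∈ T, ∀ n : ℤ, C.lt ((f.1 ^ n) a) b
      swap
      · exact ⟨f, fun g1 g2 g3 g4 g5 => absurd ⟨g1, g2, g3, g4, g5⟩ h1, fun _ _ => rfl⟩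
      obtain ⟨h1, h2, h3, h4, h5⟩ := h1
      have hp := hpres f.1 f.2 h1
      have hmem : ∀ a ∈ S, ∀ n : ℤ, (f.1 ^ n) a ∈ C.carrier := fun a ha n =>
        ((hp.zpow n).mem a).1 (h2 ha)
      -- The lower part of the cut consists of the points not above the whole orbit of some element
      -- of `S`. It is invariant because all integer powers are taken, and a new point filling the
      -- cut may be fixed.
      obtain ⟨z, hz, z', hz', hzk, hzk', hzz, hF'⟩ := exists_gap hC hp (F₀ ∪ S ∪ T ∪ F)
        (fun u => ∃ a ∈ S, ∃ n : ℤ, ¬ C.lt ((f.1 ^ n) a) u) (by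
          intro u hu
          constructor
          · rintro ⟨a, ha, n, hn⟩
            refine ⟨a, ha, 1 + n, ?_⟩
            rwa [zpow_apply_add, zpow_one, ← hp.lt]
          · rintro ⟨a, ha, n, hn⟩
            refine ⟨a, ha, -1 + n, ?_⟩
            rwa [hp.lt, zpow_apply_add, zpow_neg_one, perm_apply_inv_self]) (by
          rintro u hu v hv ⟨a, ha, n, hn⟩ hv'
          push Not at hv'
          exact (hC.cotrans _ (hmem a ha n) v hv u hu (hv' a ha n)).resolve_left hn) h4
      obtain ⟨f', hf', hag, hfz⟩ := hins f.1 f.2 h1 (F₀ ∪ S ∪ T ∪ F)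
        (fun x hx => by simp [hx]) z hz z hz rfl fun u hu huC => by
          rcases hF' u hu huC with h | h
          · exact Or.inl ⟨h.2.1, h.2.2.2.1⟩
          · exact Or.inr ⟨h.2.1, h.2.2.2.1⟩
      refine ⟨⟨f', hf'⟩, fun _ _ _ _ _ => ⟨z, hz, hfz, hzk, fun a ha => ?_, fun b hb => ?_⟩,
        fun x hx => hag x (by simp [hx])⟩
      · rcases hF' a (by simp [ha]) (h2 ha) with h | h
        · exact h.2.1
        · exact absurd ⟨a, ha, 0, by simpa using hC.irrefl (h2 ha)⟩ h.1
      · rcases hF' b (by simp [hb]) (h3 hb) with h | h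
        · obtain ⟨⟨a, ha, n, hn⟩, -⟩ := h
          exact absurd (h5 a ha b hb n) hn
        · exact h.2.1
  filter_upwards [eventually_countable_forall.2 fun S => eventually_countable_forall.2 fun T =>
      eventually_countable_forall.2 fun k => hfix S T k,
    eventually_countable_forall.2 fun a => eventually_countable_forall.2 fun b =>
      eventually_countable_forall.2 fun k => hup a b k,
    eventually_countable_forall.2 fun a => eventually_countable_forall.2 fun b =>
      eventually_countable_forall.2 fun k => hdown a b k] with f h1 h2 h3 hf
  exact ⟨fun S T hS hT hsep k hk => h1 S T k hf hS hT hk hsep,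
    fun a ha b hb hfa hfb hab k hk => h2 a b k hf hfa hfb ha hb hab hk,
    fun a ha b hb hfa hfb hab k hk => h3 a b k hf hfa hfb ha hb hab hk⟩

end Residual

end Chain

end OrdUltra

namespace OrdUltra

open Set Topology

universe u v w

/-! ### Prescribing values of automorphisms -/

variable {N : ℕ∞} {X : Type u} [MetricSpace X] [LinearOrder X]

theorem IsGeneric.isTreeEmb (h : IsGeneric N X) {f : Equiv.Perm X} (hf : f ∈ BP X) :
    IsTreeEmb f :=
  IsOrderedBP.isTreeEmb h.ordered h.ordered hf

/-- The graph of a permutation over a set. -/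
def graphOver (f : Equiv.Perm X) (F : Set X) : Set (X × X) := (fun u => (u, f u)) '' F

theorem PIso.graphOver (h : IsGeneric N X) {f : Equiv.Perm X} (hf : f ∈ BP X) (F : Set X) :
    PIso N (graphOver f F) := by
  have hf' := h.isTreeEmb hf
  refine ⟨?_, ?_, ?_⟩
  · rintro _ ⟨a, -, rfl⟩ _ ⟨b, -, rfl⟩
    exact hf'.1 a b
  · rintro _ ⟨a, -, rfl⟩ _ ⟨b, -, rfl⟩ _ ⟨c, -, rfl⟩
    exact hf'.2 a b c
  · rintro _ ⟨a, -, rfl⟩ _ ⟨b, -, rfl⟩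
    exact (lab_equiv hf' a b).symm

theorem IsHomogeneous.exists_insert (h : IsHomogeneous N X) {f : Equiv.Perm X} {F : Finset X}
    {z z' : X} (hz : PIso N (insert (z, z') (graphOver f F))) :
    ∃ f' ∈ BP X, (∀ u ∈ F, f' u = f u) ∧ f' z = z' := by
  obtain ⟨f', hf', hag⟩ := h.extend _ ((F.finite_toSet.image _).insert _) hz
  exact ⟨f', hf', fun u hu => hag (u, f u) (mem_insert_of_mem _ ⟨u, hu, rfl⟩),
    hag (z, z') (mem_insert _ _)⟩

theorem IsTreeEmb.dist_lt_of_fixed {f : Equiv.Perm X} (hf : IsTreeEmb f) {y : X} (hy : f y = y)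
    (u v : X) : dist y u < dist y v ↔ dist y (f u) < dist y (f v) := by
  have := hf.2 y u v
  rwa [hy] at this

theorem IsTreeEmb.dist_eq_of_fixed {f : Equiv.Perm X} (hf : IsTreeEmb f) {y : X} (hy : f y = y)
    (u v : X) : dist y u = dist y v ↔ dist y (f u) = dist y (f v) := by
  have := hf.dist_eq_iff y u v
  rwa [hy] at this

theorem IsTreeEmb.col_of_fixed {f : Equiv.Perm X} (hf : IsTreeEmb f) {y : X} (hy : f y = y)
    (u : X) : col N y (f u) = col N y u := by
  have h1 := lab_equiv (N := N) hf y u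
  have h2 := lab_equiv (N := N) hf u y
  have h3 := hf.1 y u
  rw [hy] at h1 h2 h3
  simp only [col, h1, h2, h3]

theorem IsHomogeneous.exists_insert_level (h : IsHomogeneous N X) {f : Equiv.Perm X}
    (hf : f ∈ BP X) {y y' : X} (hy : f y = y') {F : Finset X} (hyF : y ∈ F) {z z' : X} (hz : z ≠ y)
    (hz' : z' ≠ y') (hcol : col N y z = col N y' z')
    (hF : ∀ u ∈ F, u ≠ y → (dist y u < dist y z ∧ dist y' (f u) < dist y' z') ∨
      (dist y z < dist y u ∧ dist y' z' < dist y' (f u))) :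
    ∃ f' ∈ BP X, (∀ u ∈ F, f' u = f u) ∧ f' z = z' := by
  subst hy
  have hX := h.ordered
  have hF' : ∀ u ∈ F, (dist y u < dist y z ∧ dist (f y) (f u) < dist (f y) z') ∨
      (dist y z < dist y u ∧ dist (f y) z' < dist (f y) (f u)) := by
    intro u hu
    by_cases huy : u = y
    · left
      rw [huy, dist_self, dist_self]
      exact ⟨dist_pos.2 hz.symm, dist_pos.2 hz'.symm⟩
    · exact hF u hu huy
  have hfar : ∀ p q r : X, dist p r < dist p q ∨ dist p q < dist p r → dist q p ≤ dist q r := by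
    intro p q r hpr
    by_contra! hlt
    have := hX.level_eq_of_near hlt
    rcases hpr with h1 | h1 <;> rw [this] at h1 <;> exact lt_irrefl _ h1
  refine h.exists_insert (PIso.insert_fresh hX hX (PIso.graphOver h.toIsGeneric hf _)
    ⟨y, hyF, rfl⟩ hz hz' ?_ ?_ ?_ ?_ hcol)
  · rintro _ ⟨u, hu, rfl⟩
    exact hfar _ _ _ ((hF' u hu).imp And.left And.left)
  · rintro _ ⟨u, hu, rfl⟩
    exact hfar _ _ _ ((hF' u hu).imp And.right And.right)
  · rintro _ ⟨u, hu, rfl⟩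
    rcases hF' u hu with ⟨h1, h2⟩ | ⟨h1, h2⟩
    · exact ⟨iff_of_false h1.not_gt h2.not_gt, iff_of_true h1 h2⟩
    · exact ⟨iff_of_true h1 h2, iff_of_false h1.not_gt h2.not_gt⟩
  · rintro _ ⟨u, hu, rfl⟩ heq
    simp only at heq
    rcases hF' u hu with ⟨h1, -⟩ | ⟨h1, -⟩ <;> rw [heq] at h1 <;> exact absurd h1 (lt_irrefl _)

/-- A new branch at a node is prescribed. -/
theorem IsHomogeneous.exists_insert_node (h : IsHomogeneous N X) (hN : N = ⊤) {f : Equiv.Perm X}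
    (hf : f ∈ BP X) {y w : X} (hyw : y ≠ w) {F : Finset X} (hyF : y ∈ F) {z z' : X}
    (hz : dist y z ≤ dist y w) (hz' : dist (f y) z' ≤ dist (f y) (f w))
    (hF : ∀ u ∈ F, dist y u ≤ dist y w → dist u z = dist y w ∧ dist (f u) z' = dist (f y) (f w) ∧
      (u < z ∧ f u < z' ∨ z < u ∧ z' < f u)) :
    ∃ f' ∈ BP X, (∀ u ∈ F, f' u = f u) ∧ f' z = z' := by
  have hX := h.ordered
  have hft := h.isTreeEmb hf
  obtain ⟨hyz, hyz', hord⟩ := hF y hyF (by rw [dist_self]; exact dist_nonneg)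
  have hfw : 0 < dist (f y) (f w) := dist_pos.2 fun h1 => hyw (f.injective h1)
  have hle : ∀ u, dist y u ≤ dist y w ↔ dist (f y) (f u) ≤ dist (f y) (f w) := fun u =>
    hft.dist_le_iff y u w
  refine h.exists_insert (PIso.insert_fresh hX hX (PIso.graphOver h.toIsGeneric hf _)
    ⟨y, hyF, rfl⟩ (y := y) (y' := f y) ?_ ?_ ?_ ?_ ?_ ?_ ?_)
  · rintro rfl
    rw [dist_self] at hyz
    exact hyw (dist_eq_zero.1 hyz.symm)
  · rintro rfl
    rw [dist_self] at hyz'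
    exact hfw.ne hyz'
  · rintro _ ⟨u, hu, rfl⟩
    simp only
    rw [dist_comm z y, hyz]
    by_cases h1 : dist y u ≤ dist y w
    · rw [dist_comm z u, (hF u hu h1).1]
    · push Not at h1
      have h2 := hX.ultrametric y z u
      rw [hyz] at h2
      rcases le_max_iff.1 h2 with h3 | h3
      · exact absurd h3 h1.not_ge
      · exact h1.le.trans h3
  · rintro _ ⟨u, hu, rfl⟩
    simp only
    rw [dist_comm z' (f y), hyz']
    by_cases h1 : dist y u ≤ dist y w
    · rw [dist_comm z' (f u), (hF u hu h1).2.1]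
    · rw [hle] at h1
      push Not at h1
      have h2 := hX.ultrametric (f y) z' (f u)
      rw [hyz'] at h2
      rcases le_max_iff.1 h2 with h3 | h3
      · exact absurd h3 h1.not_ge
      · exact h1.le.trans h3
  · rintro _ ⟨u, hu, rfl⟩
    simp only
    rw [hyz, hyz']
    exact ⟨hft.2 y w u, hft.2 y u w⟩
  · rintro _ ⟨u, hu, rfl⟩ heq
    rcases (hF u hu (by rw [← hyz]; exact heq.ge)).2.2 with ⟨h1, h2⟩ | ⟨h1, h2⟩
    · exact iff_of_false h1.not_gt h2.not_gt
    · exact iff_of_true h1 h2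
  · apply col_top hN
    rcases hord with ⟨h1, h2⟩ | ⟨h1, h2⟩
    · exact iff_of_true h1 h2
    · exact iff_of_false h1.not_gt h2.not_gt

/-! ### The chains of levels and of branches -/

/-- The chain of the levels around a point. -/
noncomputable def levelChain (N : ℕ∞) (y : X) : Chain X (ℕ × ℕ × Prop) where
  carrier := {u | u ≠ y}
  lt u v := dist y u < dist y v
  col := col N y
  cols := colors N

/-- The chain of the branches at a node. -/
def nodeChain (y w : X) : Chain X Unit where
  carrier := {u | dist y u ≤ dist y w}
  lt u v := dist y u ≤ dist y w ∧ u < v ∧ dist u v = dist y w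
  col _ := ()
  cols := univ

theorem IsGeneric.levelChain_isDense (h : IsGeneric N X) (y : X) : (levelChain N y).IsDense where
  asymm _ _ _ _ hab := hab.not_gt
  cotrans a _ b _ c _ hab := by
    by_cases hac : dist y a < dist y c
    · exact Or.inl hac
    · exact Or.inr ((not_lt.1 hac).trans_lt hab)
  col_mem a ha := col_mem_colors h.ordered (Ne.symm ha)
  dense S T _ hT hST k hk := h.level y S T hST (fun b hb => hT hb) k hk

theorem IsGeneric.nodeChain_isDense (h : IsGeneric N X) (hN : N = ⊤) {y w : X} (hyw : y ≠ w) :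
    (nodeChain y w).IsDense where
  asymm _ _ _ _ hab hba := hab.2.1.not_gt hba.2.1
  cotrans a ha b hb c hc hab := by
    obtain ⟨-, hab, hd⟩ := hab
    have hle : ∀ p q : X, dist y p ≤ dist y w → dist y q ≤ dist y w → dist p q ≤ dist y w := by
      intro p q hp hq
      refine (h.ordered.ultrametric p y q).trans (max_le ?_ hq)
      rwa [dist_comm]
    rcases (hle a c ha hc).lt_or_eq with hac | hac
    · right
      have h1 : dist a c < dist a b := hac.trans_eq hd.symm
      exact ⟨hc, (h.ordered.lt_iff_of_near h1).1 hab, (h.ordered.dist_eq_of_near h1).trans hd⟩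
    · by_cases hlt : a < c
      · exact Or.inl ⟨ha, hlt, hac⟩
      · push Not at hlt
        refine Or.inr ⟨hc, hlt.trans_lt hab, (hle c b hc hb).antisymm ?_⟩
        rw [← hd]
        exact h.ordered.dist_right_le hlt hab.le
  col_mem _ _ := mem_univ _
  dense S T hS hT hST k _ := by
    obtain ⟨z, hz, hzS, hzT⟩ := h.node_top hN y w hyw S T (fun a ha => hS ha) (fun b hb => hT hb)
      (fun a ha b hb => (hST a ha b hb).2)
    exact ⟨z, hz, rfl, fun a ha => ⟨hS ha, hzS a ha⟩, fun b hb => ⟨hz, hzT b hb⟩⟩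

theorem levelChain_preserves {f : Equiv.Perm X} (hf : IsTreeEmb f) {y : X} (hy : f y = y) :
    (levelChain N y).Preserves f where
  mem u := by
    refine not_congr ⟨fun h => by rw [h, hy], fun h => f.injective (h.trans hy.symm)⟩
  lt u v := hf.dist_lt_of_fixed hy u v
  col u _ := hf.col_of_fixed hy u

theorem nodeChain_preserves (h : IsOrderedUltrametric N X) {f : Equiv.Perm X} (hf : IsTreeEmb f)
    {y w : X} (hy : f y = y) (hw : dist y (f w) = dist y w) : (nodeChain y w).Preserves f where
  mem u := by
    change dist y u ≤ dist y w ↔ dist y (f u) ≤ dist y w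
    rw [hf.dist_le_iff y u w, hy, hw]
  lt u v := by
    change dist y u ≤ dist y w ∧ u < v ∧ dist u v = dist y w ↔
      dist y (f u) ≤ dist y w ∧ f u < f v ∧ dist (f u) (f v) = dist y w
    have h1 : dist y u ≤ dist y w ↔ dist y (f u) ≤ dist y w := by
      rw [hf.dist_le_iff y u w, hy, hw]
    rw [h1, hf.1 u v]
    refine and_congr_right fun h2 => and_congr_right fun _ => ⟨fun h3 => ?_, fun h3 => ?_⟩
    · rw [hf.dist_eq_of_node h h (h1.2 h2) h3, hy, hw]
    · have h4 := (IsTreeEmb.symm hf).dist_eq_of_node h h (y := y) (w := f w)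
        (h2.trans_eq hw.symm) (h3.trans hw.symm)
      rwa [f.symm_apply_apply, f.symm_apply_apply, f.symm_apply_apply,
        f.symm_apply_eq.2 hy.symm] at h4
  col _ _ := rfl

theorem IsHomogeneous.eventually_level (h : IsHomogeneous N X) :
    ∀ᶠ f : BP X in residual (BP X), ∀ y, f.1 y = y → (levelChain N y).IsNice f.1 := by
  have := h.countable
  refine eventually_countable_forall.2 fun y => ?_
  refine Chain.eventually_isNice (adm := fun f => f y = y) (F₀ := {y}) (h.levelChain_isDense y)
    (fun f _ f' _ hff hf => by rw [hff y (by simp), hf])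
    (fun f hf hy => levelChain_preserves (h.isTreeEmb hf) hy) ?_
  intro f hf hy F hF z hz z' hz' hcol hu
  exact h.exists_insert_level hf hy (hF (by simp)) hz hz' hcol hu

theorem IsHomogeneous.eventually_node (h : IsHomogeneous N X) (hN : N = ⊤) :
    ∀ᶠ f : BP X in residual (BP X), ∀ y w, y ≠ w → f.1 y = y → dist y (f.1 w) = dist y w →
      (nodeChain y w).IsNice f.1 := by
  classical
  have := h.countable
  refine eventually_countable_forall.2 fun y => eventually_countable_forall.2 fun w => ?_
  by_cases hyw : y = w
  · exact Filter.Eventually.of_forall fun f h1 => absurd hyw h1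
  have key := Chain.eventually_isNice (G := BP X) (C := nodeChain y w)
    (adm := fun f => f y = y ∧ dist y (f w) = dist y w) (F₀ := {y, w})
    (h.nodeChain_isDense hN hyw)
    (fun f _ f' _ hff hf => by rwa [hff y (by simp), hff w (by simp)])
    (fun f hf hy => nodeChain_preserves h.ordered (h.isTreeEmb hf) hy.1 hy.2) (by
      rintro f hf ⟨hy, hw⟩ F hF z hz z' hz' - hu
      refine h.exists_insert_node hN hf hyw (hF (by simp)) hz (by rwa [hy, hw]) ?_
      intro u huF huC
      rw [hy, hw]
      rcases hu u huF huC with ⟨h1, h2⟩ | ⟨h1, h2⟩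
      · exact ⟨h1.2.2, h2.2.2, Or.inl ⟨h1.2.1, h2.2.1⟩⟩
      · exact ⟨by rw [dist_comm, h1.2.2], by rw [dist_comm, h2.2.2], Or.inr ⟨h1.2.1, h2.2.1⟩⟩)
  exact key.mono fun f hf _ hy hw => hf ⟨hy, hw⟩

/-! ### Capturing moved points by fixed points -/

/-- The image of a point off a partial isomorphism is replaced by a nearby point. -/
theorem pIso_replace (h : IsOrderedUltrametric N X) {R : Set (X × X)} (hfin : R.Finite)
    (hne : R.Nonempty) {x x' x'' : X} (hR : PIso N (insert (x, x') R))
    (hx : ∀ q ∈ R, dist x' x'' < dist x' q.2) : PIso N (insert (x, x'') R) := by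
  obtain ⟨p, hp, hpmin⟩ := hfin.exists_minimalFor (fun q => dist x q.1) R hne
  have hmin : ∀ q ∈ R, dist x p.1 ≤ dist x q.1 := fun q hq => by
    rcases le_total (dist x p.1) (dist x q.1) with h1 | h1
    · exact h1
    · exact hpmin hq h1
  have hx0 : (x, x') ∈ insert (x, x') R := mem_insert _ _
  have hm : ∀ q ∈ R, q ∈ insert (x, x') R := fun q hq => mem_insert_of_mem _ hq
  have hd : ∀ q ∈ R, dist x'' q.2 = dist x' q.2 := fun q hq => h.dist_eq_of_near (hx q hq)
  have hpx' : x' ≠ p.2 := fun h1 => by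
    have := hx p hp
    rw [← h1, dist_self] at this
    exact this.not_ge dist_nonneg
  refine PIso.insert_fresh h h (hR.mono (subset_insert _ _)) (y := p.1) (y' := p.2) hp
    ?_ ?_ hmin ?_ ?_ ?_ ?_
  · exact fun h1 => hpx' ((hR.eq_iff hx0 (hm p hp)).1 h1)
  · rintro rfl
    have := hd p hp
    rw [dist_self, eq_comm, dist_eq_zero] at this
    exact hpx' this
  · intro q hq
    rw [hd p hp, hd q hq]
    exact not_lt.1 (mt (hR.dist _ hx0 _ (hm q hq) _ (hm p hp)).2 (hmin q hq).not_gt)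
  · intro q hq
    have h1 : dist p.2 x'' = dist p.2 x' := by rw [dist_comm, hd p hp, dist_comm]
    rw [h1]
    exact ⟨hR.dist _ (hm p hp) _ hx0 _ (hm q hq), hR.dist _ (hm p hp) _ (hm q hq) _ hx0⟩
  · intro q hq _
    rw [hR.lt _ hx0 _ (hm q hq)]
    exact h.lt_iff_of_near (hx q hq)
  · rw [hR.col_eq (hm p hp) hx0]
    refine (col_congr h ?_).symm
    rw [dist_comm p.2 x']
    exact hx p hp

theorem col_congr_left (h : IsOrderedUltrametric N X) {y y' x : X} (hy : dist y y' < dist y x) :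
    col N y' x = col N y x := by
  have h1 := lab_congr_left (N := N) h hy
  have h2 : lab N x y' = lab N x y :=
    lab_congr_right (by rw [dist_comm x, dist_comm x, h.dist_eq_of_near hy])
  have h3 := h.lt_iff_of_near hy
  simp only [col, h1, h2, h3]

/-- Along the backward orbit `b` of `a` the displacements `r` strictly decrease, and the balls `K n`
around its points shrink, with `f` mapping `K (n + 1)` onto `K n`. A fixed point can be created deep
inside these balls without touching `F`. -/
theorem IsHomogeneous.exists_fixed_of_expanding (h : IsHomogeneous N X) {f : Equiv.Perm X}
    (hf : f ∈ BP X) {a : X} (ha : dist a (f a) < dist (f a) (f (f a))) {F : Finset X}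
    (haF : a ∈ F) :
    ∃ f' ∈ BP X, (∀ u ∈ F, f' u = f u) ∧ ∃ y, f' y = y ∧ dist a y ≤ dist a (f a) := by
  classical
  have hX := h.ordered
  have hft := h.isTreeEmb hf
  set b : ℕ → X := fun n => (f⁻¹ ^ n) a with hb
  have hfb : ∀ n, f (b (n + 1)) = b n := fun n => by
    simp only [hb, pow_succ', Equiv.Perm.mul_apply, perm_apply_inv_self]
  have hb0 : b 0 = a := rfl
  set r : ℕ → ℝ := fun n => dist (b n) (f (b n)) with hr
  have hr0 : r 0 = dist a (f a) := rfl
  have hr1 : ∀ n, r (n + 1) = dist (b (n + 1)) (b n) := fun n => by simp only [hr, hfb]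
  have hpos : ∀ n, 0 < r n := by
    intro n
    refine dist_pos.2 fun h1 => ?_
    have h2 : ∀ m, b (n - m) = b n := by
      intro m
      induction m with
      | zero => rfl
      | succ m ih =>
        rcases Nat.eq_zero_or_pos (n - m) with h3 | h3
        · rw [← ih]
          congr 1
          omega
        · rw [← hfb (n - (m + 1)), show n - (m + 1) + 1 = n - m by omega, ih, ← h1]
    have h3 := h2 n
    rw [Nat.sub_self, hb0] at h3
    rw [← h3] at h1
    rw [← h1, ← h1, dist_self] at ha
    exact lt_irrefl _ ha
  have hdec : ∀ n, r (n + 1) < r n := by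
    intro n
    rw [hr1, dist_comm]
    induction n with
    | zero =>
      change dist (b 0) (b 1) < dist (b 0) (f (b 0))
      rw [hft.2, hfb, dist_comm]
      exact ha
    | succ n ih =>
      change dist (b (n + 1)) (b (n + 2)) < dist (b (n + 1)) (f (b (n + 1)))
      rw [hft.2, hfb, hfb]
      exact ih
  set K : ℕ → Set X := fun n => {u | dist (b n) u < r n} with hK
  have hsub : ∀ n, K (n + 1) ⊆ K n := by
    intro n u hu
    refine (hX.ultrametric _ (b (n + 1)) _).trans_lt (max_lt ?_ ((show _ < _ from hu).trans (hdec n)))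
    rw [dist_comm, ← hr1]
    exact hdec n
  have hanti : Antitone K := antitone_nat_of_succ_le hsub
  have hmap : ∀ n u, u ∈ K (n + 1) ↔ f u ∈ K n := by
    intro n u
    change dist (b (n + 1)) u < dist (b (n + 1)) (f (b (n + 1))) ↔ _
    rw [hft.2, hfb]
    rfl
  have hbK : ∀ n, b n ∈ K n := fun n => by
    change dist (b n) (b n) < r n
    rw [dist_self]
    exact hpos n
  have hsep : ∀ n, ∀ k ∈ K n, ∀ u, u ∈ K n ↔ dist k u < r n := by
    intro n k hk u
    have hk' : dist k (b n) < r n := by rwa [dist_comm]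
    exact ⟨fun hu => (hX.ultrametric k (b n) u).trans_lt (max_lt hk' hu),
      fun hu => (hX.ultrametric (b n) k u).trans_lt (max_lt hk hu)⟩
  -- If a point `k` of `F` lies in all the balls, the intersection of the balls is invariant. The
  -- fixed point is placed on a level around `k` above the relevant points of the intersection and
  -- below those outside.
  by_cases hcase : ∃ k ∈ F, ∀ n, k ∈ K n
  · obtain ⟨k, hkF, hk⟩ := hcase
    have hinv : ∀ u, (∀ n, u ∈ K n) ↔ ∀ n, f u ∈ K n := fun u =>
      ⟨fun h1 n => (hmap n u).1 (h1 _), fun h1 n => hsub n ((hmap n u).2 (h1 n))⟩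
    have hfk := (hinv k).1 hk
    have haK : ¬ ∀ n, a ∈ K n := fun h1 => by
      have h2 : dist (b 1) (b 0) < r 1 := h1 1
      rw [hr1] at h2
      exact lt_irrefl _ h2
    set E : Set X := ↑F ∪ f '' F with hE
    have hEfin : E.Finite := F.finite_toSet.union (F.finite_toSet.image _)
    have hka : k ≠ a := by
      rintro rfl
      exact haK hk
    obtain ⟨z, hzk, -, hzS, hzT⟩ := h.exists_level (y := k) (E ∩ {u | ∀ n, u ∈ K n})
      (E ∩ {u | ¬ ∀ n, u ∈ K n}) (hEfin.subset inter_subset_left) (hEfin.subset inter_subset_left)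
      (by
        rintro s ⟨-, hs⟩ t ⟨-, ht⟩
        simp only [mem_ofPred_eq, not_forall] at hs ht
        obtain ⟨n, hn⟩ := ht
        have h1 := (hsep n k (hk n) s).1 (hs n)
        have h2 := mt (hsep n k (hk n) t).2 hn
        exact h1.trans_le (not_lt.1 h2))
      (fun h1 => h1.2 hk) (col_mem_colors hX hka)
    have hkz : dist k (f k) < dist k z := hzS _ ⟨Or.inr ⟨k, hkF, rfl⟩, hfk⟩
    have hdz := hX.dist_eq_of_near hkz
    obtain ⟨f', hf', hag, hfz⟩ := h.exists_insert_level hf (y := k) rfl hkF hzk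
      (z' := z) (fun h1 => by rw [← h1] at hkz; exact lt_irrefl _ hkz)
      (col_congr_left hX hkz).symm (by
        intro u hu _
        rw [hdz]
        by_cases huK : ∀ n, u ∈ K n
        · refine Or.inl ⟨hzS u ⟨Or.inl hu, huK⟩, ?_⟩
          refine (hX.ultrametric _ k _).trans_lt (max_lt (by rwa [dist_comm]) ?_)
          exact hzS _ ⟨Or.inr ⟨u, hu, rfl⟩, (hinv u).1 huK⟩
        · have h1 := hzT _ ⟨Or.inr ⟨u, hu, rfl⟩, mt (hinv u).2 huK⟩
          refine Or.inr ⟨hzT u ⟨Or.inl hu, huK⟩, ?_⟩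
          rwa [hX.dist_eq_of_near (hkz.trans h1)])
    refine ⟨f', hf', hag, z, hfz, ?_⟩
    have h1 : dist a k < dist a (f a) := hk 0
    have h2 := hzT a ⟨Or.inl haF, haK⟩
    refine (hX.ultrametric a k z).trans (max_le h1.le (h2.le.trans ?_))
    rw [dist_comm]
    exact h1.le
  -- Otherwise some `K n` misses `F`, so the image `b n` of `b (n + 1)` may be replaced by the
  -- nearby point `b (n + 1)` itself.
  · push Not at hcase
    choose! m hm using hcase
    have hn : ∀ u ∈ F, u ∉ K (F.sup m) := fun u hu h1 =>
      hm u hu (hanti (Finset.le_sup hu) h1)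
    set n := F.sup m with hn'
    have hP : PIso N (insert (b (n + 1), b n) (graphOver f F)) := by
      have h1 := PIso.graphOver h.toIsGeneric hf (insert (b (n + 1)) (F : Set X))
      refine h1.mono ?_
      rintro p (rfl | ⟨u, hu, rfl⟩)
      · exact ⟨_, mem_insert _ _, Prod.ext rfl (hfb n)⟩
      · exact ⟨u, mem_insert_of_mem _ hu, rfl⟩
    obtain ⟨f', hf', hag, hfz⟩ := h.exists_insert (pIso_replace hX (F.finite_toSet.image _)
      ⟨_, a, haF, rfl⟩ hP (x'' := b (n + 1)) (by
        rintro _ ⟨u, hu, rfl⟩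
        have h1 : f u ∉ K n := fun h1 => hn u hu (hsub n ((hmap n u).2 h1))
        rw [dist_comm, ← hr1]
        exact (hdec n).trans_le (not_lt.1 h1)))
    refine ⟨f', hf', hag, _, hfz, ?_⟩
    exact (show dist (b 0) _ < _ from hanti (Nat.zero_le _) (hbK (n + 1))).le

/-- Here `f` preserves the node of `a` and `f a`. A new branch to the left of all relevant points of
this node can be fixed. -/
theorem IsHomogeneous.exists_fixed_of_elliptic (h : IsHomogeneous N X) (hN : N = ⊤)
    {f : Equiv.Perm X} (hf : f ∈ BP X) {a : X} (ha : dist a (f a) = dist (f a) (f (f a)))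
    (hne : f a ≠ a) {F : Finset X} (haF : a ∈ F) :
    ∃ f' ∈ BP X, (∀ u ∈ F, f' u = f u) ∧ ∃ y, f' y = y ∧ dist a y ≤ dist a (f a) := by
  have hX := h.ordered
  have hft := h.isTreeEmb hf
  set E : Set X := ↑F ∪ f '' F with hE
  have hEfin : E.Finite := F.finite_toSet.union (F.finite_toSet.image _)
  obtain ⟨z, hz, -, hzT⟩ := h.exists_branch hN (Ne.symm hne) ∅ (E ∩ {u | dist a u ≤ dist a (f a)})
    finite_empty (hEfin.subset inter_subset_left) (by simp) (fun u hu => hu.2) (by simp)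
  obtain ⟨f', hf', hag, hfz⟩ := h.exists_insert_node hN hf (Ne.symm hne) haF hz (z' := z) (by
      rw [← ha]
      refine (hX.ultrametric _ a _).trans (max_le ?_ hz)
      rw [dist_comm]) (by
      intro u hu hau
      have h1 : dist a (f u) ≤ dist a (f a) := by
        refine (hX.ultrametric _ (f a) _).trans (max_le le_rfl ?_)
        rw [ha, ← hft.dist_le_iff]
        exact hau
      have h2 := hzT u ⟨Or.inl hu, hau⟩
      have h3 := hzT (f u) ⟨Or.inr ⟨u, hu, rfl⟩, h1⟩
      rw [dist_comm u, dist_comm (f u), ← ha]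
      exact ⟨h2.2, h3.2, Or.inr ⟨h2.1, h3.1⟩⟩)
  exact ⟨f', hf', hag, z, hfz, hz⟩

theorem IsHomogeneous.exists_fixed (h : IsHomogeneous N X) {f : Equiv.Perm X}
    (hf : f ∈ BP X) {a : X} (hne : f a ≠ a) {F : Finset X} (haF : a ∈ F) :
    ∃ f' ∈ BP X, (∀ u ∈ F, f' u = f u) ∧ ∃ y, f' y = y ∧ dist a y ≤ dist a (f a) := by
  classical
  have hX := h.ordered
  have hft := h.isTreeEmb hf
  rcases lt_trichotomy (dist a (f a)) (dist (f a) (f (f a))) with ha | ha | ha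
  · exact h.exists_fixed_of_expanding hf ha haF
  · by_cases hN : N = ⊤
    · exact h.exists_fixed_of_elliptic hN hf ha hne haF
    -- For finite `N` this case cannot occur: `a` and `f a` would be in different branches of an
    -- invariant node and have the same label.
    · have h1 := lab_equiv (N := N) hft a (f a)
      have h2 : lab N (f a) (f (f a)) = lab N (f a) a :=
        lab_congr_right (by rw [← ha, dist_comm])
      exact absurd (h2.symm.trans h1) (lab_ne hX hN hne)
  -- When displacements decrease along `f`, they increase along `f⁻¹` starting from `f a`.
  · have hlt : dist (f a) (f⁻¹ (f a)) < dist (f⁻¹ (f a)) (f⁻¹ (f⁻¹ (f a))) := by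
      rw [perm_inv_apply_self, dist_comm, hft.2, perm_apply_inv_self, dist_comm (f a) a]
      exact ha
    obtain ⟨g, hg, hag, y, hy, hay⟩ := h.exists_fixed_of_expanding ((BP X).inv_mem hf) hlt
      (F := insert (f a) (F.image f)) (by simp)
    rw [perm_inv_apply_self] at hay
    refine ⟨g⁻¹, (BP X).inv_mem hg, fun u hu => ?_, y, ?_, ?_⟩
    · rw [Equiv.Perm.inv_eq_iff_eq, hag _ (by simp [hu]), perm_inv_apply_self]
    · rw [Equiv.Perm.inv_eq_iff_eq, hy]
    · refine (hX.ultrametric a (f a) y).trans (max_le le_rfl ?_)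
      rwa [dist_comm (f a) a] at hay

theorem IsHomogeneous.eventually_captured (h : IsHomogeneous N X) :
    ∀ᶠ f : BP X in residual (BP X), ∀ a, f.1 a = a ∨ ∃ y, f.1 y = y ∧ dist a y ≤ dist a (f.1 a) := by
  classical
  have := h.countable
  refine eventually_countable_forall.2 fun a => mem_residual_of_dense ?_ ?_
  · rintro f (hf | ⟨y, hy, hay⟩)
    · exact ⟨{a}, fun f' hf' => Or.inl (by rw [hf' a (by simp), hf])⟩
    · refine ⟨{a, y}, fun f' hf' => Or.inr ⟨y, ?_, ?_⟩⟩
      · rw [hf' y (by simp), hy]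
      · rwa [hf' a (by simp)]
  · intro f F
    by_cases hfa : f.1 a = a
    · exact ⟨f, Or.inl hfa, fun _ _ => rfl⟩
    · obtain ⟨f', hf', hag, y, hy, hay⟩ := h.exists_fixed f.2 hfa (F := insert a F) (by simp)
      refine ⟨⟨f', hf'⟩, Or.inr ⟨y, hy, ?_⟩, fun u hu => hag u (by simp [hu])⟩
      change dist a y ≤ dist a (f' a)
      rwa [hag a (by simp)]

/-- The generic automorphisms. -/
structure IsNiceAut (N : ℕ∞) (f : Equiv.Perm X) : Prop where
  captured : ∀ a, f a = a ∨ ∃ y, f y = y ∧ dist a y ≤ dist a (f a)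
  level : ∀ y, f y = y → (levelChain N y).IsNice f
  node : N = ⊤ → ∀ y w, y ≠ w → f y = y → dist y (f w) = dist y w → (nodeChain y w).IsNice f

theorem IsHomogeneous.eventually_isNiceAut (h : IsHomogeneous N X) :
    ∀ᶠ f : BP X in residual (BP X), IsNiceAut N f.1 := by
  by_cases hN : N = ⊤
  · filter_upwards [h.eventually_captured, h.eventually_level, h.eventually_node hN]
      with f h1 h2 h3
    exact ⟨h1, h2, fun _ => h3⟩
  · filter_upwards [h.eventually_captured, h.eventually_level] with f h1 h2
    exact ⟨h1, h2, fun h3 => absurd h3 hN⟩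

end OrdUltra

namespace OrdUltra

open Set Topology

universe u v w

/-! ### Comparison of points of one orbit, and the simultaneous action on pairs -/

section Orbits

namespace Chain

variable {X : Type u} {K : Type v} {C C' : Chain X K} {f f' : Equiv.Perm X}

theorem Preserves.zpow_lt_iff (hf : C.Preserves f) (hC : C.IsDense) {c : X} (hc : c ∈ C.carrier)
    (hup : C.lt c (f c)) (i j : ℤ) : C.lt ((f ^ i) c) ((f ^ j) c) ↔ i < j := by
  have hmem : ∀ n : ℤ, (f ^ n) c ∈ C.carrier := fun n => ((hf.zpow n).mem c).1 hc
  refine ⟨fun h => ?_, hf.zpow_lt_zpow hC hc hup⟩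
  rcases lt_trichotomy i j with h1 | rfl | h1
  · exact h1
  · exact absurd h (hC.irrefl (hmem _))
  · exact absurd h (hC.asymm _ (hmem _) _ (hmem _) (hf.zpow_lt_zpow hC hc hup h1))

theorem Preserves.zpow_lt_iff' (hf : C.Preserves f) (hC : C.IsDense) {c : X} (hc : c ∈ C.carrier)
    (hdown : C.lt (f c) c) (i j : ℤ) : C.lt ((f ^ i) c) ((f ^ j) c) ↔ j < i := by
  have h1 : C.lt c (f⁻¹ c) := by rwa [hf.lt, perm_apply_inv_self]
  have h2 := hf.inv.zpow_lt_iff hC hc h1 (-i) (-j)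
  rwa [inv_zpow', inv_zpow', neg_neg, neg_neg, neg_lt_neg_iff] at h2

theorem Preserves.zpow_lt_or (hf : C.Preserves f) (hC : C.IsDense) {c : X} (hc : c ∈ C.carrier)
    (hmove : C.lt c (f c) ∨ C.lt (f c) c) {i j : ℤ} (hij : i ≠ j) :
    C.lt ((f ^ i) c) ((f ^ j) c) ∨ C.lt ((f ^ j) c) ((f ^ i) c) := by
  rcases hmove with h | h
  · rw [hf.zpow_lt_iff hC hc h, hf.zpow_lt_iff hC hc h]
    omega
  · rw [hf.zpow_lt_iff' hC hc h, hf.zpow_lt_iff' hC hc h]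
    omega

theorem orbit_lt_iff (hC : C.IsDense) (hC' : C'.IsDense) (hf : C.Preserves f)
    (hf' : C'.Preserves f') {x x' : X} (hx : x ∈ C.carrier) (hx' : x' ∈ C'.carrier)
    (hcase : f x = x ∨ C.lt x (f x) ∨ C.lt (f x) x) (h1 : f x = x → f' x' = x')
    (h2 : C.lt x (f x) → C'.lt x' (f' x')) (h3 : C.lt (f x) x → C'.lt (f' x') x') (i j : ℤ) :
    C.lt ((f ^ i) x) ((f ^ j) x) ↔ C'.lt ((f' ^ i) x') ((f' ^ j) x') := by
  rcases hcase with h | h | h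
  · rw [zpow_fixed h, zpow_fixed h, zpow_fixed (h1 h), zpow_fixed (h1 h)]
    exact iff_of_false (hC.irrefl hx) (hC'.irrefl hx')
  · rw [hf.zpow_lt_iff hC hx h, hf'.zpow_lt_iff hC' hx' (h2 h)]
  · rw [hf.zpow_lt_iff' hC hx h, hf'.zpow_lt_iff' hC' hx' (h3 h)]

end Chain

variable {X : Type u} {f f' : Equiv.Perm X}

/-- The action of the `n`-th powers of two permutations on pairs. -/
def shift {X : Type u} (f f' : Equiv.Perm X) (n : ℤ) (p : X × X) : X × X := ((f ^ n) p.1, (f' ^ n) p.2)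

theorem shift_shift (m n : ℤ) (p : X × X) :
    shift f f' m (shift f f' n p) = shift f f' (m + n) p := by
  simp only [shift, Chain.zpow_apply_add]

theorem shift_zero (p : X × X) : shift f f' 0 p = p := rfl

theorem shift_neg_shift (n : ℤ) (p : X × X) : shift f f' n (shift f f' (-n) p) = p := by
  rw [shift_shift, add_neg_cancel, shift_zero]

end Orbits

/-! ### Criteria for partial isomorphisms -/

variable {N : ℕ∞} {X : Type u} [MetricSpace X] [LinearOrder X]

/-- The relation of being closer to each other than to `y`. -/
def Near (y u v : X) : Prop := dist u v < dist u y

theorem Near.symm (h : IsOrderedUltrametric N X) {y u v : X} (huv : Near y u v) : Near y v u := by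
  change dist v u < dist v y
  rw [h.dist_eq_of_near huv, dist_comm]
  exact huv

theorem Near.trans (h : IsOrderedUltrametric N X) {y u v w : X} (huv : Near y u v)
    (hvw : Near y v w) : Near y u w := by
  have h1 : dist v w < dist u y := by
    rw [← h.dist_eq_of_near huv]
    exact hvw
  exact (h.ultrametric u v w).trans_lt (max_lt huv h1)

theorem Near.dist_eq (h : IsOrderedUltrametric N X) {y u v : X} (huv : Near y u v) :
    dist y u = dist y v := by
  rw [dist_comm y v, h.dist_eq_of_near huv, dist_comm]

theorem IsTreeEmb.near_iff {f : Equiv.Perm X} (hf : IsTreeEmb f) {y : X} (hy : f y = y)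
    (u v : X) : Near y u v ↔ Near y (f u) (f v) := by
  have := hf.2 u v y
  rwa [hy] at this

/-- Partial isomorphisms are checked level by level around a point. -/
theorem pIso_of_levels (h : IsOrderedUltrametric N X) {S : Set (X × X)} {y y' : X}
    (h1 : ∀ p ∈ S, ∀ q ∈ S, dist y p.1 < dist y q.1 ↔ dist y' p.2 < dist y' q.2)
    (hloc : ∀ p ∈ S, ∃ T, PIso N T ∧ (y, y') ∈ T ∧ ∀ u ∈ S, dist y u.1 = dist y p.1 → u ∈ T) :
    PIso N S := by
  have heq : ∀ p ∈ S, ∀ q ∈ S, dist y p.1 = dist y q.1 ↔ dist y' p.2 = dist y' q.2 := by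
    intro p hp q hq
    have h2 := h1 p hp q hq
    have h3 := h1 q hq p hp
    constructor <;> intro h4 <;> apply le_antisymm <;> rw [← not_lt]
    · exact mt h3.2 h4.le.not_gt
    · exact mt h2.2 h4.ge.not_gt
    · exact mt h3.1 h4.le.not_gt
    · exact mt h2.1 h4.ge.not_gt
  refine PIso.of_link h h h1 ?_ ?_ ?_ ?_ ?_
  · intro p hp q hq
    obtain ⟨T, hT, hy, hu⟩ := hloc p hp
    by_cases h2 : dist y q.1 = dist y p.1
    · exact hT.dist p (hu p hp rfl) q (hu q hq h2) _ hy
    · refine iff_of_false (fun h3 => h2 (h.level_eq_of_near h3)) fun h3 => h2 ?_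
      exact (heq q hq p hp).2 (h.level_eq_of_near h3)
  · intro p hp q hq h2
    obtain ⟨T, hT, -, hu⟩ := hloc p hp
    exact hT.lt p (hu p hp rfl) q (hu q hq h2.symm)
  · intro p hp
    obtain ⟨T, hT, hy, hu⟩ := hloc p hp
    exact hT.col_eq hy (hu p hp rfl)
  · intro p hp q hq r hr h2 h3
    obtain ⟨T, hT, -, hu⟩ := hloc p hp
    exact hT.dist p (hu p hp rfl) q (hu q hq (h.level_eq_of_near h2)) r
      (hu r hr (h.level_eq_of_near h3))
  · intro p hp q hq h2
    obtain ⟨T, hT, -, hu⟩ := hloc p hp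
    exact hT.lab p (hu p hp rfl) q (hu q hq (h.level_eq_of_near h2))

/-- Partial isomorphisms are checked branch by branch around a point. -/
theorem pIso_of_cones (h : IsOrderedUltrametric N X) {R S : Set (X × X)} (hR : PIso N R) {y y' : X}
    (hy : (y, y') ∈ R)
    (hrep : ∀ p ∈ S, ∃ r ∈ R, p = r ∨ (Near y p.1 r.1 ∧ Near y' p.2 r.2))
    (hloc : ∀ p ∈ S, ∃ T, PIso N T ∧ (y, y') ∈ T ∧ ∀ u ∈ S, Near y u.1 p.1 → u ∈ T) :
    PIso N S := by
  have hE : ∀ {y p q r s : X}, (p = r ∨ Near y p r) → (q = s ∨ Near y q s) →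
      (Near y p q ↔ Near y r s) := by
    rintro y p q r s (rfl | h1) (rfl | h2)
    · exact Iff.rfl
    · exact ⟨fun h3 => h3.trans h h2, fun h3 => h3.trans h (h2.symm h)⟩
    · exact ⟨fun h3 => (h1.symm h).trans h h3, fun h3 => h1.trans h h3⟩
    · exact ⟨fun h3 => ((h1.symm h).trans h h3).trans h h2,
        fun h3 => (h1.trans h h3).trans h (h2.symm h)⟩
  have hlev : ∀ {y p r : X}, (p = r ∨ Near y p r) → dist y p = dist y r := by
    rintro y p r (rfl | h1)
    · rfl
    · exact h1.dist_eq h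
  have hord : ∀ {y p q r s : X}, (p = r ∨ Near y p r) → (q = s ∨ Near y q s) →
      dist y p = dist y q → ¬ Near y p q → (p < q ↔ r < s) := by
    intro y p q r s h1 h2 h3 h4
    have h5 : p < q ↔ r < q := by
      rcases h1 with rfl | h1
      · exact Iff.rfl
      · exact h.lt_iff_of_near ((show dist p r < dist p y from h1).trans_le (not_lt.1 h4))
    have h6 : ¬ Near y r q := fun h6 => h4 ((hE h1 (Or.inl rfl)).2 h6)
    rw [h5]
    rcases h2 with rfl | h2
    · exact Iff.rfl
    · refine h.gt_iff_of_near ((show dist q s < dist q y from h2).trans_le ?_)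
      rw [dist_comm q y, ← h3, hlev h1, dist_comm, dist_comm q r]
      exact not_lt.1 h6
  have hrep' : ∀ p ∈ S, ∃ r ∈ R, (p.1 = r.1 ∨ Near y p.1 r.1) ∧ (p.2 = r.2 ∨ Near y' p.2 r.2) := by
    intro p hp
    obtain ⟨r, hr, rfl | h1⟩ := hrep p hp
    · exact ⟨p, hr, Or.inl rfl, Or.inl rfl⟩
    · exact ⟨r, hr, Or.inr h1.1, Or.inr h1.2⟩
  have hnear : ∀ p ∈ S, ∀ q ∈ S, Near y p.1 q.1 ↔ Near y' p.2 q.2 := by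
    intro p hp q hq
    obtain ⟨r, hr, h1, h1'⟩ := hrep' p hp
    obtain ⟨s, hs, h2, h2'⟩ := hrep' q hq
    rw [hE h1 h2, hE h1' h2']
    exact hR.dist r hr s hs _ hy
  have hself : ∀ p ∈ S, p.1 ≠ y → Near y p.1 p.1 := fun p _ hpy => by
    change dist _ _ < _
    rw [dist_self]
    exact dist_pos.2 hpy
  have hself' : ∀ {p q : X}, Near y p q → Near y p p := by
    intro p q h1
    exact h1.trans h (h1.symm h)
  refine PIso.of_link h h (y := y) (y' := y') ?_ hnear ?_ ?_ ?_ ?_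
  · intro p hp q hq
    obtain ⟨r, hr, h1, h1'⟩ := hrep' p hp
    obtain ⟨s, hs, h2, h2'⟩ := hrep' q hq
    rw [hlev h1, hlev h2, hlev h1', hlev h2']
    exact hR.dist _ hy r hr s hs
  · intro p hp q hq h3
    by_cases h4 : Near y p.1 q.1
    · obtain ⟨T, hT, -, hu⟩ := hloc p hp
      exact hT.lt p (hu p hp (hself' h4)) q (hu q hq (h4.symm h))
    · obtain ⟨r, hr, h1, h1'⟩ := hrep' p hp
      obtain ⟨s, hs, h2, h2'⟩ := hrep' q hq
      rw [hord h1 h2 h3 h4, hord h1' h2' ?_ (mt (hnear p hp q hq).2 h4)]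
      · exact hR.lt r hr s hs
      · rw [hlev h1', hlev h2']
        rw [hlev h1, hlev h2] at h3
        exact (hR.dist_eq_iff hy hr hs).1 h3
  · intro p hp
    by_cases hpy : p.1 = y
    · obtain ⟨r, hr, h1 | h1⟩ := hrep p hp
      · rw [h1]
        exact hR.col_eq hy hr
      · exact absurd (show dist _ _ < _ from h1.1) (by rw [hpy, dist_self]; exact dist_nonneg.not_gt)
    · obtain ⟨T, hT, hyT, hu⟩ := hloc p hp
      exact hT.col_eq hyT (hu p hp (hself p hp hpy))
  · intro p hp q hq r hr h2 h3
    obtain ⟨T, hT, -, hu⟩ := hloc p hp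
    exact hT.dist p (hu p hp (hself' h2)) q (hu q hq (Near.symm h h2)) r (hu r hr (Near.symm h h3))
  · intro p hp q hq h2
    obtain ⟨T, hT, -, hu⟩ := hloc p hp
    exact hT.lab p (hu p hp (hself' h2)) q (hu q hq (Near.symm h h2))

/-- Whether two points lie in distinct branches of a node is preserved. -/
theorem pIso_node_iff (h : IsOrderedUltrametric N X) {R : Set (X × X)} (hR : PIso N R)
    {y w p q : X × X} (hy : y ∈ R) (hw : w ∈ R) (hp : p ∈ R) (hq : q ∈ R)
    (hpw : dist y.1 p.1 ≤ dist y.1 w.1) (hqw : dist y.1 q.1 ≤ dist y.1 w.1) :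
    dist p.1 q.1 = dist y.1 w.1 ↔ dist p.2 q.2 = dist y.2 w.2 := by
  rcases hpw.lt_or_eq with h1 | h1
  · have h1' := (hR.dist y hy p hp w hw).1 h1
    have key : ∀ {y w p q : X}, dist y p < dist y w → dist y q ≤ dist y w →
        (dist p q = dist y w ↔ dist y q = dist y w) := by
      intro y w p q h1 h2
      rcases h2.lt_or_eq with h3 | h3
      · refine iff_of_false (fun h4 => ?_) h3.ne
        have h5 := h.ultrametric p y q
        rw [h4, dist_comm p y] at h5
        exact (max_lt h1 h3).not_ge h5
      · refine iff_of_true ?_ h3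
        rw [← h3] at h1 ⊢
        exact h.dist_eq_of_near h1
    have hqw' : dist y.2 q.2 ≤ dist y.2 w.2 :=
      not_lt.1 (mt (hR.dist y hy w hw q hq).2 hqw.not_gt)
    rw [key h1 hqw, key h1' hqw']
    exact hR.dist_eq_iff hy hq hw
  · have h1' := (hR.dist_eq_iff hy hp hw).1 h1
    rw [← h1, ← h1', dist_comm y.1, dist_comm y.2]
    exact hR.dist_eq_iff hp hq hy


/-! ### Invariant partial isomorphisms -/

variable {f f' : Equiv.Perm X}

/-- An invariant partial isomorphism with finitely many orbits, which contains a fixed point and in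
which moved points are captured by fixed points. -/
structure Sys (N : ℕ∞) (f f' : Equiv.Perm X) (R : Set (X × X)) : Prop where
  piso : PIso N R
  inv : ∀ p ∈ R, ∀ n : ℤ, shift f f' n p ∈ R
  fin : ∃ R₀ : Set (X × X), R₀.Finite ∧ R₀ ⊆ R ∧ ∀ p ∈ R, ∃ r ∈ R₀, ∃ n : ℤ, p = shift f f' n r
  fixed : ∃ p ∈ R, f p.1 = p.1
  captured : ∀ p ∈ R, f p.1 = p.1 ∨ ∃ q ∈ R, f q.1 = q.1 ∧ dist p.1 q.1 ≤ dist p.1 (f p.1)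

namespace Sys

variable {R : Set (X × X)}

theorem apply_mem (hR : Sys N f f' R) {p : X × X} (hp : p ∈ R) : (f p.1, f' p.2) ∈ R := by
  simpa [shift] using hR.inv p hp 1

theorem fixed_iff (hR : Sys N f f' R) {p : X × X} (hp : p ∈ R) : f p.1 = p.1 ↔ f' p.2 = p.2 :=
  hR.piso.eq_iff (hR.apply_mem hp) hp

theorem swap (hR : Sys N f f' R) : Sys N f' f (Prod.swap ⁻¹' R) where
  piso := hR.piso.swap
  inv p hp n := hR.inv p.swap hp n
  fin := by
    obtain ⟨R₀, hfin, hsub, hcov⟩ := hR.fin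
    refine ⟨Prod.swap ⁻¹' R₀, hfin.preimage Prod.swap_injective.injOn, fun p hp => hsub hp,
      fun p hp => ?_⟩
    obtain ⟨r, hr, n, hn⟩ := hcov p.swap hp
    exact ⟨r.swap, by simpa using hr, n, Prod.swap_injective hn⟩
  fixed := by
    obtain ⟨p, hp, hpf⟩ := hR.fixed
    exact ⟨p.swap, by simpa using hp, (hR.fixed_iff hp).1 hpf⟩
  captured p hp := by
    rcases hR.captured p.swap hp with h1 | ⟨q, hq, hqf, hd⟩
    · exact Or.inl ((hR.fixed_iff hp).1 h1)
    · refine Or.inr ⟨q.swap, by simpa using hq, (hR.fixed_iff hq).1 hqf, ?_⟩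
      exact not_lt.1 (mt (hR.piso.dist _ hp _ (hR.apply_mem hp) _ hq).2 hd.not_gt)

/-- A fixed pair forms an orbit by itself and so is one of the finitely many representatives; hence
there is a closest one. -/
theorem exists_closest (hR : Sys N f f' R) (x : X) :
    ∃ p ∈ R, f p.1 = p.1 ∧ ∀ q ∈ R, f q.1 = q.1 → dist x p.1 ≤ dist x q.1 := by
  obtain ⟨R₀, hfin, hsub, hcov⟩ := hR.fin
  have hF : {p | p ∈ R ∧ f p.1 = p.1}.Finite := by
    refine hfin.subset ?_
    rintro p ⟨hp, hpf⟩
    obtain ⟨r, hr, n, rfl⟩ := hcov p hp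
    have h1 : shift f f' n r = r := by
      have h2 : shift f f' (-n) (shift f f' n r) = shift f f' n r :=
        Prod.ext (Chain.zpow_fixed hpf _) (Chain.zpow_fixed ((hR.fixed_iff hp).1 hpf) _)
      rw [← h2, shift_shift, neg_add_cancel, shift_zero]
    rwa [h1]
  obtain ⟨p, ⟨hp, hpf⟩, hmin⟩ := hF.exists_minimalFor (fun q => dist x q.1) _ hR.fixed
  refine ⟨p, hp, hpf, fun q hq hqf => ?_⟩
  rcases le_total (dist x p.1) (dist x q.1) with h1 | h1
  · exact h1
  · exact hmin ⟨hq, hqf⟩ h1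

/-- The class of a point under an invariant equivalence relation without recurrence. -/
theorem finite_class (hR : Sys N f f' R) {E : X → X → Prop} (hsymm : ∀ u v, E u v → E v u)
    (htrans : ∀ u v w, E u v → E v w → E u w)
    (hinv : ∀ (n : ℤ) (u v : X), E u v ↔ E ((f ^ n) u) ((f ^ n) v)) {x : X}
    (hx : ∀ n : ℤ, E ((f ^ n) x) x → n = 0) : {p | p ∈ R ∧ E p.1 x}.Finite := by
  classical
  obtain ⟨R₀, hfin, hsub, hcov⟩ := hR.fin
  -- Since the class of `x` never returns to itself, each of the finitely many orbits meets it for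
  -- at most one exponent.
  have hch : ∀ r : X × X, ∃ n : ℤ, (∃ m : ℤ, E ((f ^ m) r.1) x) → E ((f ^ n) r.1) x := fun r => by
    by_cases h1 : ∃ m : ℤ, E ((f ^ m) r.1) x
    · obtain ⟨m, hm⟩ := h1
      exact ⟨m, fun _ => hm⟩
    · exact ⟨0, fun h2 => absurd h2 h1⟩
  choose n hn using hch
  refine (hfin.image fun r => shift f f' (n r) r).subset ?_
  rintro p ⟨hp, hpE⟩
  obtain ⟨r, hr, m, rfl⟩ := hcov p hp
  refine ⟨r, hr, ?_⟩
  have h1 := hn r ⟨m, hpE⟩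
  have h2 := (hinv (m - n r) _ _).1 h1
  rw [← Chain.zpow_apply_add, sub_add_cancel] at h2
  have h3 := hx _ (htrans _ _ _ (hsymm _ _ h2) hpE)
  rw [show m = n r by omega]

theorem piso_shift (h : IsGeneric N X) (hf : f ∈ BP X) (hf' : f' ∈ BP X) {T : Set (X × X)}
    (hT : PIso N T) (n : ℤ) : PIso N (shift f f' n '' T) := by
  have h1 := h.isTreeEmb ((BP X).zpow_mem hf n)
  have h2 := h.isTreeEmb ((BP X).zpow_mem hf' n)
  refine ⟨?_, ?_, ?_⟩
  · rintro _ ⟨p, hp, rfl⟩ _ ⟨q, hq, rfl⟩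
    simp only [shift]
    rw [← h1.1, ← h2.1]
    exact hT.lt p hp q hq
  · rintro _ ⟨p, hp, rfl⟩ _ ⟨q, hq, rfl⟩ _ ⟨r, hr, rfl⟩
    simp only [shift]
    rw [← h1.2, ← h2.2]
    exact hT.dist p hp q hq r hr
  · rintro _ ⟨p, hp, rfl⟩ _ ⟨q, hq, rfl⟩
    simp only [shift]
    rw [lab_equiv h1, lab_equiv h2]
    exact hT.lab p hp q hq

/-- The orbit of a pair. -/
def orbit (f f' : Equiv.Perm X) (p : X × X) : Set (X × X) := range fun n : ℤ => shift f f' n p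

theorem union_orbit (h : IsGeneric N X) (hf : f ∈ BP X) (hR : Sys N f f' R) {p : X × X}
    (hP : PIso N (R ∪ orbit f f' p))
    (hp : f p.1 = p.1 ∨ ∃ q ∈ R, f q.1 = q.1 ∧ dist p.1 q.1 ≤ dist p.1 (f p.1)) :
    Sys N f f' (R ∪ orbit f f' p) where
  piso := hP
  inv q hq n := by
    rcases hq with hq | ⟨m, rfl⟩
    · exact Or.inl (hR.inv q hq n)
    · exact Or.inr ⟨n + m, (shift_shift _ _ _).symm⟩
  fin := by
    obtain ⟨R₀, hfin, hsub, hcov⟩ := hR.fin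
    refine ⟨insert p R₀, hfin.insert p, insert_subset (Or.inr ⟨0, rfl⟩)
      (hsub.trans subset_union_left), ?_⟩
    rintro q (hq | ⟨m, rfl⟩)
    · obtain ⟨r, hr, n, hn⟩ := hcov q hq
      exact ⟨r, mem_insert_of_mem _ hr, n, hn⟩
    · exact ⟨p, mem_insert _ _, m, rfl⟩
  fixed := by
    obtain ⟨q, hq, hqf⟩ := hR.fixed
    exact ⟨q, Or.inl hq, hqf⟩
  captured := by
    rintro q (hq | ⟨m, rfl⟩)
    · rcases hR.captured q hq with h1 | ⟨r, hr, h1⟩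
      · exact Or.inl h1
      · exact Or.inr ⟨r, Or.inl hr, h1⟩
    · rcases hp with h1 | ⟨r, hr, hrf, h1⟩
      · left
        simp only [shift]
        rw [Chain.zpow_fixed h1, h1]
      · right
        refine ⟨r, Or.inl hr, hrf, ?_⟩
        rw [(h.isTreeEmb ((BP X).zpow_mem hf m)).dist_le_iff, Chain.zpow_fixed hrf,
          show (f ^ m) (f p.1) = f ((f ^ m) p.1) by
            rw [← Equiv.Perm.mul_apply, ← Equiv.Perm.mul_apply, (Commute.zpow_self f m).eq]] at h1
        exact h1

end Sys

end OrdUltra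

namespace OrdUltra

open Set Topology

universe u v w

/-! ### Adding orbits on moved levels and branches, and on new levels -/

namespace Sys

variable {N : ℕ∞} {X : Type u} [MetricSpace X] [LinearOrder X] {f f' : Equiv.Perm X}
  {R : Set (X × X)}

theorem shift_fixed (hR : Sys N f f' R) {p : X × X} (hp : p ∈ R) (hpf : f p.1 = p.1) (n : ℤ) :
    shift f f' n p = p :=
  Prod.ext (Chain.zpow_fixed hpf _) (Chain.zpow_fixed ((hR.fixed_iff hp).1 hpf) _)

/-- The class of a point under an invariant equivalence relation without recurrence is extended by
the point, and so is the whole orbit of the class. -/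
theorem exists_local (h : IsGeneric N X) (hf : f ∈ BP X) (hf' : f' ∈ BP X) (hR : Sys N f f' R)
    {E : X → X → Prop} (hsymm : ∀ u v, E u v → E v u)
    (htrans : ∀ u v w, E u v → E v w → E u w)
    (hinv : ∀ (n : ℤ) (u v : X), E u v ↔ E ((f ^ n) u) ((f ^ n) v)) {x : X}
    (hx : ∀ n : ℤ, E ((f ^ n) x) x → n = 0) {p : X × X} (hp : p ∈ R) (hpf : f p.1 = p.1) :
    ∃ (x' : X) (T₀ : Set (X × X)), PIso N T₀ ∧ p ∈ T₀ ∧ (x, x') ∈ T₀ ∧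
      (∀ u ∈ R, E u.1 x → u ∈ T₀) ∧ ∀ u ∈ R ∪ orbit f f' (x, x'), ∃ T, PIso N T ∧ p ∈ T ∧
        ∀ v ∈ R ∪ orbit f f' (x, x'), E v.1 u.1 → v ∈ T := by
  have hfin := hR.finite_class hsymm htrans hinv hx
  obtain ⟨x', hx'⟩ := exists_extension h.ordered h (hfin.insert p)
    (hR.piso.mono (insert_subset hp fun u hu => hu.1)) x
  refine ⟨x', _, hx', mem_insert_of_mem _ (mem_insert _ _), mem_insert _ _,
    fun u hu huE => mem_insert_of_mem _ (mem_insert_of_mem _ ⟨hu, huE⟩), fun u hu => ?_⟩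
  -- Near `f ^ n x` everything is the image under the `n`-th shift of the finite extension at `x`;
  -- elsewhere only points of `R` occur.
  by_cases hn : ∃ n : ℤ, E u.1 ((f ^ n) x)
  · obtain ⟨n, hn⟩ := hn
    refine ⟨_, piso_shift h hf hf' hx' n, ⟨p, mem_insert_of_mem _ (mem_insert _ _),
      hR.shift_fixed hp hpf n⟩, ?_⟩
    have hback : ∀ v : X, E v ((f ^ n) x) → E ((f ^ (-n)) v) x := by
      intro v hv
      have := (hinv (-n) _ _).1 hv
      rwa [← Chain.zpow_apply_add, neg_add_cancel, zpow_zero] at this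
    rintro v (hv | ⟨m, rfl⟩) hvu
    · refine ⟨shift f f' (-n) v, mem_insert_of_mem _ (mem_insert_of_mem _ ⟨hR.inv v hv _, ?_⟩),
        shift_neg_shift n v⟩
      exact hback _ (htrans _ _ _ hvu hn)
    · have h1 := hback _ (htrans _ _ _ hvu hn)
      simp only [shift] at h1
      rw [← Chain.zpow_apply_add] at h1
      refine ⟨(x, x'), mem_insert _ _, ?_⟩
      rw [show n = m by have := hx _ h1; omega]
  · refine ⟨R, hR.piso, hp, ?_⟩
    rintro v (hv | ⟨m, rfl⟩) hvu
    · exact hv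
    · exact absurd ⟨m, hsymm _ _ hvu⟩ hn

theorem dist_zpow_lt (h : IsGeneric N X) (hf : f ∈ BP X) {y : X} (hfy : f y = y) (n : ℤ) (u v : X) :
    dist y u < dist y v ↔ dist y ((f ^ n) u) < dist y ((f ^ n) v) :=
  (h.isTreeEmb ((BP X).zpow_mem hf n)).dist_lt_of_fixed (Chain.zpow_fixed hfy n) u v

theorem dist_zpow_eq (h : IsGeneric N X) (hf : f ∈ BP X) {y : X} (hfy : f y = y) (n : ℤ) (u v : X) :
    dist y u = dist y v ↔ dist y ((f ^ n) u) = dist y ((f ^ n) v) :=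
  (h.isTreeEmb ((BP X).zpow_mem hf n)).dist_eq_of_fixed (Chain.zpow_fixed hfy n) u v

theorem levelChain_move {y u : X} (hu : dist y (f u) ≠ dist y u) :
    (levelChain N y).lt u (f u) ∨ (levelChain N y).lt (f u) u :=
  (lt_or_gt_of_ne hu).symm

/-- A point on a moved level, which is a level of the partial isomorphism, is added. -/
theorem exists_of_level (h : IsGeneric N X) (hf : f ∈ BP X) (hf' : f' ∈ BP X) (hR : Sys N f f' R)
    {y y' : X} (hy : (y, y') ∈ R) (hfy : f y = y) {x : X} (hx : x ≠ y)
    (hmove : dist y (f x) ≠ dist y x) {p : X × X} (hp : p ∈ R) (hpx : dist y p.1 = dist y x) :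
    ∃ x', PIso N (R ∪ orbit f f' (x, x')) := by
  have hfy' : f' y' = y' := (hR.fixed_iff hy).1 hfy
  -- A moved level never returns under the powers of `f`. So a finite extension on the level of `x`
  -- is unconstrained by the dynamics and can be copied along the orbit.
  obtain ⟨x', T₀, hT₀, hyT, hxT, hRT, hloc⟩ := hR.exists_local h hf hf'
    (E := fun u v => dist y u = dist y v) (fun _ _ => Eq.symm) (fun _ _ _ => Eq.trans)
    (fun n u v => dist_zpow_eq h hf hfy n u v) (x := x) (fun n hn => by
      by_contra hne
      have := (levelChain_preserves (N := N) (h.isTreeEmb hf) hfy).zpow_lt_or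
        (h.levelChain_isDense y) hx (levelChain_move hmove) hne
      rw [zpow_zero] at this
      rcases this with h1 | h1
      · exact (show dist _ _ < dist _ _ from h1).ne hn
      · exact (show dist _ _ < dist _ _ from h1).ne' hn) hy hfy
  refine ⟨x', ?_⟩
  have hpx' : dist y' p.2 = dist y' x' := (hT₀.dist_eq_iff hyT (hRT p hp hpx) hxT).1 hpx
  have hrep : ∀ u ∈ R ∪ orbit f f' (x, x'), ∃ r ∈ R, dist y u.1 = dist y r.1 ∧
      dist y' u.2 = dist y' r.2 := by
    rintro u (hu | ⟨n, rfl⟩)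
    · exact ⟨u, hu, rfl, rfl⟩
    · exact ⟨_, hR.inv p hp n, (dist_zpow_eq h hf hfy n _ _).1 hpx.symm,
        (dist_zpow_eq h hf' hfy' n _ _).1 hpx'.symm⟩
  refine pIso_of_levels h.ordered (y := y) (y' := y') (fun u hu v hv => ?_) fun u hu => ?_
  · obtain ⟨r, hr, h1, h1'⟩ := hrep u hu
    obtain ⟨s, hs, h2, h2'⟩ := hrep v hv
    rw [h1, h2, h1', h2']
    exact hR.piso.dist _ hy r hr s hs
  · exact hloc u hu

/-- A point on a moved branch, which is a branch of the partial isomorphism, is added. -/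
theorem exists_of_cone (h : IsGeneric N X) (hN : N = ⊤) (hf : f ∈ BP X) (hf' : f' ∈ BP X)
    (hR : Sys N f f' R)
    {y y' : X} (hy : (y, y') ∈ R) (hfy : f y = y) {x : X} (hx : x ≠ y)
    (hlev : dist y (f x) = dist y x) (hmove : dist x (f x) = dist y x) {p : X × X} (hp : p ∈ R)
    (hpx : Near y x p.1) : ∃ x', PIso N (R ∪ orbit f f' (x, x')) := by
  have hX := h.ordered
  have hfy' : f' y' = y' := (hR.fixed_iff hy).1 hfy
  have hxfx : x ≠ f x := fun h1 => by
    rw [← h1, dist_self, eq_comm, dist_eq_zero] at hmove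
    exact hx hmove.symm
  have hinv : ∀ {f : Equiv.Perm X} {y : X}, f ∈ BP X → f y = y → ∀ (n : ℤ) (u v : X),
      Near y u v ↔ Near y ((f ^ n) u) ((f ^ n) v) := fun {f y} hf hfy n u v =>
    (h.isTreeEmb ((BP X).zpow_mem hf n)).near_iff (Chain.zpow_fixed hfy n) u v
  obtain ⟨x', T₀, hT₀, hyT, hxT, hRT, hloc⟩ := hR.exists_local h hf hf' (E := Near y)
    (fun _ _ h1 => h1.symm hX) (fun _ _ _ h1 h2 => h1.trans hX h2) (hinv hf hfy) (x := x)
    (fun n hn => by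
      by_contra hne
      have := (nodeChain_preserves hX (h.isTreeEmb hf) hfy hlev).zpow_lt_or
        (h.nodeChain_isDense hN (Ne.symm hx)) (c := x) (le_refl (dist y x)) (by
          rcases lt_or_gt_of_ne hxfx with h1 | h1
          · exact Or.inl ⟨le_rfl, h1, hmove⟩
          · exact Or.inr ⟨hlev.le, h1, by rw [dist_comm, hmove]⟩) hne
      rw [zpow_zero] at this
      have h1 : dist ((f ^ n) x) x = dist y x := by
        rcases this with h1 | h1
        · exact h1.2.2
        · rw [dist_comm]
          exact h1.2.2
      have h2 : dist x ((f ^ n) x) < dist x y := hn.symm hX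
      rw [dist_comm, h1, dist_comm] at h2
      exact lt_irrefl _ h2) hy hfy
  refine ⟨x', pIso_of_cones hX hR.piso hy ?_ hloc⟩
  have hpx' : Near y' x' p.2 := (hT₀.dist _ hxT p (hRT p hp (hpx.symm hX)) _ hyT).1 hpx
  rintro u (hu | ⟨n, rfl⟩)
  · exact ⟨u, hu, Or.inl rfl⟩
  · exact ⟨_, hR.inv p hp n, Or.inr ⟨(hinv hf hfy n _ _).1 hpx, (hinv hf' hfy' n _ _).1 hpx'⟩⟩

/-- A point on a new level is added. -/
theorem exists_of_new_level (h : IsGeneric N X) (hf : f ∈ BP X) (hf' : f' ∈ BP X)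
    (hnice : IsNiceAut N f') (hR : Sys N f f' R)
    {y y' : X} (hy : (y, y') ∈ R) (hfy : f y = y) {x : X} (hx : x ≠ y)
    (hmove : f x = x ∨ dist y (f x) ≠ dist y x) (hfresh : ∀ p ∈ R, dist y p.1 ≠ dist y x) :
    ∃ x', PIso N (R ∪ orbit f f' (x, x')) := by
  have hX := h.ordered
  have hfy' : f' y' = y' := (hR.fixed_iff hy).1 hfy
  obtain ⟨R₀, hfin, hsub, hcov⟩ := hR.fin
  have hpy : ∀ p ∈ R, p.1 = y ↔ p.2 = y' := fun p hp => hR.piso.eq_iff hp hy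
  have hC := levelChain_preserves (N := N) (h.isTreeEmb hf) hfy
  have hC' := levelChain_preserves (N := N) (h.isTreeEmb hf') hfy'
  have hcase : f x = x ∨ (levelChain N y).lt x (f x) ∨ (levelChain N y).lt (f x) x :=
    hmove.imp id levelChain_move
  -- On a new level only the level and the color matter, so the problem is one about chains. The
  -- point `y` is not in the chain and is treated as lying below it.
  obtain ⟨x', hx', hcol, hpos, h1, h2, h3⟩ := Chain.exists_extension (C := levelChain N y)
    (C' := levelChain N y') (R := {p | p ∈ R ∧ p.1 ≠ y}) (R₀ := {p | p ∈ R₀ ∧ p.1 ≠ y})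
    (h.levelChain_isDense y) (h.levelChain_isDense y') Subset.rfl hC hC' (hnice.level y' hfy')
    (hfin.subset (sep_subset _ _)) (fun p hp => ⟨hsub hp.1, hp.2⟩)
    (by
      rintro p ⟨hp, hpy⟩
      obtain ⟨r, hr, n, rfl⟩ := hcov p hp
      exact ⟨r, ⟨hr, ((hC.zpow n).mem _).2 hpy⟩, n, rfl⟩)
    (fun p hp n => ⟨hR.inv p hp.1 n, ((hC.zpow n).mem _).1 hp.2⟩)
    (fun p hp => hp.2) (fun p hp => mt (hpy p hp.1).2 hp.2)
    (fun p hp q hq => hR.piso.dist _ hy p hp.1 q hq.1) (x := x) hx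
    (fun p hp => lt_or_gt_of_ne (hfresh p hp.1)) hcase
  have hx'y : x' ≠ y' := hx'
  have hcol' : col N y' x' = col N y x := hcol
  have hdir : ∀ p ∈ R, (dist y p.1 < dist y x → dist y' p.2 < dist y' x') ∧
      (dist y x < dist y p.1 → dist y' x' < dist y' p.2) := by
    intro p hp
    by_cases h4 : p.1 = y
    · rw [h4, (hpy p hp).1 h4, dist_self, dist_self]
      exact ⟨fun _ => dist_pos.2 hx'y.symm, fun h5 => absurd h5 dist_nonneg.not_gt⟩
    · exact hpos p ⟨hp, h4⟩
  have hiff : ∀ p ∈ R, (dist y p.1 < dist y x ↔ dist y' p.2 < dist y' x') ∧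
      (dist y x < dist y p.1 ↔ dist y' x' < dist y' p.2) := by
    intro p hp
    rcases lt_or_gt_of_ne (hfresh p hp) with h4 | h4
    · have := (hdir p hp).1 h4
      exact ⟨iff_of_true h4 this, iff_of_false h4.not_gt this.not_gt⟩
    · have := (hdir p hp).2 h4
      exact ⟨iff_of_false h4.not_gt this.not_gt, iff_of_true h4 this⟩
  have hshift : ∀ p ∈ R, ∀ n : ℤ,
      (dist y p.1 < dist y ((f ^ n) x) ↔ dist y' p.2 < dist y' ((f' ^ n) x')) ∧
      (dist y ((f ^ n) x) < dist y p.1 ↔ dist y' ((f' ^ n) x') < dist y' p.2) ∧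
      dist y p.1 ≠ dist y ((f ^ n) x) := by
    intro p hp n
    have h4 := hR.inv p hp (-n)
    have h5 := hiff _ h4
    rw [dist_zpow_lt h hf hfy n, dist_zpow_lt h hf' hfy' n, dist_zpow_lt h hf hfy n x,
      dist_zpow_lt h hf' hfy' n x'] at h5
    have h6 := hfresh _ h4
    rw [ne_eq, dist_zpow_eq h hf hfy n] at h6
    have h7 : (f ^ n) (shift f f' (-n) p).1 = p.1 := congrArg Prod.fst (shift_neg_shift n p)
    have h8 : (f' ^ n) (shift f f' (-n) p).2 = p.2 := congrArg Prod.snd (shift_neg_shift n p)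
    rw [h7, h8] at h5
    rw [h7] at h6
    exact ⟨h5.1, h5.2, h6⟩
  have horb := Chain.orbit_lt_iff (h.levelChain_isDense y) (h.levelChain_isDense y') hC hC' hx hx'
    hcase h1 h2 h3
  refine ⟨x', pIso_of_levels hX (y := y) (y' := y') ?_ ?_⟩
  · rintro p (hp | ⟨n, rfl⟩) q (hq | ⟨m, rfl⟩)
    · exact hR.piso.dist _ hy p hp q hq
    · exact (hshift p hp m).1
    · exact (hshift q hq n).2.1
    · exact horb n m
  · rintro p (hp | ⟨n, rfl⟩)
    · refine ⟨R, hR.piso, hy, ?_⟩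
      rintro u (hu | ⟨m, rfl⟩) hup
      · exact hu
      · exact absurd hup.symm (hshift p hp m).2.2
    -- A level of the new orbit contains no other pair, so the pair and `(y, y')` suffice locally.
    · refine ⟨insert (shift f f' n (x, x')) {(y, y')}, PIso.pair hX hX ?_ ?_ ?_,
        mem_insert_of_mem _ rfl, ?_⟩
      · exact ((hC.zpow n).mem x).1 hx
      · exact ((hC'.zpow n).mem x').1 hx'
      · have h4 : col N y ((f ^ n) x) = col N y x := (hC.zpow n).col x hx
        have h5 : col N y' ((f' ^ n) x') = col N y' x' := (hC'.zpow n).col x' hx'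
        simp only [h4, h5, hcol']
      · rintro u (hu | ⟨m, rfl⟩) hup
        · exact absurd hup (hshift u hu n).2.2
        · left
          rcases hmove with h4 | h4
          · simp only [shift]
            rw [Chain.zpow_fixed h4, Chain.zpow_fixed h4, Chain.zpow_fixed (h1 h4),
              Chain.zpow_fixed (h1 h4)]
          · by_contra hne
            have hmn : m ≠ n := by
              rintro rfl
              exact hne rfl
            rcases hC.zpow_lt_or (h.levelChain_isDense y) hx (levelChain_move h4) hmn with h5 | h5
            · exact (show dist _ _ < dist _ _ from h5).ne hup
            · exact (show dist _ _ < dist _ _ from h5).ne' hup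

end Sys

end OrdUltra

namespace OrdUltra

open Set Topology

universe u v w

/-! ### Adding orbits on new branches, and the extension of systems to arbitrary points -/

namespace Sys

variable {N : ℕ∞} {X : Type u} [MetricSpace X] [LinearOrder X] {f f' : Equiv.Perm X}
  {R : Set (X × X)}

/-- A point on a new branch at a node of the partial isomorphism is added. -/
theorem exists_of_new_branch (h : IsGeneric N X) (hN : N = ⊤) (hf : f ∈ BP X) (hf' : f' ∈ BP X)
    (hnice : IsNiceAut N f') (hR : Sys N f f' R)
    {y y' : X} (hy : (y, y') ∈ R) (hfy : f y = y) {x : X} (hx : x ≠ y)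
    (hlev : dist y (f x) = dist y x) (hmove : f x = x ∨ dist x (f x) = dist y x)
    (hfresh : ∀ p ∈ R, dist x y ≤ dist x p.1) {w : X × X} (hw : w ∈ R)
    (hwx : dist y w.1 = dist y x) : ∃ x', PIso N (R ∪ orbit f f' (x, x')) := by
  have hX := h.ordered
  have hfy' : f' y' = y' := (hR.fixed_iff hy).1 hfy
  obtain ⟨R₀, hfin, hsub, hcov⟩ := hR.fin
  have hyw : y ≠ w.1 := fun h1 => by
    rw [← h1, dist_self, eq_comm, dist_eq_zero] at hwx
    exact hx hwx.symm
  have hyw' : y' ≠ w.2 := mt (hR.piso.eq_iff hy hw).2 hyw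
  have hfw : dist y (f w.1) = dist y w.1 := by
    rw [hwx, ← hlev, ← (h.isTreeEmb hf).dist_eq_of_fixed hfy, hwx]
  have hfw' : dist y' (f' w.2) = dist y' w.2 := (hR.piso.dist_eq_iff hy (hR.apply_mem hw) hw).1 hfw
  have hC := nodeChain_preserves hX (h.isTreeEmb hf) hfy hfw
  have hC' := nodeChain_preserves hX (h.isTreeEmb hf') hfy' hfw'
  have hD := h.nodeChain_isDense hN hyw
  have hD' := h.nodeChain_isDense hN hyw'
  have hxC : x ∈ (nodeChain y w.1).carrier := hwx.ge
  have hle : ∀ p ∈ R, dist y p.1 ≤ dist y w.1 ↔ dist y' p.2 ≤ dist y' w.2 := fun p hp => by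
    rw [← not_lt, ← not_lt]
    exact not_congr (hR.piso.dist _ hy w hw p hp)
  have hlt_or : ∀ u v : X, dist y u ≤ dist y w.1 → dist y v ≤ dist y w.1 →
      dist u v = dist y w.1 → (nodeChain y w.1).lt u v ∨ (nodeChain y w.1).lt v u := by
    intro u v hu hv huv
    rcases lt_trichotomy u v with h1 | rfl | h1
    · exact Or.inl ⟨hu, h1, huv⟩
    · rw [dist_self, eq_comm, dist_eq_zero] at huv
      exact absurd huv hyw
    · exact Or.inr ⟨hv, h1, by rw [dist_comm, huv]⟩
  have hcase : f x = x ∨ (nodeChain y w.1).lt x (f x) ∨ (nodeChain y w.1).lt (f x) x :=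
    hmove.imp id fun h1 => hlt_or _ _ hwx.ge (hlev.trans hwx.symm).le (h1.trans hwx.symm)
  have hfr : ∀ p ∈ R, dist y p.1 ≤ dist y w.1 →
      (nodeChain y w.1).lt p.1 x ∨ (nodeChain y w.1).lt x p.1 := by
    intro p hp hpw
    refine hlt_or _ _ hpw hwx.ge (le_antisymm ?_ ?_)
    · refine (hX.ultrametric _ y _).trans (max_le ?_ hwx.ge)
      rwa [dist_comm]
    · rw [hwx, dist_comm y, dist_comm p.1]
      exact hfresh p hp
  obtain ⟨x', hx', -, hpos, h1, h2, h3⟩ := Chain.exists_extension (C := nodeChain y w.1)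
    (C' := nodeChain y' w.2) (R := {p | p ∈ R ∧ dist y p.1 ≤ dist y w.1})
    (R₀ := {p | p ∈ R₀ ∧ dist y p.1 ≤ dist y w.1}) hD hD' Subset.rfl hC hC'
    (hnice.node hN y' w.2 hyw' hfy' hfw') (hfin.subset (sep_subset _ _))
    (fun p hp => ⟨hsub hp.1, hp.2⟩)
    (by
      rintro p ⟨hp, hpw⟩
      obtain ⟨r, hr, n, rfl⟩ := hcov p hp
      exact ⟨r, ⟨hr, ((hC.zpow n).mem _).2 hpw⟩, n, rfl⟩)
    (fun p hp n => ⟨hR.inv p hp.1 n, ((hC.zpow n).mem _).1 hp.2⟩)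
    (fun p hp => hp.2) (fun p hp => (hle p hp.1).1 hp.2)
    (by
      rintro p ⟨hp, hpw⟩ q ⟨hq, hqw⟩
      refine and_congr (hle p hp) (and_congr (hR.piso.lt p hp q hq) ?_)
      exact pIso_node_iff hX hR.piso hy hw hp hq hpw hqw) (x := x) hxC
    (fun p hp => hfr p hp.1 hp.2) hcase
  have hshift : ∀ p ∈ R, dist y p.1 ≤ dist y w.1 → ∀ n : ℤ,
      ((nodeChain y w.1).lt p.1 ((f ^ n) x) ∧ (nodeChain y' w.2).lt p.2 ((f' ^ n) x')) ∨
      ((nodeChain y w.1).lt ((f ^ n) x) p.1 ∧ (nodeChain y' w.2).lt ((f' ^ n) x') p.2) := by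
    intro p hp hpw n
    have h4 := hR.inv p hp (-n)
    have h5 : dist y (shift f f' (-n) p).1 ≤ dist y w.1 := ((hC.zpow (-n)).mem _).1 hpw
    have h7 : (f ^ n) (shift f f' (-n) p).1 = p.1 := congrArg Prod.fst (shift_neg_shift n p)
    have h8 : (f' ^ n) (shift f f' (-n) p).2 = p.2 := congrArg Prod.snd (shift_neg_shift n p)
    rcases hfr _ h4 h5 with h6 | h6
    · left
      have h9 := ((hC.zpow n).lt _ _).1 h6
      have h10 := ((hC'.zpow n).lt _ _).1 ((hpos _ ⟨h4, h5⟩).1 h6)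
      rw [h7] at h9
      rw [h8] at h10
      exact ⟨h9, h10⟩
    · right
      have h9 := ((hC.zpow n).lt _ _).1 h6
      have h10 := ((hC'.zpow n).lt _ _).1 ((hpos _ ⟨h4, h5⟩).2 h6)
      rw [h7] at h9
      rw [h8] at h10
      exact ⟨h9, h10⟩
  have horb := Chain.orbit_lt_iff hD hD' hC hC' hxC hx' hcase h1 h2 h3
  have horb_or : ∀ n m : ℤ, shift f f' n (x, x') ≠ shift f f' m (x, x') →
      ((nodeChain y w.1).lt ((f ^ n) x) ((f ^ m) x) ∧
        (nodeChain y' w.2).lt ((f' ^ n) x') ((f' ^ m) x')) ∨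
      ((nodeChain y w.1).lt ((f ^ m) x) ((f ^ n) x) ∧
        (nodeChain y' w.2).lt ((f' ^ m) x') ((f' ^ n) x')) := by
    intro n m hnm
    have hfx : f x ≠ x := fun h4 => hnm (by
      simp only [shift, Chain.zpow_fixed h4, Chain.zpow_fixed (h1 h4)])
    have hnm' : n ≠ m := by
      rintro rfl
      exact hnm rfl
    rw [← horb n m, ← horb m n, and_self, and_self]
    exact hC.zpow_lt_or hD hxC (hcase.resolve_left hfx) hnm'
  have hOC : ∀ n : ℤ, dist y ((f ^ n) x) = dist y w.1 ∧ dist y' ((f' ^ n) x') = dist y' w.2 := by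
    intro n
    rcases hshift _ hy (by rw [dist_self]; exact dist_nonneg) n with ⟨h4, h5⟩ | ⟨h4, h5⟩
    · exact ⟨h4.2.2, h5.2.2⟩
    · rw [dist_comm y, dist_comm y']
      exact ⟨h4.2.2, h5.2.2⟩
  have hfar : ∀ {y w u v : X}, dist y u = dist y w → dist y w < dist y v → dist u y ≤ dist u v := by
    intro y w u v h4 h5
    have h6 : dist y u < dist y v := h4.trans_lt h5
    rw [hX.dist_eq_of_near h6, dist_comm]
    exact h6.le
  refine ⟨x', PIso.union_fresh hX hX hR.piso hy ?_ ?_ ?_ ?_⟩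
  · rintro _ ⟨n, rfl⟩ q hq
    simp only [shift]
    rw [(hOC n).1, (hOC n).2]
    rcases hq with hq | ⟨m, rfl⟩
    · exact ⟨hR.piso.dist _ hy w hw q hq, hR.piso.dist _ hy q hq w hw⟩
    · simp only [shift]
      rw [(hOC m).1, (hOC m).2]
      simp
  · rintro _ ⟨n, rfl⟩ q hq hne
    rcases hq with hq | ⟨m, rfl⟩
    · by_cases hqw : dist y q.1 ≤ dist y w.1
      · simp only [shift]
        rw [dist_comm _ y, dist_comm _ y', (hOC n).1, (hOC n).2]
        rcases hshift q hq hqw n with ⟨h4, h5⟩ | ⟨h4, h5⟩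
        · rw [dist_comm _ q.1, dist_comm _ q.2]
          exact ⟨h4.2.2.ge, h5.2.2.ge⟩
        · exact ⟨h4.2.2.ge, h5.2.2.ge⟩
      · have h4 := not_le.1 hqw
        exact ⟨hfar (hOC n).1 h4, hfar (hOC n).2 ((hR.piso.dist _ hy w hw q hq).1 h4)⟩
    · have h4 := horb_or n m hne
      simp only [shift]
      rw [dist_comm _ y, dist_comm _ y', (hOC n).1, (hOC n).2]
      rcases h4 with ⟨h4, h5⟩ | ⟨h4, h5⟩
      · exact ⟨h4.2.2.ge, h5.2.2.ge⟩
      · rw [dist_comm ((f ^ n) x), dist_comm ((f' ^ n) x')]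
        exact ⟨h4.2.2.ge, h5.2.2.ge⟩
  · rintro _ ⟨n, rfl⟩ q hq hd
    rcases hq with hq | ⟨m, rfl⟩
    · have hqw : dist y q.1 ≤ dist y w.1 := by
        rw [← hd]
        exact (hOC n).1.le
      rcases hshift q hq hqw n with ⟨h4, h5⟩ | ⟨h4, h5⟩
      · exact ⟨iff_of_false h4.2.1.not_gt h5.2.1.not_gt, iff_of_true h4.2.1 h5.2.1⟩
      · exact ⟨iff_of_true h4.2.1 h5.2.1, iff_of_false h4.2.1.not_gt h5.2.1.not_gt⟩
    · by_cases hne : shift f f' n (x, x') = shift f f' m (x, x')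
      · simp only [hne]
        exact ⟨iff_of_false (lt_irrefl _) (lt_irrefl _), iff_of_false (lt_irrefl _) (lt_irrefl _)⟩
      · rcases horb_or n m hne with ⟨h4, h5⟩ | ⟨h4, h5⟩
        · exact ⟨iff_of_true h4.2.1 h5.2.1, iff_of_false h4.2.1.not_gt h5.2.1.not_gt⟩
        · exact ⟨iff_of_false h4.2.1.not_gt h5.2.1.not_gt, iff_of_true h4.2.1 h5.2.1⟩
  · rintro _ ⟨n, rfl⟩
    apply col_top hN
    rcases hshift _ hy (by rw [dist_self]; exact dist_nonneg) n with ⟨h4, h5⟩ | ⟨h4, h5⟩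
    · exact iff_of_true h4.2.1 h5.2.1
    · exact iff_of_false h4.2.1.not_gt h5.2.1.not_gt

/-- A fixed point on a new branch at a node of the partial isomorphism is added. -/
theorem exists_of_new_label (h : IsGeneric N X) (hN : N ≠ ⊤) (hf : f ∈ BP X) (hf' : f' ∈ BP X)
    (hnice : IsNiceAut N f') (hR : Sys N f f' R)
    {y y' : X} (hy : (y, y') ∈ R) (hfy : f y = y) {x : X} (hx : x ≠ y) (hfx : f x = x)
    (hfresh : ∀ p ∈ R, dist x y ≤ dist x p.1) {w : X × X} (hw : w ∈ R)
    (hwx : dist y w.1 = dist y x) : ∃ x', PIso N (R ∪ orbit f f' (x, x')) := by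
  have hX := h.ordered
  have hfy' : f' y' = y' := (hR.fixed_iff hy).1 hfy
  have hft' := h.isTreeEmb hf'
  -- The point `z` only marks the branch that has to contain the image; it need not be fixed by
  -- `f'`.
  obtain ⟨z, hz⟩ := exists_extension hX h (R := {(y, y'), w}) (by simp)
    (hR.piso.mono (by rintro p (rfl | rfl) <;> assumption)) x
  have hmx := mem_insert (x, z) {(y, y'), w}
  have hmy : (y, y') ∈ insert (x, z) ({(y, y'), w} : Set (X × X)) := by simp
  have hmw : w ∈ insert (x, z) ({(y, y'), w} : Set (X × X)) := by simp
  have hzy : z ≠ y' := mt (hz.eq_iff hmx hmy).2 hx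
  have hzw : dist y' w.2 = dist y' z := (hz.dist_eq_iff hmy hmw hmx).1 hwx
  have hcolz : col N y x = col N y' z := hz.col_eq hmy hmx
  have hlev : dist y' (f' z) = dist y' z := by
    have h1 : dist y (f w.1) = dist y w.1 := by
      have h2 := (h.isTreeEmb hf).dist_eq_of_fixed hfy w.1 x
      rw [hfx] at h2
      rw [h2.1 hwx, hwx]
    have h2 := (hR.piso.dist_eq_iff hy (hR.apply_mem hw) hw).1 h1
    rw [← hzw, ← h2, eq_comm, ← hft'.dist_eq_of_fixed hfy', hzw]
  -- The level of `z` around the fixed point `y'` is preserved, hence so is its branch, because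
  -- branches of a node are told apart by labels. If `z` moves, it moves inside this branch, and a
  -- fixed point capturing it lies there too.
  obtain ⟨x', hx'z, hfx'⟩ : ∃ x', dist z x' < dist z y' ∧ f' x' = x' := by
    have hsmall : dist z (f' z) < dist z y' := by
      refine lt_of_le_of_ne ?_ fun h1 => ?_
      · refine (hX.ultrametric z y' _).trans (max_le le_rfl ?_)
        rw [hlev, dist_comm]
      · by_cases h2 : f' z = z
        · rw [h2, dist_self, eq_comm, dist_eq_zero] at h1
          exact hzy h1
        · refine lab_ne hX hN h2 ?_
          have h3 := lab_equiv (N := N) hft' z y'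
          rw [hfy'] at h3
          rw [lab_congr_right h1, ← h3]
          refine lab_congr_right ?_
          rw [dist_comm, h1, dist_comm, ← hlev, dist_comm]
    rcases hnice.captured z with h1 | ⟨u, hu, hd⟩
    · exact ⟨z, by rw [dist_self]; exact dist_pos.2 hzy, h1⟩
    · exact ⟨u, hd.trans_lt hsmall, hu⟩
  have hx'y : x' ≠ y' := by
    rintro rfl
    exact lt_irrefl _ hx'z
  have hzx' : dist y' x' = dist y' z := by
    rw [dist_comm, hX.dist_eq_of_near hx'z, dist_comm]
  have hcol : col N y x = col N y' x' := by
    rw [hcolz]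
    refine (col_congr hX ?_).symm
    rwa [dist_comm y' z]
  have hlab : lab N x y = lab N x' y' := congrArg (fun c => c.2.1) hcol
  have hlevel : ∀ q ∈ R, dist y q.1 = dist y x ↔ dist y' q.2 = dist y' x' := by
    intro q hq
    rw [hzx', ← hwx, ← hzw]
    exact hR.piso.dist_eq_iff hy hq hw
  have hxq : ∀ q ∈ R, x ≠ q.1 := fun q hq h1 => by
    have h2 := hfresh q hq
    rw [← h1, dist_self] at h2
    exact hx (dist_le_zero.1 h2)
  have hfresh' : ∀ q ∈ R, dist x' y' ≤ dist x' q.2 := by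
    intro q hq
    by_contra! h1
    have h2 := hX.level_eq_of_near h1
    have h3 := (hlevel q hq).2 h2
    have h4 : dist x q.1 = dist x y := by
      refine le_antisymm ((hX.ultrametric x y _).trans (max_le le_rfl ?_)) (hfresh q hq)
      rw [h3, dist_comm]
    refine lab_ne hX hN (hxq q hq) ?_
    rw [lab_congr_right h4, hlab, ← lab_congr_left hX h1, ← hR.piso.lab q hq _ hy]
    refine lab_congr_right ?_
    rw [dist_comm _ y, h3, dist_comm q.1, h4, dist_comm]
  have horb : orbit f f' (x, x') = {(x, x')} := by
    refine Subset.antisymm ?_ (singleton_subset_iff.2 ⟨0, rfl⟩)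
    rintro _ ⟨n, rfl⟩
    exact Prod.ext (Chain.zpow_fixed hfx n) (Chain.zpow_fixed hfx' n)
  refine ⟨x', ?_⟩
  rw [horb, union_singleton]
  refine PIso.insert_fresh hX hX hR.piso hy hx hx'y hfresh hfresh' ?_ ?_ hcol
  · intro q hq
    rw [hzx', ← hwx, ← hzw]
    exact ⟨hR.piso.dist _ hy w hw q hq, hR.piso.dist _ hy q hq w hw⟩
  · intro q hq hd
    have hd' := (hlevel q hq).1 hd.symm
    have key : ∀ {y x q : X}, dist y q = dist y x → dist x y ≤ dist x q →
        lab N x q = lab N x y ∧ lab N q x = lab N q y := by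
      intro y x q h1 h2
      have h4 : dist x q = dist x y := by
        refine le_antisymm ((hX.ultrametric x y _).trans (max_le le_rfl ?_)) h2
        rw [h1, dist_comm]
      refine ⟨lab_congr_right h4, lab_congr_right ?_⟩
      rw [dist_comm q, h4, dist_comm q, h1, dist_comm]
    have k1 := key hd.symm (hfresh q hq)
    have k2 := key hd' (hfresh' q hq)
    rw [lt_iff_lab_lt hX hN, lt_iff_lab_lt hX hN, k1.1, k1.2, k2.1, k2.2, hlab,
      hR.piso.lab q hq _ hy]

/-- A fixed point is added. -/
theorem exists_of_fixed (h : IsGeneric N X) (hf : f ∈ BP X) (hf' : f' ∈ BP X)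
    (hnice : IsNiceAut N f') (hR : Sys N f f' R) {x : X} (hfx : f x = x) :
    ∃ R', Sys N f f' R' ∧ R ⊆ R' ∧ ∃ x', (x, x') ∈ R' := by
  have hX := h.ordered
  have hft := h.isTreeEmb hf
  by_cases hxR : ∃ x', (x, x') ∈ R
  · exact ⟨R, hR, Subset.rfl, hxR⟩
  suffices hP : ∃ x', PIso N (R ∪ orbit f f' (x, x')) by
    obtain ⟨x', hP⟩ := hP
    exact ⟨_, hR.union_orbit h hf hP (Or.inl hfx), subset_union_left, x', Or.inr ⟨0, rfl⟩⟩
  obtain ⟨⟨y, y'⟩, hy, hfy, hmin⟩ := hR.exists_closest x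
  simp only at hfy hmin
  have hxy : x ≠ y := by
    rintro rfl
    exact hxR ⟨y', hy⟩
  by_cases hlev : ∃ w ∈ R, dist y w.1 = dist y x
  · obtain ⟨w, hw, hwx⟩ := hlev
    -- No point of `R` is closer to `x` than the closest fixed one: since `x` is fixed, such a point
    -- would move by less than `dist x y`, and the fixed point capturing it would be too close to
    -- `x`.
    have hfresh : ∀ p ∈ R, dist x y ≤ dist x p.1 := by
      intro p hp
      by_contra! h1
      have hpx : dist x (f p.1) < dist x y := by
        have h2 := (hft.2 x p.1 y).1 h1
        rwa [hfx, hfy] at h2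
      rcases hR.captured p hp with h2 | ⟨q, hq, hfq, hd⟩
      · exact (hmin p hp h2).not_gt h1
      · refine (hmin q hq hfq).not_gt ?_
        refine (hX.ultrametric x p.1 q.1).trans_lt (max_lt h1 (hd.trans_lt ?_))
        refine (hX.ultrametric p.1 x _).trans_lt (max_lt (by rwa [dist_comm]) hpx)
    by_cases hN : N = ⊤
    · exact hR.exists_of_new_branch h hN hf hf' hnice hy hfy hxy (by rw [hfx]) (Or.inl hfx) hfresh
        hw hwx
    · exact hR.exists_of_new_label h hN hf hf' hnice hy hfy hxy hfx hfresh hw hwx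
  · push Not at hlev
    exact hR.exists_of_new_level h hf hf' hnice hy hfy hxy (Or.inl hfx) hlev

/-- A captured moved point is added. -/
theorem exists_of_moved (h : IsGeneric N X) (hf : f ∈ BP X) (hf' : f' ∈ BP X)
    (hnf : IsNiceAut N f) (hnice : IsNiceAut N f') (hR : Sys N f f' R) {x : X}
    (hcap : ∃ q ∈ R, f q.1 = q.1 ∧ dist x q.1 ≤ dist x (f x)) :
    ∃ R', Sys N f f' R' ∧ R ⊆ R' ∧ ∃ x', (x, x') ∈ R' := by
  have hX := h.ordered
  have hft := h.isTreeEmb hf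
  have hmain : ∀ R, Sys N f f' R → (∃ q ∈ R, f q.1 = q.1 ∧ dist x q.1 ≤ dist x (f x)) →
      (∃ x', PIso N (R ∪ orbit f f' (x, x'))) →
      ∃ R', Sys N f f' R' ∧ R ⊆ R' ∧ ∃ x', (x, x') ∈ R' := by
    rintro R hR hcap ⟨x', hP⟩
    exact ⟨_, hR.union_orbit h hf hP (Or.inr hcap), subset_union_left, x', Or.inr ⟨0, rfl⟩⟩
  obtain ⟨⟨y, y'⟩, hy, hfy, hmin⟩ := hR.exists_closest x
  simp only at hfy hmin
  by_cases hxy : x = y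
  · subst hxy
    exact ⟨R, hR, Subset.rfl, y', hy⟩
  have hyx : dist x y ≤ dist x (f x) := by
    obtain ⟨q, hq, hfq, hd⟩ := hcap
    exact (hmin q hq hfq).trans hd
  by_cases hmove : dist y (f x) = dist y x
  swap
  · refine hmain R hR hcap ?_
    by_cases hlev : ∃ w ∈ R, dist y w.1 = dist y x
    · obtain ⟨w, hw, hwx⟩ := hlev
      exact hR.exists_of_level h hf hf' hy hfy hxy hmove hw hwx
    · push Not at hlev
      exact hR.exists_of_new_level h hf hf' hnice hy hfy hxy (Or.inr hmove) hlev
  have hbr : dist x (f x) = dist y x := by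
    refine le_antisymm ((hX.ultrametric x y _).trans (max_le ?_ hmove.le)) ?_
    · rw [dist_comm]
    · rwa [dist_comm y]
  -- With the level of `x` preserved, a moved branch would have the same label as its image, which
  -- is impossible for finite `N`.
  have hN : N = ⊤ := by
    by_contra hN
    have hne : f x ≠ x := fun h1 => by
      rw [h1, dist_self, eq_comm, dist_eq_zero] at hbr
      exact hxy hbr.symm
    refine lab_ne hX hN hne ?_
    have h3 := lab_equiv (N := N) hft x y
    rw [hfy] at h3
    rw [lab_congr_right (hbr.trans (dist_comm _ _)), ← h3]
    refine lab_congr_right ?_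
    rw [dist_comm, hbr, ← hmove, dist_comm]
  have key : ∀ R, Sys N f f' R → (y, y') ∈ R →
      (∃ q ∈ R, f q.1 = q.1 ∧ dist x q.1 ≤ dist x (f x)) →
      (∃ w ∈ R, dist y w.1 = dist y x) →
      ∃ R', Sys N f f' R' ∧ R ⊆ R' ∧ ∃ x', (x, x') ∈ R' := by
    rintro R hR hy hcap ⟨w, hw, hwx⟩
    refine hmain R hR hcap ?_
    by_cases hcone : ∃ p ∈ R, Near y x p.1
    · obtain ⟨p, hp, hpx⟩ := hcone
      exact hR.exists_of_cone h hN hf hf' hy hfy hxy hmove hbr hp hpx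
    · push Not at hcone
      exact hR.exists_of_new_branch h hN hf hf' hnice hy hfy hxy hmove (Or.inr hbr)
        (fun p hp => not_lt.1 (hcone p hp)) hw hwx
  have hyC : ({y} : Set X) ⊆ (nodeChain y x).carrier := by
    rintro _ rfl
    change dist _ _ ≤ _
    rw [dist_self]
    exact dist_nonneg
  -- The system may have no point on this level around `y`. Niceness of `f` on the branches provides
  -- a fixed point there, which is added before `x`.
  obtain ⟨z, -, hfz, -, hyz, -⟩ := (hnf.node hN y x (Ne.symm hxy) hfy hmove).exists_fixed_between
    (S := {y}) (T := ∅) (finite_singleton y) finite_empty hyC (empty_subset _) (by simp)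
    (mem_univ ())
  obtain ⟨R₁, hR₁, hsub, z', hz'⟩ := hR.exists_of_fixed h hf hf' hnice hfz
  obtain ⟨R₂, hR₂, hsub₂, hx⟩ := key R₁ hR₁ (hsub hy)
    (by
      obtain ⟨q, hq, h1⟩ := hcap
      exact ⟨q, hsub hq, h1⟩) ⟨_, hz', (hyz y rfl).2.2⟩
  exact ⟨R₂, hR₂, hsub.trans hsub₂, hx⟩

/-- A moved point is added only after a fixed point that captures it. This keeps the last clause of
`Sys` true and guarantees that the orbit leaves its level or branch around the closest fixed point.
-/
theorem exists_extension (h : IsGeneric N X) (hf : f ∈ BP X) (hf' : f' ∈ BP X)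
    (hnf : IsNiceAut N f) (hnice : IsNiceAut N f') (hR : Sys N f f' R) (x : X) :
    ∃ R', Sys N f f' R' ∧ R ⊆ R' ∧ ∃ x', (x, x') ∈ R' := by
  rcases hnf.captured x with hfx | ⟨y, hfy, hd⟩
  · exact hR.exists_of_fixed h hf hf' hnice hfx
  · obtain ⟨R₁, hR₁, hsub, y', hy⟩ := hR.exists_of_fixed h hf hf' hnice hfy
    obtain ⟨R₂, hR₂, hsub₂, hx⟩ := hR₁.exists_of_moved h hf hf' hnf hnice ⟨_, hy, hfy, hd⟩
    exact ⟨R₂, hR₂, hsub.trans hsub₂, hx⟩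

end Sys

/-! ### The comeager conjugacy class -/

variable {N : ℕ∞} {X : Type u} [MetricSpace X] [LinearOrder X]

/-- Any two generic automorphisms are conjugate. -/
theorem IsHomogeneous.exists_conj (h : IsHomogeneous N X) {f f' : Equiv.Perm X} (hf : f ∈ BP X)
    (hf' : f' ∈ BP X) (hnf : IsNiceAut N f) (hnf' : IsNiceAut N f') :
    ∃ e ∈ BP X, e * f = f' * e := by
  have := h.countable
  have hfix : ∀ {f : Equiv.Perm X}, IsNiceAut N f → ∃ y, f y = y := by
    intro f hnf
    obtain ⟨a⟩ := h.nonempty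
    rcases hnf.captured a with h1 | ⟨y, hy, -⟩
    · exact ⟨a, h1⟩
    · exact ⟨y, hy⟩
  obtain ⟨y, hy⟩ := hfix hnf
  obtain ⟨y', hy'⟩ := hfix hnf'
  have hsh : ∀ n : ℤ, shift f f' n (y, y') = (y, y') := fun n =>
    Prod.ext (Chain.zpow_fixed hy n) (Chain.zpow_fixed hy' n)
  have hinit : Sys N f f' {(y, y')} :=
    { piso := PIso.singleton y y'
      inv := by
        rintro _ rfl n
        exact hsh n
      fin := ⟨{(y, y')}, finite_singleton _, Subset.rfl, fun p hp => ⟨p, hp, 0, rfl⟩⟩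
      fixed := ⟨_, rfl, hy⟩
      captured := by
        rintro _ rfl
        exact Or.inl hy }
  obtain ⟨e, D, hmono, hD, hgraph, -⟩ := exists_equiv_of_back_and_forth (Sys N f f')
    (fun R hR x => hR.exists_extension h.toIsGeneric hf hf' hnf hnf' x)
    (fun R hR x' => by
      obtain ⟨R', hR', hsub, x, hx⟩ := hR.swap.exists_extension h.toIsGeneric hf' hf hnf' hnf x'
      exact ⟨_, hR'.swap, fun p hp => hsub (show p.swap ∈ _ from hp), x, hx⟩)
    (fun R hR p hp q hq => hR.piso.eq_iff hp hq) hinit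
  refine ⟨e, h.mem_BP e (isTreeEmb_of_graph hmono (fun n => (hD n).piso) hgraph), ?_⟩
  ext a
  obtain ⟨n, hn⟩ := hgraph a
  obtain ⟨m, hm⟩ := hgraph (f a)
  have h1 := hmono (le_max_left n m) ((hD n).apply_mem hn)
  have h2 := hmono (le_max_right n m) hm
  exact ((hD (max n m)).piso.eq_iff h2 h1).1 rfl

theorem IsHomogeneous.hasComeagerClass (h : IsHomogeneous N X) : HasComeagerClass (BP X) := by
  have := h.countable
  have := h.polishSpace
  have hres := h.eventually_isNiceAut
  obtain ⟨g, hg⟩ := (dense_of_mem_residual hres).nonempty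
  refine ⟨g, Filter.mem_of_superset hres fun f hf => ?_⟩
  obtain ⟨e, he, hef⟩ := h.exists_conj g.2 f.2 hg hf
  exact (isConj_iff.2 ⟨⟨e, he⟩, mul_inv_eq_iff_eq_mul.2 (Subtype.ext hef)⟩ : IsConj g f)

end OrdUltra

namespace OrdUltra

open Set Topology

universe u v w

/-! ### Words in pairs of automorphisms -/

section Words

variable {X : Type u} {G : Subgroup (Equiv.Perm X)} {ι : Type}

/-- The permutation given by a word in a tuple of permutations. -/
noncomputable def word (t : ι → G) (w : FreeGroup ι) : Equiv.Perm X := (FreeGroup.lift t w).1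

theorem word_one (t : ι → G) : word t 1 = 1 := by simp [word]

theorem word_mul (t : ι → G) (w w' : FreeGroup ι) : word t (w * w') = word t w * word t w' := by
  simp [word]

theorem word_of (t : ι → G) (i : ι) : word t (FreeGroup.of i) = (t i).1 := by simp [word]

theorem word_inv (t : ι → G) (w : FreeGroup ι) : word t w⁻¹ = (word t w)⁻¹ := by simp [word]

theorem word_mem (t : ι → G) (w : FreeGroup ι) : word t w ∈ G := (FreeGroup.lift t w).2

/-- A property of points closed under the letters and their inverses is closed under words. -/
theorem word_induction {t : ι → G} {P : X → Prop} (h1 : ∀ i c, P c → P ((t i).1 c))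
    (h2 : ∀ i c, P c → P ((t i).1⁻¹ c)) (w : FreeGroup ι) {c : X} (hc : P c) : P (word t w c) := by
  induction w using FreeGroup.induction_on generalizing c with
  | C1 => simpa [word_one] using hc
  | of i =>
    rw [word_of]
    exact h1 i c hc
  | inv_of i _ =>
    rw [word_inv, word_of]
    exact h2 i c hc
  | mul w w' hw hw' =>
    rw [word_mul]
    exact hw (hw' hc)

theorem exists_finset_word (t : ι → G) (w : FreeGroup ι) (a : X) :
    ∃ F : Finset X, ∀ t' : ι → G, (∀ i, ∀ u ∈ F, (t' i).1 u = (t i).1 u) →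
      word t' w a = word t w a := by
  classical
  induction w using FreeGroup.induction_on generalizing a with
  | C1 => exact ⟨∅, fun t' _ => by rw [word_one, word_one]⟩
  | of i => exact ⟨{a}, fun t' h => by rw [word_of, word_of, h i a (by simp)]⟩
  | inv_of i _ =>
    refine ⟨{(t i).1⁻¹ a}, fun t' h => ?_⟩
    rw [word_inv, word_inv, word_of, word_of, Equiv.Perm.inv_eq_iff_eq, h i _ (by simp),
      perm_apply_inv_self]
  | mul w w' hw hw' =>
    obtain ⟨F, hF⟩ := hw (word t w' a)
    obtain ⟨F', hF'⟩ := hw' a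
    refine ⟨F ∪ F', fun t' h => ?_⟩
    rw [word_mul, word_mul, Equiv.Perm.mul_apply, Equiv.Perm.mul_apply,
      hF' t' fun i u hu => h i u (by simp [hu]), hF t' fun i u hu => h i u (by simp [hu])]

theorem word_conj (t : ι → G) (k : G) (w : FreeGroup ι) :
    k.1 * word (fun i => k⁻¹ * t i * k) w = word t w * k.1 := by
  induction w using FreeGroup.induction_on with
  | C1 => simp [word_one]
  | of i => simp [word_of, mul_assoc]
  | inv_of i _ => simp [word_of, word_inv, mul_assoc]
  | mul w w' hw hw' => rw [word_mul, word_mul, ← mul_assoc, hw, mul_assoc, hw', mul_assoc]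

end Words

/-! ### There is no generic pair -/

variable {N : ℕ∞} {X : Type u} [MetricSpace X] [LinearOrder X]

theorem word_fixed {t : Fin 2 → BP X} {x : X} (hx : ∀ i, (t i).1 x = x) (w : FreeGroup (Fin 2)) :
    word t w x = x := by
  refine word_induction (P := fun c => c = x) ?_ ?_ w rfl
  · rintro i c rfl
    exact hx i
  · rintro i c rfl
    rw [Equiv.Perm.inv_eq_iff_eq, hx i]

theorem IsHomogeneous.dist_word_lt (h : IsHomogeneous N X) {t : Fin 2 → BP X} {x : X}
    (hx : ∀ i, (t i).1 x = x) (w : FreeGroup (Fin 2)) (u v : X) :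
    dist x u < dist x v ↔ dist x (word t w u) < dist x (word t w v) :=
  (h.isTreeEmb (word_mem t w)).dist_lt_of_fixed (word_fixed hx w) u v

theorem IsHomogeneous.dist_word_le (h : IsHomogeneous N X) {t : Fin 2 → BP X} {x : X}
    (hx : ∀ i, (t i).1 x = x) (w : FreeGroup (Fin 2)) (u v : X) :
    dist x u ≤ dist x v ↔ dist x (word t w u) ≤ dist x (word t w v) := by
  rw [← not_lt, ← not_lt, h.dist_word_lt hx w]

/-- The relative levels of the points of an orbit of a pair are not determined by the values of the
pair on a finite set. -/
theorem IsHomogeneous.exists_undetermined (h : IsHomogeneous N X) (t : Fin 2 → BP X) {x a : X}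
    (hx : ∀ i, (t i).1 x = x) (ha : dist x ((t 0).1 a) ≠ dist x a) (F : Finset X) :
    ∃ (w w' : FreeGroup (Fin 2)) (t₁ t₂ : Fin 2 → BP X),
      (∀ i, ∀ u ∈ F, (t₁ i).1 u = (t i).1 u) ∧ (∀ i, ∀ u ∈ F, (t₂ i).1 u = (t i).1 u) ∧
      dist x (word t₁ w a) < dist x (word t₁ w' a) ∧
      ¬ dist x (word t₂ w a) < dist x (word t₂ w' a) := by
  classical
  have hX := h.ordered
  -- The prescribed points whose level is bounded by the orbit of `a`. The other prescribed points
  -- are strictly above the whole orbit.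
  set B : Set X := {b | b ∈ insert a (F ∪ F.image (t 0).1 ∪ F.image (t 1).1) ∧
    ∃ w, dist x b ≤ dist x (word t w a)} with hB
  have hBfin : B.Finite := (Finset.finite_toSet _).subset fun b hb => hb.1
  have haB : a ∈ B := ⟨by simp, 1, by rw [word_one]; rfl⟩
  have hFB : ∀ j, ∀ u ∈ F, u ∈ B → (t j).1 u ∈ B := by
    rintro j u hu ⟨-, w, hw⟩
    refine ⟨?_, FreeGroup.of j * w, ?_⟩
    · fin_cases j
      · simp [hu]
      · simp [hu]
    · rw [h.dist_word_le hx (FreeGroup.of j), word_of] at hw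
      rwa [word_mul, word_of]
  have hFB' : ∀ j, ∀ u ∈ F, (t j).1 u ∈ B → u ∈ B := by
    rintro j u hu ⟨-, w, hw⟩
    refine ⟨by simp [hu], (FreeGroup.of j)⁻¹ * w, ?_⟩
    rw [h.dist_word_le hx (FreeGroup.of j)⁻¹, word_inv, word_of, perm_inv_apply_self] at hw
    rwa [word_mul, word_inv, word_of]
  set Low : X → Prop := fun c => ∃ b ∈ B, dist x c ≤ dist x b with hLow
  -- some point of the orbit is above all low points
  have hex : ∃ w, ¬ Low (word t w a) := by
    obtain ⟨b, hb, hbmax⟩ := hBfin.exists_maximalFor (fun u => dist x u) B ⟨a, haB⟩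
    have hmax : ∀ u ∈ B, dist x u ≤ dist x b := fun u hu => by
      rcases le_total (dist x u) (dist x b) with h1 | h1
      · exact h1
      · exact hbmax hu h1
    obtain ⟨-, w, hw⟩ := hb
    have hnl : ∀ c, dist x (word t w a) < dist x c → ¬ Low c := by
      rintro c hc ⟨u, hu, hcu⟩
      exact (hw.trans_lt hc).not_ge (hcu.trans (hmax u hu))
    rcases lt_or_gt_of_ne ha with h1 | h1
    · refine ⟨w * (FreeGroup.of 0)⁻¹, hnl _ ?_⟩
      rw [h.dist_word_lt hx (FreeGroup.of 0)⁻¹, h.dist_word_lt hx w, word_inv, word_of,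
        perm_inv_apply_self] at h1
      rwa [word_mul, word_inv, word_of]
    · refine ⟨w * FreeGroup.of 0, hnl _ ?_⟩
      rw [h.dist_word_lt hx w] at h1
      rwa [word_mul, word_of]
  -- The low points of the orbit that are reached using only values of the pair between low points;
  -- `E` records where these values are taken.
  set S : X → Prop := fun c => Low c ∧ ∃ (w : FreeGroup (Fin 2)) (E : Fin 2 → Finset X),
    (∀ i, ∀ u ∈ E i, Low u ∧ Low ((t i).1 u)) ∧
    ∀ t' : Fin 2 → BP X, (∀ i, ∀ u ∈ E i, (t' i).1 u = (t i).1 u) → word t' w a = c with hS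
  have haS : S a := ⟨⟨a, haB, le_rfl⟩, 1, fun _ => ∅, by simp, fun t' _ => by rw [word_one]; rfl⟩
  -- The first exit of the orbit from the low points, at `d`, by the generator `i` or its inverse.
  -- If there were none, the whole orbit would stay low by induction on words. For the other
  -- generator only values between low points have been used.
  obtain ⟨d, hd, i, w, E, hE, hw⟩ : ∃ d, ¬ Low d ∧ ∃ (i : Fin 2) (w : FreeGroup (Fin 2))
      (E : Fin 2 → Finset X), (∀ j, j ≠ i → ∀ u ∈ E j, Low u ∧ Low ((t j).1 u)) ∧
      ∀ t' : Fin 2 → BP X, (∀ j, ∀ u ∈ E j, (t' j).1 u = (t j).1 u) → word t' w a = d := by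
    by_contra! hcon
    obtain ⟨w, hw⟩ := hex
    have hstep : ∀ (i : Fin 2) (v : FreeGroup (Fin 2)) (c d e : X), S c → (∀ (w : FreeGroup (Fin 2)) (t' : Fin 2 → BP X), word t' w a = c →
        (t' i).1 e = (t i).1 e → word t' (v * w) a = d) → (Low c → Low d → Low e ∧ Low ((t i).1 e)) →
        S d := by
      rintro i v c d e ⟨hc, w, E, hE, hw⟩ h1 h2
      have h3 : ∀ t' : Fin 2 → BP X,
          (∀ j, ∀ u ∈ Function.update E i (insert e (E i)) j, (t' j).1 u = (t j).1 u) →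
          word t' (v * w) a = d := by
        intro t' ht'
        refine h1 w t' (hw t' fun j u hu => ht' j u ?_) (ht' i e (by simp))
        by_cases hj : j = i
        · subst hj
          simp [hu]
        · simpa [Function.update_of_ne hj] using hu
      have hd : Low d := by
        by_contra hd
        obtain ⟨t', ht', hne⟩ := hcon d hd i (v * w) (Function.update E i (insert e (E i)))
          fun j hj u hu => hE j u (by simpa [Function.update_of_ne hj] using hu)
        exact hne (h3 t' ht')
      refine ⟨hd, v * w, _, fun j u hu => ?_, h3⟩
      by_cases hj : j = i
      · subst hj
        rw [Function.update_self, Finset.mem_insert] at hu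
        rcases hu with rfl | hu
        · exact h2 hc hd
        · exact hE j u hu
      · exact hE j u (by simpa [Function.update_of_ne hj] using hu)
    refine hw (word_induction (P := S) (fun i c hc => ?_) (fun i c hc => ?_) w haS).1
    · refine hstep i (FreeGroup.of i) c _ c hc (fun w t' h1 h2 => ?_) fun h1 h2 => ⟨h1, h2⟩
      rw [word_mul, word_of, Equiv.Perm.mul_apply, h1, h2]
    · refine hstep i (FreeGroup.of i)⁻¹ c _ ((t i).1⁻¹ c) hc (fun w t' h1 h2 => ?_) fun h1 h2 => ?_
      · rw [word_mul, word_inv, word_of, Equiv.Perm.mul_apply, h1, Equiv.Perm.inv_eq_iff_eq, h2,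
          perm_apply_inv_self]
      · rw [perm_apply_inv_self]
        exact ⟨h2, h1⟩
  -- Here two generators are needed: `t i` may be committed at `d` by the step leading there, but `t
  -- j` is not.
  obtain ⟨j, hji⟩ := exists_ne i
  have hdorb : word t w a = d := hw t fun _ _ _ => rfl
  have hBd : ∀ b ∈ B, dist x b < dist x d := fun b hb => by
    by_contra! h1
    exact hd ⟨b, hb, h1⟩
  have hdx : d ≠ x := by
    rintro rfl
    have := hBd a haB
    rw [dist_self] at this
    exact this.not_ge dist_nonneg
  -- All values of the `j`-th member to be kept go from low points to low points, or from above `d`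
  -- to above `z`. So `d` may be sent to `z`.
  have hins : ∀ z, z ≠ x → col N x z = col N x d → (∀ b ∈ B, dist x b < dist x z) →
      (∀ u ∈ F.image (t j).1, u ∉ B → dist x z < dist x u) →
      ∃ t' : Fin 2 → BP X, (∀ i, ∀ u ∈ F, (t' i).1 u = (t i).1 u) ∧ word t' w a = d ∧
        word t' (FreeGroup.of j * w) a = z := by
    intro z hz hcol hzB hzF
    have hhigh : ∀ u ∈ F, u ∉ B → dist x d < dist x u := by
      intro u hu huB
      by_contra! h1
      exact huB ⟨by simp [hu], w, by rwa [hdorb]⟩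
    have hlow : ∀ u, Low u → dist x u < dist x d ∧ dist x u < dist x z := by
      rintro u ⟨b, hb, hub⟩
      exact ⟨hub.trans_lt (hBd b hb), hub.trans_lt (hzB b hb)⟩
    obtain ⟨f', hf', hag, hfd⟩ := h.exists_insert_level (t j).2 (hx j) (F := insert x (F ∪ E j))
      (by simp) hdx hz hcol.symm (by
        intro u hu hux
        simp only [Finset.mem_insert, Finset.mem_union] at hu
        rcases hu.resolve_left hux with hu | hu
        · by_cases huB : u ∈ B
          · exact Or.inl ⟨hBd u huB, hzB _ (hFB j u hu huB)⟩
          · exact Or.inr ⟨hhigh u hu huB,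
              hzF _ (Finset.mem_image_of_mem _ hu) (mt (hFB' j u hu) huB)⟩
        · exact Or.inl ⟨(hlow _ (hE j hji u hu).1).1, (hlow _ (hE j hji u hu).2).2⟩)
    set t' : Fin 2 → BP X := Function.update t j ⟨f', hf'⟩ with ht'
    have htj : (t' j).1 = f' := by simp [ht']
    have hag' : ∀ i, ∀ u, (u ∈ F ∨ u ∈ E i) → (t' i).1 u = (t i).1 u := by
      intro i u hu
      by_cases hi : i = j
      · subst hi
        rw [htj]
        exact hag u (by simp [hu])
      · rw [ht', Function.update_of_ne hi]
    have hw' := hw t' fun i u hu => hag' i u (Or.inr hu)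
    refine ⟨t', fun i u hu => hag' i u (Or.inl hu), hw', ?_⟩
    rw [word_mul, word_of, Equiv.Perm.mul_apply, hw', htj, hfd]
  have hcold := col_mem_colors (N := N) hX hdx.symm
  have hhigh : ∀ u ∈ F.image (t j).1, u ∉ B → dist x d < dist x u := by
    intro u hu huB
    by_contra! h1
    refine huB ⟨?_, w, by rwa [hdorb]⟩
    fin_cases j
    · exact Finset.mem_insert_of_mem (Finset.mem_union_left _ (Finset.mem_union_right _ hu))
    · exact Finset.mem_insert_of_mem (Finset.mem_union_right _ hu)
  -- Two admissible images of `d`, with level below and above that of `d`; they decide the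
  -- comparison differently.
  obtain ⟨z₁, hz₁, hc₁, hl₁, hu₁⟩ := h.exists_level (y := x) B {d} hBfin (finite_singleton d)
    (fun b hb u hu => by rw [hu]; exact hBd b hb) (fun h1 => hdx h1.symm) hcold
  obtain ⟨z₂, hz₂, hc₂, hl₂, hu₂⟩ := h.exists_level (y := x) {d} {u | u ∈ F.image (t j).1 ∧ u ∉ B}
    (finite_singleton d) ((Finset.finite_toSet _).subset fun u hu => hu.1)
    (fun b hb u hu => by rw [hb]; exact hhigh u hu.1 hu.2)
    (fun h1 => by
      have := hhigh x h1.1 h1.2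
      rw [dist_self] at this
      exact this.not_ge dist_nonneg) hcold
  have hd₁ := hu₁ d rfl
  have hd₂ := hl₂ d rfl
  obtain ⟨t₁, ht₁, hw₁, hv₁⟩ := hins z₁ hz₁ hc₁ hl₁ fun u hu huB => hd₁.trans (hhigh u hu huB)
  obtain ⟨t₂, ht₂, hw₂, hv₂⟩ := hins z₂ hz₂ hc₂ (fun b hb => (hBd b hb).trans hd₂)
    fun u hu huB => hu₂ u ⟨hu, huB⟩
  refine ⟨FreeGroup.of j * w, w, t₁, t₂, ht₁, ht₂, ?_, ?_⟩
  · rwa [hw₁, hv₁]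
  · rw [hw₂, hv₂]
    exact hd₂.not_gt

theorem colors_nonempty (hN : 2 ≤ N) : (colors N).Nonempty := by
  by_cases h : N = ⊤
  · exact ⟨(0, 0, True), fun _ => ⟨rfl, rfl⟩, fun h1 => absurd h h1⟩
  · refine ⟨(0, 1, True), fun h1 => absurd h1 h, fun _ => ⟨?_, ?_, by simp, by simp⟩⟩
    · exact lt_of_lt_of_le (by simp) hN
    · exact lt_of_lt_of_le (by norm_num) hN

theorem IsHomogeneous.not_hasComeagerDiagonalClass (h : IsHomogeneous N X) (hN : 2 ≤ N) :
    ¬ HasComeagerDiagonalClass 2 (BP X) := by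
  rintro ⟨g, hg⟩
  have := h.countable
  have := h.polishSpace
  have hX := h.ordered
  obtain ⟨x⟩ := h.nonempty
  obtain ⟨k, hk⟩ := colors_nonempty hN
  -- Two points of equal color on different levels around `x`: some automorphism fixes `x` and moves
  -- the level of `a`. This makes `U` below nonempty.
  obtain ⟨a, hax, hca, -⟩ := h.level x ∅ ∅ (by simp) (by simp) k hk
  obtain ⟨b, hbx, hcb, hab, -⟩ := h.level x {a} ∅ (by simp) (by simp) k hk
  have hab := hab a (by simp)
  obtain ⟨s, hs, hsR⟩ := h.extend (insert (a, b) {(x, x)}) (by simp)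
    (PIso.pair hX hX hax hbx (hca.trans hcb.symm))
  have hsx : s x = x := hsR (x, x) (by simp)
  have hsa : s a = b := hsR (a, b) (by simp)
  -- the relative levels of the points of the orbit
  set C : X × X → Set (Fin 2 → BP X) := fun p => {t | ∀ w w' : FreeGroup (Fin 2),
    dist x (word t w a) < dist x (word t w' a) ↔
      dist p.1 (word g w p.2) < dist p.1 (word g w' p.2)} with hC
  have hclosed : ∀ p, IsClosed (C p) := by
    intro p
    rw [← isOpen_compl_iff]
    refine isOpen_pi_subgroup_of fun t ht => ?_
    classical
    simp only [hC, mem_compl_iff, mem_ofPred_eq, not_forall] at ht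
    obtain ⟨w, w', hww⟩ := ht
    obtain ⟨F, hF⟩ := exists_finset_word t w a
    obtain ⟨F', hF'⟩ := exists_finset_word t w' a
    refine ⟨F ∪ F', fun t' ht' hmem => hww ?_⟩
    have h1 := hmem w w'
    rwa [hF t' fun i u hu => ht' i u (by simp [hu]),
      hF' t' fun i u hu => ht' i u (by simp [hu])] at h1
  have hcover : diagonalClass g ⊆ ⋃ p, C p := by
    rintro t ⟨k, hkt⟩
    have ht : t = fun i => k⁻¹ * g i * k := funext hkt
    -- The conjugating element carries `x` and `a` to the parameters. As `X` is countable, there are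
    -- only countably many sets `C p`.
    refine mem_iUnion.2 ⟨(k.1 x, k.1 a), fun w w' => ?_⟩
    have hword : ∀ w : FreeGroup (Fin 2), word g w (k.1 a) = k.1 (word t w a) := fun w => by
      have h1 := congrArg (fun e : Equiv.Perm X => e a) (word_conj g k w)
      rw [ht]
      exact h1.symm
    simp only [hword]
    exact (h.isTreeEmb k.2).2 _ _ _
  -- A dense Gδ set covered by countably many closed sets: by Baire's theorem the union of their
  -- interiors is dense, so it meets `U`.
  obtain ⟨D, hDsub, hDG, hDd⟩ := mem_residual.1 hg
  have hdense := hDG.dense_iUnion_interior_of_closed hDd hclosed (hDsub.trans hcover)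
  set U : Set (Fin 2 → BP X) := {t | (∀ i, (t i).1 x = x) ∧ dist x ((t 0).1 a) ≠ dist x a} with hU
  have hUo : IsOpen U := by
    classical
    refine isOpen_pi_subgroup_of fun t ht => ⟨{x, a}, fun t' ht' => ⟨fun i => ?_, ?_⟩⟩
    · rw [ht' i x (by simp), ht.1 i]
    · rw [ht' 0 a (by simp)]
      exact ht.2
  have hUne : U.Nonempty := by
    refine ⟨fun _ => ⟨s, hs⟩, fun _ => hsx, ?_⟩
    change dist x (s a) ≠ dist x a
    rw [hsa]
    exact hab.ne'
  obtain ⟨t, htU, ht⟩ := hdense.inter_open_nonempty U hUo hUne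
  obtain ⟨p, hp⟩ := mem_iUnion.1 ht
  obtain ⟨F, hF⟩ := exists_finset_of_isOpen_pi isOpen_interior hp
  obtain ⟨w, w', t₁, t₂, ht₁, ht₂, h1, h2⟩ := h.exists_undetermined t htU.1 htU.2 F
  have h3 := interior_subset (hF t₁ ht₁) w w'
  have h4 := interior_subset (hF t₂ ht₂) w w'
  exact h2 (h4.2 (h3.1 h1))

end OrdUltra

theorem mainTheorem6 (N : ℕ∞) (hN : 2 ≤ N) :
    (∃ (X : Type) (_ : MetricSpace X) (_ : LinearOrder X), OrdUltra.IsUrysohn N X) ∧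
    ∀ (X : Type*) [MetricSpace X] [LinearOrder X], OrdUltra.IsUrysohn N X →
      OrdUltra.HasComeagerClass (OrdUltra.BP X) ∧
      ¬ OrdUltra.HasComeagerDiagonalClass 2 (OrdUltra.BP X) := by
  refine ⟨?_, fun X _ _ hX => ?_⟩
  · obtain ⟨X, hm, hl, hX⟩ := OrdUltra.exists_isHomogeneous N hN
    exact ⟨X, hm, hl, hX.isUrysohn⟩
  · have h := hX.isHomogeneous hN
    exact ⟨h.hasComeagerClass, h.not_hasComeagerDiagonalClass hN⟩
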